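/- **Theorem.** A temporal graph $\mathcal{G}=([n],\mathcal{E},\tau)$ with $\tau\ge 1$ and $\mathcal{E}\subseteq\binom{[n]}{2}\times\{1,\dots,\tau\}$ is a *temporal permutation graph* if there are permutations $\pi_1,\dots,\pi_\tau$ of $[n]$ such that, for all $t$ and all vertices $v<w$, $(\{v,w\},t)\in\mathcal{E}$ if and only if $\pi_t(w)<\pi_t(v)$. These permutations are then uniquely determined; let $d_\Sigma:=\sum_{t=1}^{\tau-1}d_{\mathrm{Kt}}(\pi_t,\pi_{t+1})$, where the Kendall tau distance $d_{\mathrm{Kt}}(\pi,\rho)$ is the number of pairs $v<w$ whose images are ordered differently by $\pi$ and by $\rho$. A *temporal $(s,z)$-path* is a sequence of time-edges $(\{v_{i-1},v_i\},t_i)\in\mathcal{E}$, $i=1,\dots,\ell$, with $v_0=s$, $v_\ell=z$, pairwise distinct vertices $v_0,\dots,v_\ell$ and $t_1\le\dots\le t_\ell$. A *temporal $(s,z)$-separator* is a set of vertices that contains neither $s$ nor $z$ and whose removal destroys all temporal $(s,z)$-paths. There is an algorithm that, given a temporal permutation graph $\mathcal{G}$ (by the list of its time-edges in any order, without the permutations),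 two distinct vertices $s,z\in[n]$ and $k\in\mathbb{N}=\{0,1,2,\dots\}$, decides whether $\mathcal{G}$ has a temporal $(s,z)$-separator of size at most $k$ in time $$O\bigl((d_\Sigma(2k+1))^k\cdot n\cdot|\mathcal{E}|+\tau n^2\bigr),$$ with an absolute constant in the $O$ and $0^0=1$. Time is counted on a word RAM with unit-cost operations on words of at least $c\log_2(n+\tau+k+|\mathcal{E}|)$ bits, for an absolute constant $c$. -/

import Mathlib

/-! ## Temporal graphs -/

/-- A temporal graph with vertex set `V` and lifetime `τ`: a finite set of time-edges, each of which
is a two-element subset of `V` together with a time label. The labels `1, …, τ` are written as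
the elements `0, …, τ - 1` of `Fin τ`. -/
structure TemporalGraph (V : Type*) (τ : ℕ) where
  edges : Finset (Sym2 V × Fin τ)
  loopless : ∀ e ∈ edges, ¬ e.1.IsDiag

namespace TemporalGraph

variable {V : Type*} {τ : ℕ}

/-- The vertices `v 0, …, v ℓ` and the time labels `t 0, …, t (ℓ - 1)` form a (non-strict) temporal
walk of length `ℓ` from `s` to `z`. -/
structure IsTemporalWalk (G : TemporalGraph V τ) (s z : V) (ℓ : ℕ)
    (v : Fin (ℓ + 1) → V) (t : Fin ℓ → Fin τ) : Prop where
  start : v 0 = s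
  finish : v (Fin.last ℓ) = z
  edge : ∀ i : Fin ℓ, (s(v i.castSucc, v i.succ), t i) ∈ G.edges
  mono : Monotone t

/-- A temporal path is a temporal walk that visits every vertex at most once. -/
structure IsTemporalPath (G : TemporalGraph V τ) (s z : V) (ℓ : ℕ)
    (v : Fin (ℓ + 1) → V) (t : Fin ℓ → Fin τ) : Prop extends
    G.IsTemporalWalk s z ℓ v t where
  inj : Function.Injective v

open Classical in
/-- Removal of the vertices in `S`: all time-edges with an endpoint in `S` disappear. The vertices
in `S` stay behind as isolated vertices, which no path between two vertices outside `S` visits. -/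
noncomputable def deleteVerts (G : TemporalGraph V τ) (S : Finset V) : TemporalGraph V τ where
  edges := G.edges.filter fun e => ∀ v ∈ S, v ∉ e.1
  loopless := fun e he => G.loopless e (Finset.mem_filter.mp he).1

/-- `S` is a temporal `(s, z)`-separator: it contains neither `s` nor `z`, and its removal destroys
all temporal paths from `s` to `z`. -/
def IsSeparator (G : TemporalGraph V τ) (s z : V) (S : Finset V) : Prop :=
  s ∉ S ∧ z ∉ S ∧
    ¬ ∃ (ℓ : ℕ) (v : Fin (ℓ + 1) → V) (t : Fin ℓ → Fin τ), (G.deleteVerts S).IsTemporalPath s z ℓ v t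

/-- The question of the problem Temporal `(s, z)`-Separation with separator size `k`. -/
def HasSeparatorOfSize (G : TemporalGraph V τ) (s z : V) (k : ℕ) : Prop :=
  ∃ S : Finset V, G.IsSeparator s z S ∧ S.card ≤ k

/-- `G` is the temporal permutation graph given by the permutations `π 0, …, π (τ - 1)`: in
layer `t`, two vertices are adjacent if and only if `π t` inverts their order. -/
def IsPermutationGraphOf {n : ℕ} (G : TemporalGraph (Fin n) τ)
    (π : Fin τ → Equiv.Perm (Fin n)) : Prop :=
  ∀ (t : Fin τ) (v w : Fin n), v < w → ((s(v, w), t) ∈ G.edges ↔ π t w < π t v)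

/-- The list `l` contains every time-edge of `G` exactly once, in an arbitrary order and with the
endpoints of each edge in an arbitrary order. -/
def IsEdgeList (G : TemporalGraph V τ) (l : List (V × V × Fin τ)) : Prop :=
  (l.map fun e => (s(e.1, e.2.1), e.2.2)).Nodup ∧
    ∀ x, x ∈ (l.map fun e => (s(e.1, e.2.1), e.2.2)) ↔ x ∈ G.edges

end TemporalGraph

/-! ## Kendall tau distance -/

/-- The Kendall tau distance of two permutations of `Fin n`: the number of pairs of elements that
are ordered differently by the two total orders "`v` before `w` iff `σ v < σ w`"
and "`v` before `w` iff `ρ v < ρ w`". -/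
def kendallTau {n : ℕ} (σ ρ : Equiv.Perm (Fin n)) : ℕ :=
  (Finset.univ.filter fun p : Fin n × Fin n =>
    p.1 < p.2 ∧ ¬ (σ p.1 < σ p.2 ↔ ρ p.1 < ρ p.2)).card

/-- The sum of the Kendall tau distances of consecutive members of a sequence of permutations. -/
def kendallTauSum {n τ : ℕ} (π : Fin τ → Equiv.Perm (Fin n)) : ℕ :=
  ∑ t : Fin τ, if h : (t : ℕ) + 1 < τ then kendallTau (π t) (π ⟨(t : ℕ) + 1, h⟩) else 0

/-! ## Word RAM

A random access machine with words of `w` bits, programmed by structured programs. A program uses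
finitely many registers and finitely many arrays of words (banks of memory with random access).
Every arithmetic operation, comparison and memory access takes one unit of time. -/

namespace WordRAM

/-- The contents of the registers and of the arrays. -/
structure State where
  reg : ℕ → ℕ
  arr : ℕ → ℕ → ℕ

/-- Expressions: constants, registers, array accesses `arr a [i]`, sum, truncated difference,
product and the comparisons `<` and `=` (with value `1` for true and `0` for false). -/
inductive Expr where
  | const (c : ℕ)
  | reg (x : ℕ)
  | load (a : ℕ) (i : Expr)
  | add (e f : Expr)
  | sub (e f : Expr)
  | mul (e f : Expr)
  | lt (e f : Expr)
  | eq (e f : Expr)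

/-- The value of an expression on a machine with words of `w` bits (arithmetic modulo `2 ^ w`). -/
def Expr.eval (w : ℕ) (σ : State) : Expr → ℕ
  | const c => c % 2 ^ w
  | reg x => σ.reg x
  | load a i => σ.arr a (i.eval w σ)
  | add e f => (e.eval w σ + f.eval w σ) % 2 ^ w
  | sub e f => e.eval w σ - f.eval w σ
  | mul e f => (e.eval w σ * f.eval w σ) % 2 ^ w
  | lt e f => if e.eval w σ < f.eval w σ then 1 else 0
  | eq e f => if e.eval w σ = f.eval w σ then 1 else 0

/-- The time for evaluating an expression: its number of constants, registers and operations. -/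
def Expr.cost : Expr → ℕ
  | const _ => 1
  | reg _ => 1
  | load _ i => i.cost + 1
  | add e f => e.cost + f.cost + 1
  | sub e f => e.cost + f.cost + 1
  | mul e f => e.cost + f.cost + 1
  | lt e f => e.cost + f.cost + 1
  | eq e f => e.cost + f.cost + 1

/-- Programs: `assign x e` is `reg x := e`, `store a i e` is `arr a [i] := e`, and `loop e p` is
`while e ≠ 0 do p`. -/
inductive Program where
  | skip
  | assign (x : ℕ) (e : Expr)
  | store (a : ℕ) (i e : Expr)
  | seq (p q : Program)
  | ite (e : Expr) (p q : Program)
  | loop (e : Expr) (p : Program)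

/-- `Exec w p σ T σ'`: with words of `w` bits, the program `p` started in state `σ` terminates after
exactly `T` units of time in state `σ'`. -/
inductive Exec (w : ℕ) : Program → State → ℕ → State → Prop where
  | skip (σ : State) : Exec w .skip σ 1 σ
  | assign (x : ℕ) (e : Expr) (σ : State) :
      Exec w (.assign x e) σ (e.cost + 1)
        ⟨Function.update σ.reg x (e.eval w σ), σ.arr⟩
  | store (a : ℕ) (i e : Expr) (σ : State) :
      Exec w (.store a i e) σ (i.cost + e.cost + 1)
        ⟨σ.reg, Function.update σ.arr a (Function.update (σ.arr a) (i.eval w σ) (e.eval w σ))⟩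
  | seq {p q : Program} {σ σ' ρ : State} {T T' : ℕ} :
      Exec w p σ T σ' → Exec w q σ' T' ρ → Exec w (.seq p q) σ (T + T') ρ
  | ite_true {e : Expr} {p q : Program} {σ σ' : State} {T : ℕ} :
      e.eval w σ ≠ 0 → Exec w p σ T σ' → Exec w (.ite e p q) σ (e.cost + 1 + T) σ'
  | ite_false {e : Expr} {p q : Program} {σ σ' : State} {T : ℕ} :
      e.eval w σ = 0 → Exec w q σ T σ' → Exec w (.ite e p q) σ (e.cost + 1 + T) σ'
  | loop_true {e : Expr} {p : Program} {σ σ' ρ : State} {T T' : ℕ} :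
      e.eval w σ ≠ 0 → Exec w p σ T σ' → Exec w (.loop e p) σ' T' ρ →
        Exec w (.loop e p) σ (e.cost + 1 + T + T') ρ
  | loop_false {e : Expr} {p : Program} {σ : State} :
      e.eval w σ = 0 → Exec w (.loop e p) σ (e.cost + 1) σ

/-- The initial state for an input word list: array `0` contains the input, and everything else
is `0`. -/
def initState (input : List ℕ) : State where
  reg := fun _ => 0
  arr := fun a i => if a = 0 then input.getD i 0 else 0

end WordRAM

/-- The encoding of an instance of Temporal `(s, z)`-Separation on the vertices `0, …, n - 1`, with
the time-edges given by the list `l`, as a list of words. -/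
def encodeInstance {n τ : ℕ} (l : List (Fin n × Fin n × Fin τ)) (s z : Fin n) (k : ℕ) : List ℕ :=
  [n, τ, (s : ℕ), (z : ℕ), k, l.length] ++
    l.flatMap fun e => [(e.1 : ℕ), (e.2.1 : ℕ), (e.2.2 : ℕ)]

/-!
In a permutation graph, every vertex between the endpoints of an edge is adjacent to one of them.
Hence the vertices that temporal paths from `s` avoiding a set `S` have reached up to some time form
an interval, up to the vertices of `S`, and `S` is a separator if and only if it has a *barrier*
(`hasSeparatorOfSize_iff`): thresholds `β 0 ≤ β 1 ≤ ⋯` between `s` and `z` such that `S` hits all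
edges of layer `t` across the threshold `β t`. (If `z < s`, both orders are reversed first.) In the
drawing of a layer as segments between two parallel lines, `S` hits these edges if and only if it
contains all segments crossed by some *scanline* from the gap `β t` of the natural order to a gap `c`
of the order of the layer (`IsBarrier.exists_cross_subset`). If `S` has at most `k` elements, then
`c` and `β t` differ by at most `k`, which leaves `2 * k + 1` scanlines for each gap `c`.

Call `(t, c)` an *event* if some vertex moves across the gap `c` between the layers `t - 1` and `t`.
The number of events is at most `d_Σ` (`card_isEvent_le`). Choose the scanlines for a given separator
*eagerly*: a scanline is used in the earliest layer from which on it fits. When a vertex is crossed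
for the first time after layer `0`, there is an event at the end of its scanline. So the vertices
crossed by at most `k` scanlines, all at events except possibly one in layer `0`, form a separator of
size at most `k` if there is one (`HasBarrier.exists_items`). A depth-first search tries all choices
of such scanlines, of which there are `O(n (d_Σ (2 k + 1)) ^ k)`: if there are events at all, then
only the first scanline contributes a factor `n`. Each choice is tested in time `O(|E|)` by one sweep
over the sorted list of edges (`foldl_sweepStep_lt_iff`). If there is no event, all layers are equal,
and trying all scanlines of a single layer in time `O(n ^ 2)` is enough
(`hasBarrier_iff_of_no_event`). The permutations and the sorted lists are computed from the
adjacency matrices of the layers in time `O(τ n ^ 2)`; array cells are `0` at the beginning, so the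
matrices need not be cleared.

Programs are verified with the total correctness triples `Runs`, which carry a time bound. Every
program leaves alone the registers and arrays to which it does not write (`Exec.frame`). The search
keeps its branch on a stack, and its number of steps is bounded by the potential `remaining`.
-/

namespace TemporalPermutation

/-! ### Separators and barriers -/

/-- The pair `u`, `v` is an inversion of `q`: its natural order and its order under `q` differ. -/
def Inverts (q : ℕ → ℕ) (u v : ℕ) : Prop :=
  (u < v ∧ q v < q u) ∨ (v < u ∧ q u < q v)

instance (q : ℕ → ℕ) (u v : ℕ) : Decidable (Inverts q u v) := by
  unfold Inverts; infer_instance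

theorem Inverts.symm {q : ℕ → ℕ} {u v : ℕ} (h : Inverts q u v) : Inverts q v u := by
  unfold Inverts at *; omega

/-- Every vertex between the endpoints of an edge of a permutation graph is adjacent to one of
them. -/
theorem Inverts.between {q : ℕ → ℕ} {u v y : ℕ} (h : Inverts q u v) (huy : u < y) (hyv : y < v) :
    Inverts q u y ∨ Inverts q y v := by
  unfold Inverts at *; omega

/-- A barrier for `S` between `s` and `z`: thresholds `β 0 ≤ β 1 ≤ ⋯` between `s` and `z` such
that each edge of layer `t` that leads across the threshold `β t` has an endpoint in `S`.
Layer `t` is the permutation graph of `p t` on the vertices `0, …, n - 1`. -/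
structure IsBarrier (n τ s z : ℕ) (p : ℕ → ℕ → ℕ) (S : Finset ℕ) (β : ℕ → ℕ) : Prop where
  mono : ∀ t t', t ≤ t' → t' < τ → β t ≤ β t'
  start_lt : ∀ t < τ, s < β t
  le_finish : ∀ t < τ, β t ≤ z
  hit : ∀ t < τ, ∀ x y, x < β t → β t ≤ y → y < n → p t y < p t x → x ∈ S ∨ y ∈ S

/-- There are at most `k` vertices other than `s` and `z` with a barrier. -/
def HasBarrier (n τ s z k : ℕ) (p : ℕ → ℕ → ℕ) : Prop :=
  ∃ S : Finset ℕ, S ⊆ Finset.range n ∧ s ∉ S ∧ z ∉ S ∧ S.card ≤ k ∧ ∃ β, IsBarrier n τ s z p S β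

section Reach

variable {V : Type*} {τ : ℕ}

/-- `Reach G S s t x`: some temporal walk from `s` that avoids `S` is at `x` at time `t`. -/
inductive Reach (G : TemporalGraph V τ) (S : Finset V) (s : V) : Fin τ → V → Prop
  | start (t : Fin τ) : Reach G S s t s
  | step {t t' : Fin τ} {x y : V} : Reach G S s t x → t ≤ t' → (s(x, y), t') ∈ G.edges → y ∉ S →
      Reach G S s t' y
  | wait {t t' : Fin τ} {x : V} : Reach G S s t x → t ≤ t' → Reach G S s t' x

theorem mem_deleteVerts {G : TemporalGraph V τ} {S : Finset V} {e : Sym2 V × Fin τ} :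
    e ∈ (G.deleteVerts S).edges ↔ e ∈ G.edges ∧ ∀ v ∈ S, v ∉ e.1 :=
  @Finset.mem_filter _ _ (_) _ _

theorem Reach.not_mem {G : TemporalGraph V τ} {S : Finset V} {s x : V} {t : Fin τ}
    (hs : s ∉ S) (h : Reach G S s t x) : x ∉ S := by
  induction h <;> assumption

/-- A vertex that is reached is reached by a path: the path to the predecessor is either extended
or, if it visits the vertex already, cut off there. -/
theorem Reach.exists_path {G : TemporalGraph V τ} {S : Finset V} {s x : V} {t : Fin τ}
    (hs : s ∉ S) (h : Reach G S s t x) :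
    ∃ (ℓ : ℕ) (v : ℕ → V) (e : ℕ → Fin τ), v 0 = s ∧ v ℓ = x ∧
      (∀ i < ℓ, (s(v i, v (i + 1)), e i) ∈ (G.deleteVerts S).edges) ∧
      (∀ i j, i ≤ j → j < ℓ → e i ≤ e j) ∧ (∀ i ≤ ℓ, ∀ j ≤ ℓ, v i = v j → i = j) ∧
      ∀ i < ℓ, e i ≤ t := by
  induction h with
  | start t => exact ⟨0, fun _ => s, fun _ => t, rfl, rfl, by simp, by simp, by simp, by simp⟩
  | @step t t' x y hx htt' he hy ih =>
    obtain ⟨ℓ, v, e, h0, hℓ, hE, hm, hi, ht⟩ := ih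
    by_cases hex : ∃ i ≤ ℓ, v i = y
    · obtain ⟨i, hiℓ, hiy⟩ := hex
      exact ⟨i, v, e, h0, hiy, fun j hj => hE j (by omega), fun a b hab hb => hm a b hab (by omega),
        fun a ha b hb => hi a (by omega) b (by omega), fun j hj => (ht j (by omega)).trans htt'⟩
    · push Not at hex
      refine ⟨ℓ + 1, Function.update v (ℓ + 1) y, Function.update e ℓ t', ?_, by simp, ?_, ?_,
        ?_, ?_⟩
      · rw [Function.update_of_ne (by omega), h0]
      · intro i hi'
        rcases Nat.lt_succ_iff_lt_or_eq.mp hi' with h | rfl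
        · rw [Function.update_of_ne (by omega), Function.update_of_ne (by omega),
            Function.update_of_ne (by omega)]
          exact hE i h
        · rw [Function.update_of_ne (by omega), Function.update_self, Function.update_self, hℓ]
          rw [mem_deleteVerts]
          refine ⟨he, fun a ha hax => ?_⟩
          rcases Sym2.mem_iff.mp hax with rfl | rfl
          · exact hx.not_mem hs ha
          · exact hy ha
      · intro i j hij hj
        rcases Nat.lt_succ_iff_lt_or_eq.mp hj with h | rfl
        · rw [Function.update_of_ne (by omega), Function.update_of_ne (by omega)]
          exact hm i j hij h
        · rw [Function.update_self]
          rcases hij.lt_or_eq with h | rfl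
          · rw [Function.update_of_ne (by omega)]
            exact (ht i h).trans htt'
          · rw [Function.update_self]
      · intro i hi' j hj' hij
        rcases Nat.le_succ_iff.mp hi' with h | rfl <;> rcases Nat.le_succ_iff.mp hj' with h' | rfl
        · rw [Function.update_of_ne (by omega), Function.update_of_ne (by omega)] at hij
          exact hi i h j h' hij
        · rw [Function.update_of_ne (by omega), Function.update_self] at hij
          exact absurd hij (hex i h)
        · rw [Function.update_of_ne (by omega : j ≠ ℓ + 1), Function.update_self] at hij
          exact absurd hij.symm (hex j h')
        · rfl
      · intro i hi'
        rcases Nat.lt_succ_iff_lt_or_eq.mp hi' with h | rfl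
        · rw [Function.update_of_ne (by omega)]
          exact (ht i h).trans htt'
        · rw [Function.update_self]
  | wait _ htt' ih =>
    obtain ⟨ℓ, v, e, h0, hℓ, hE, hm, hi, ht⟩ := ih
    exact ⟨ℓ, v, e, h0, hℓ, hE, hm, hi, fun i hi' => (ht i hi').trans htt'⟩

theorem Reach.exists_isTemporalPath {G : TemporalGraph V τ} {S : Finset V} {s x : V} {t : Fin τ}
    (hs : s ∉ S) (h : Reach G S s t x) :
    ∃ (ℓ : ℕ) (v : Fin (ℓ + 1) → V) (e : Fin ℓ → Fin τ),
      (G.deleteVerts S).IsTemporalPath s x ℓ v e := by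
  obtain ⟨ℓ, v, e, h0, hℓ, hE, hm, hi, -⟩ := h.exists_path hs
  refine ⟨ℓ, fun i => v i, fun i => e i, ⟨⟨by simpa using h0, by simpa using hℓ, fun i => ?_,
    fun i j hij => hm i j hij j.2⟩, fun i j hij => ?_⟩⟩
  · simpa using hE i i.2
  · exact Fin.ext (hi i (by omega) j (by omega) hij)

end Reach

section Graph

variable {n τ : ℕ} {G : TemporalGraph (Fin n) τ} {φ : Fin n → ℕ} {p : ℕ → ℕ → ℕ}

/-- In a temporal permutation graph, the reached vertices at any time form an interval, up to the
removed vertices. -/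
theorem Reach.interval (hG : ∀ (t : Fin τ) a b, (s(a, b), t) ∈ G.edges ↔ Inverts (p t) (φ a) (φ b))
    (hφ : Function.Injective φ) {S : Finset (Fin n)} {s x : Fin n} {t : Fin τ}
    (h : Reach G S s t x) : ∀ y, y ∉ S → φ s ≤ φ y → φ y ≤ φ x → Reach G S s t y := by
  induction h with
  | start t =>
    intro y _ h1 h2
    rw [hφ (h2.antisymm h1)]
    exact .start t
  | @step t t' x w hx htt' he hw ih =>
    intro y hy h1 h2
    rcases le_or_gt (φ y) (φ x) with h | h
    · exact (ih y hy h1 h).wait htt'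
    rcases h2.lt_or_eq with h3 | h3
    · rcases ((hG t' x w).mp he).between h h3 with h4 | h4
      · exact .step hx htt' ((hG t' x y).mpr h4) hy
      · exact .step (.step hx htt' he hw) le_rfl ((hG t' w y).mpr h4.symm) hy
    · rw [hφ h3]
      exact .step hx htt' he hw
  | wait _ htt' ih => exact fun y hy h1 h2 => (ih y hy h1 h2).wait htt'

/-- A set of vertices other than `s` and `z` is a separator if and only if it has a barrier. If
`z` is not reached, the largest vertices reached up to each time give a barrier; and no path
crosses a barrier. -/
theorem isSeparator_iff
    (hG : ∀ (t : Fin τ) a b, (s(a, b), t) ∈ G.edges ↔ Inverts (p t) (φ a) (φ b))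
    (hφ : Function.Injective φ) (hlt : ∀ a, φ a < n) (hsurj : ∀ y < n, ∃ a, φ a = y)
    (hτ : 1 ≤ τ) {s z : Fin n} (hsz : φ s < φ z) {S : Finset (Fin n)} (hs : s ∉ S) (hz : z ∉ S) :
    G.IsSeparator s z S ↔ ∃ β, IsBarrier n τ (φ s) (φ z) p (S.image φ) β := by
  constructor
  · rintro ⟨-, -, hno⟩
    have hnr : ∀ t, ¬ Reach G S s t z := fun t h => hno (h.exists_isTemporalPath hs)
    have hnr' : ∀ t x, Reach G S s t x → φ x < φ z := fun t x h => by
      by_contra hx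
      exact hnr t (h.interval hG hφ z hz hsz.le (not_lt.mp hx))
    classical
    let R : Fin τ → Finset (Fin n) := fun t => Finset.univ.filter fun x => Reach G S s t x
    let β : ℕ → ℕ := fun t => if h : t < τ then (R ⟨t, h⟩).sup φ + 1 else 0
    have hβ : ∀ (t : ℕ) (h : t < τ), β t = (R ⟨t, h⟩).sup φ + 1 := fun t h => dif_pos h
    refine ⟨β, ⟨fun t t' htt' ht' => ?_, fun t ht => ?_, fun t ht => ?_,
      fun t ht x y hx hy hyn hxy => ?_⟩⟩
    · rw [hβ t (by omega), hβ t' ht']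
      refine Nat.succ_le_succ (Finset.sup_mono fun x hx => ?_)
      rw [Finset.mem_filter] at hx ⊢
      exact ⟨hx.1, hx.2.wait htt'⟩
    · rw [hβ t ht]
      exact Nat.lt_succ_of_le (Finset.le_sup (f := φ) (Finset.mem_filter.mpr ⟨Finset.mem_univ _,
        .start _⟩))
    · rw [hβ t ht]
      refine Nat.succ_le_of_lt ((Finset.sup_lt_iff (by simp only [bot_eq_zero]; omega)).mpr fun x
        hx => ?_)
      exact hnr' _ x (Finset.mem_filter.mp hx).2
    · obtain ⟨b, rfl⟩ := hsurj y hyn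
      obtain ⟨a, rfl⟩ := hsurj x (by omega)
      rw [hβ t ht] at hx hy
      by_contra hcon
      push Not at hcon
      have ha : a ∉ S := fun h => hcon.1 (Finset.mem_image_of_mem _ h)
      have hb : b ∉ S := fun h => hcon.2 (Finset.mem_image_of_mem _ h)
      have hab : Inverts (p t) (φ a) (φ b) := .inl ⟨by omega, hxy⟩
      have hbR : ¬ Reach G S s ⟨t, ht⟩ b := fun h => by
        have hbm : b ∈ R ⟨t, ht⟩ := Finset.mem_filter.mpr ⟨Finset.mem_univ b, h⟩
        have : φ b ≤ (R ⟨t, ht⟩).sup φ := Finset.le_sup hbm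
        omega
      have haR : ¬ Reach G S s ⟨t, ht⟩ a := fun h =>
        hbR (.step h le_rfl ((hG ⟨t, ht⟩ a b).mpr hab) hb)
      -- The largest reached vertex lies between the endpoints of the crossing edge.
      obtain ⟨m, hm, hmsup⟩ := (R ⟨t, ht⟩).exists_mem_eq_sup
        ⟨s, Finset.mem_filter.mpr ⟨Finset.mem_univ _, .start _⟩⟩ φ
      have hmR := (Finset.mem_filter.mp hm).2
      rw [hmsup] at hx hy
      rcases (Nat.lt_succ_iff.mp hx).lt_or_eq with h | h
      · rcases hab.between h (by omega) with h' | h'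
        · exact haR (.step hmR le_rfl ((hG ⟨t, ht⟩ m a).mpr h'.symm) ha)
        · exact hbR (.step hmR le_rfl ((hG ⟨t, ht⟩ m b).mpr h') hb)
      · exact haR (hφ h ▸ hmR)
  · rintro ⟨β, hβ⟩
    refine ⟨hs, hz, ?_⟩
    rintro ⟨ℓ, v, e, hp⟩
    have key : ∀ (i : ℕ) (hi : i < ℓ + 1) (t : Fin τ), (∀ j : Fin ℓ, (j : ℕ) < i → e j ≤ t) →
        φ (v ⟨i, hi⟩) < β t := by
      intro i
      induction i with
      | zero =>
        intro hi t _
        have : v ⟨0, hi⟩ = s := hp.start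
        rw [this]
        exact hβ.start_lt t t.2
      | succ i ih =>
        intro hi t ht
        have hE := hp.edge ⟨i, by omega⟩
        rw [mem_deleteVerts] at hE
        obtain ⟨hE, hS⟩ := hE
        have h1 := ih (by omega) (e ⟨i, by omega⟩) fun j hj => hp.mono (Fin.le_def.mpr hj.le)
        refine lt_of_lt_of_le ?_ (hβ.mono (e ⟨i, by omega⟩) t (ht ⟨i,
          by omega⟩ (Nat.lt_succ_self i)) t.2)
        by_contra hcon
        rw [hG] at hE
        change Inverts _ (φ (v ⟨i, by omega⟩)) (φ (v ⟨i + 1, hi⟩)) at hE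
        have hinv : p (e ⟨i, by omega⟩) (φ (v ⟨i + 1, hi⟩)) < p (e ⟨i, by omega⟩) (φ (v ⟨i,
          by omega⟩)) := by
          rcases hE with h | h
          · exact h.2
          · omega
        rcases hβ.hit _ (e ⟨i, by omega⟩).2 _ _ h1 (not_lt.mp hcon) (hlt _) hinv with h | h
        · obtain ⟨c, hc, hce⟩ := Finset.mem_image.mp h
          exact hS c hc (by rw [hφ hce]; exact Sym2.mem_mk_left _ _)
        · obtain ⟨c, hc, hce⟩ := Finset.mem_image.mp h
          exact hS c hc (by rw [hφ hce]; exact Sym2.mem_mk_right _ _)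
    have h1 := key ℓ (Nat.lt_succ_self ℓ) ⟨τ - 1, by omega⟩ fun j _ => by
      rw [Fin.le_def]; have := (e j).2; simp only; omega
    have h2 : v ⟨ℓ, Nat.lt_succ_self ℓ⟩ = z := hp.finish
    rw [h2] at h1
    have := hβ.le_finish (τ - 1) (by omega)
    simp only at h1
    omega

theorem hasSeparatorOfSize_iff
    (hG : ∀ (t : Fin τ) a b, (s(a, b), t) ∈ G.edges ↔ Inverts (p t) (φ a) (φ b))
    (hφ : Function.Injective φ) (hlt : ∀ a, φ a < n) (hsurj : ∀ y < n, ∃ a, φ a = y)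
    (hτ : 1 ≤ τ) {s z : Fin n} (hsz : φ s < φ z) (k : ℕ) :
    G.HasSeparatorOfSize s z k ↔ HasBarrier n τ (φ s) (φ z) k p := by
  constructor
  · rintro ⟨S, hS, hk⟩
    refine ⟨S.image φ, fun x hx => ?_, ?_, ?_, Finset.card_image_le.trans hk,
      (isSeparator_iff hG hφ hlt hsurj hτ hsz hS.1 hS.2.1).mp hS⟩
    · obtain ⟨a, -, rfl⟩ := Finset.mem_image.mp hx
      exact Finset.mem_range.mpr (hlt a)
    · rw [hφ.mem_finset_image]; exact hS.1
    · rw [hφ.mem_finset_image]; exact hS.2.1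
  · rintro ⟨S, hSn, hs, hz, hk, hβ⟩
    have himg : (S.preimage φ hφ.injOn).image φ = S := by
      ext x
      simp only [Finset.mem_image, Finset.mem_preimage]
      constructor
      · rintro ⟨a, ha, rfl⟩; exact ha
      · intro hx
        obtain ⟨a, rfl⟩ := hsurj x (Finset.mem_range.mp (hSn hx))
        exact ⟨a, hx, rfl⟩
    refine ⟨S.preimage φ hφ.injOn, (isSeparator_iff hG hφ hlt hsurj hτ hsz ?_ ?_).mpr ?_, ?_⟩
    · simpa using hs
    · simpa using hz
    · rw [himg]; exact hβ
    · rw [← Finset.card_image_of_injective _ hφ, himg]; exact hk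

end Graph

/-! ### Scanlines -/

/-- `q` permutes `0, …, n - 1`. -/
structure IsPermOn (n : ℕ) (q : ℕ → ℕ) : Prop where
  lt : ∀ x < n, q x < n
  inj : ∀ x < n, ∀ y < n, q x = q y → x = y

theorem IsPermOn.exists_eq {n : ℕ} {q : ℕ → ℕ} (hq : IsPermOn n q) {i : ℕ} (hi : i < n) :
    ∃ x < n, q x = i := by
  have h := Finset.surj_on_of_inj_on_of_card_le (s := Finset.range n) (t := Finset.range n)
    (fun x _ => q x) (fun x hx => Finset.mem_range.mpr (hq.lt x (Finset.mem_range.mp hx)))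
    (fun x y hx hy h => hq.inj x (Finset.mem_range.mp hx) y (Finset.mem_range.mp hy) h) le_rfl i
    (Finset.mem_range.mpr hi)
  obtain ⟨x, hx, rfl⟩ := h
  exact ⟨x, Finset.mem_range.mp hx, rfl⟩

theorem IsPermOn.card_filter_lt {n : ℕ} {q : ℕ → ℕ} (hq : IsPermOn n q) {c : ℕ} (hc : c ≤ n) :
    ((Finset.range n).filter fun x => q x < c).card = c := by
  have himg : ((Finset.range n).filter fun x => q x < c).image q = Finset.range c := by
    ext i
    simp only [Finset.mem_image, Finset.mem_filter, Finset.mem_range]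
    constructor
    · rintro ⟨x, ⟨_, h⟩, rfl⟩; exact h
    · intro hi
      obtain ⟨x, hx, rfl⟩ := hq.exists_eq (lt_of_lt_of_le hi hc)
      exact ⟨x, ⟨hx, hi⟩, rfl⟩
  rw [← Finset.card_image_of_injOn (f := q), himg, Finset.card_range]
  intro x hx y hy h
  simp only [Finset.coe_filter, Finset.mem_range, Set.mem_ofPred_eq] at hx hy
  exact hq.inj x hx.1 y hy.1 h

/-- The position `q x` of `x` is the number of elements that precede it: those smaller elements
that form no inversion with `x`, and those larger elements that do. -/
theorem IsPermOn.card_precede {n : ℕ} {q : ℕ → ℕ} (hq : IsPermOn n q) {x : ℕ} (hx : x < n) :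
    ((Finset.range n).filter fun y => ¬ (y < x ↔ Inverts q y x)).card = q x := by
  rw [← hq.card_filter_lt (hq.lt x hx).le]
  congr 1
  refine Finset.filter_congr fun y hy => ?_
  have hy := Finset.mem_range.mp hy
  have := hq.inj x hx y hy
  unfold Inverts
  by_cases h : x = y
  · subst h; omega
  · omega

/-- The vertices that the scanline from the gap `β` of the natural order to the gap `c` of the
order given by `q` crosses. Removing them separates the vertices before the gap `β` from those
behind it. -/
def cross (n : ℕ) (q : ℕ → ℕ) (β c : ℕ) : Finset ℕ :=
  (Finset.range n).filter fun x => ¬ (x < β ↔ q x < c)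

theorem mem_cross {n : ℕ} {q : ℕ → ℕ} {β c x : ℕ} :
    x ∈ cross n q β c ↔ x < n ∧ ¬ (x < β ↔ q x < c) := by
  simp [cross]

theorem cross_card_bounds {n : ℕ} {q : ℕ → ℕ} (hq : IsPermOn n q) {β c : ℕ} (hβ : β ≤ n)
    (hc : c ≤ n) : β ≤ c + (cross n q β c).card ∧ c ≤ β + (cross n q β c).card := by
  have h1 := hq.card_filter_lt hc
  have h2 : ((Finset.range n).filter fun x => x < β).card = β := by
    have : (Finset.range n).filter (fun x => x < β) = Finset.range β := by
      ext x; simp only [Finset.mem_filter, Finset.mem_range]; omega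
    rw [this, Finset.card_range]
  constructor
  · have : (Finset.range n).filter (fun x => x < β) ⊆
        (Finset.range n).filter (fun x => q x < c) ∪ cross n q β c := by
      intro x hx
      rw [Finset.mem_union, mem_cross]
      simp only [Finset.mem_filter, Finset.mem_range] at hx ⊢
      tauto
    have := (Finset.card_le_card this).trans (Finset.card_union_le _ _)
    omega
  · have : (Finset.range n).filter (fun x => q x < c) ⊆
        (Finset.range n).filter (fun x => x < β) ∪ cross n q β c := by
      intro x hx
      rw [Finset.mem_union, mem_cross]
      simp only [Finset.mem_filter, Finset.mem_range] at hx ⊢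
      tauto
    have := (Finset.card_le_card this).trans (Finset.card_union_le _ _)
    omega

/-- A set that hits all edges across the gap `β` contains all vertices that some scanline
through this gap crosses: its other end is behind the last remaining vertex before the gap. -/
theorem IsBarrier.exists_cross_subset {n τ s z : ℕ} {p : ℕ → ℕ → ℕ} {S : Finset ℕ} {β : ℕ → ℕ}
    (hp : ∀ t < τ, IsPermOn n (p t)) (hz : z < n) (h : IsBarrier n τ s z p S β) {t : ℕ}
    (ht : t < τ) : ∃ c ≤ n, cross n (p t) (β t) c ⊆ S := by
  have hβn := h.le_finish t ht
  let R := (Finset.range (β t)).filter fun x => x ∉ S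
  refine ⟨R.sup fun x => p t x + 1, Finset.sup_le fun x hx => ?_, fun x hx => ?_⟩
  · rw [Finset.mem_filter, Finset.mem_range] at hx
    exact (hp t ht).lt x (by omega)
  · rw [mem_cross] at hx
    by_contra hxS
    rcases lt_or_ge x (β t) with hb | hb
    · have hxR : x ∈ R := Finset.mem_filter.mpr ⟨Finset.mem_range.mpr hb, hxS⟩
      have : p t x + 1 ≤ R.sup fun x => p t x + 1 := Finset.le_sup (f := fun x => p t x + 1) hxR
      exact hx.2 ⟨fun _ => this, fun _ => hb⟩
    · have hlt : p t x < R.sup fun x => p t x + 1 := by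
        by_contra hcon
        exact hx.2 ⟨fun h => absurd h (not_lt.mpr hb), fun h => absurd h hcon⟩
      obtain ⟨y, hy, hyx⟩ := (Finset.lt_sup_iff).mp hlt
      rw [Finset.mem_filter, Finset.mem_range] at hy
      have hne : p t x ≠ p t y := fun h => by
        have := (hp t ht).inj x hx.1 y (by omega) h
        omega
      rcases h.hit t ht y x hy.1 hb hx.1 (by omega) with h' | h'
      · exact hy.2 h'
      · exact hxS h'

/-! ### Events -/

/-- Between the layers `t - 1` and `t`, some vertex moves across the gap `c` of the order of the
layer. There is no event at time `0`. -/
def IsEvent (n : ℕ) (p : ℕ → ℕ → ℕ) (t c : ℕ) : Prop :=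
  ∃ x ∈ Finset.range n, ¬ (p t x < c ↔ p (t - 1) x < c)

instance (n : ℕ) (p : ℕ → ℕ → ℕ) (t c : ℕ) : Decidable (IsEvent n p t c) := by
  unfold IsEvent; infer_instance

/-- Two consecutive layers have at most as many events as pairs on which they differ. An element
that moves up by `i` positions accounts for at most `i` gaps that are crossed upwards, and it is
overtaken by at least `i` elements. -/
theorem card_isEvent_le {n : ℕ} {p : ℕ → ℕ → ℕ} {t : ℕ} (hp : IsPermOn n (p t))
    (hq : IsPermOn n (p (t + 1))) :
    ((Finset.range (n + 1)).filter fun c => IsEvent n p (t + 1) c).card ≤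
      ((Finset.range n ×ˢ Finset.range n).filter fun e =>
        e.1 < e.2 ∧ ¬ (Inverts (p t) e.1 e.2 ↔ Inverts (p (t + 1)) e.1 e.2)).card := by
  have hup : ∀ c ≤ n, IsEvent n p (t + 1) c → ∃ x < n, p t x < c ∧ c ≤ p (t + 1) x := by
    intro c hc hev
    by_contra hcon
    push Not at hcon
    have hsub : (Finset.range n).filter (fun x => p t x < c) ⊆
        (Finset.range n).filter (fun x => p (t + 1) x < c) := by
      intro x hx
      rw [Finset.mem_filter, Finset.mem_range] at hx ⊢
      exact ⟨hx.1, hcon x hx.1 hx.2⟩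
    have heq := Finset.eq_of_subset_of_card_le hsub
      (by rw [hp.card_filter_lt hc, hq.card_filter_lt hc])
    obtain ⟨x, hx, hne⟩ := hev
    have := Finset.ext_iff.mp heq x
    simp only [Finset.mem_filter, hx, true_and] at this
    exact hne this.symm
  calc ((Finset.range (n + 1)).filter fun c => IsEvent n p (t + 1) c).card
      ≤ ((Finset.range n).biUnion fun x => Finset.Ioc (p t x) (p (t + 1) x)).card := by
        refine Finset.card_le_card fun c hc => ?_
        rw [Finset.mem_filter, Finset.mem_range] at hc
        obtain ⟨x, hx, h1, h2⟩ := hup c (by omega) hc.2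
        exact Finset.mem_biUnion.mpr ⟨x, Finset.mem_range.mpr hx, Finset.mem_Ioc.mpr ⟨h1, h2⟩⟩
    _ ≤ ∑ x ∈ Finset.range n, (Finset.Ioc (p t x) (p (t + 1) x)).card := Finset.card_biUnion_le
    _ ≤ ∑ x ∈ Finset.range n, ((Finset.range n).filter fun y =>
          p t x < p t y ∧ p (t + 1) y < p (t + 1) x).card := by
        refine Finset.sum_le_sum fun x hx => ?_
        rw [Finset.mem_range] at hx
        rw [Nat.card_Ioc]
        have h1 := hp.card_filter_lt (hp.lt x hx).le
        have h2 := hq.card_filter_lt (hq.lt x hx).le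
        have hsub : (Finset.range n).filter (fun y => p (t + 1) y < p (t + 1) x) ⊆
            (Finset.range n).filter (fun y => p t x < p t y ∧ p (t + 1) y < p (t + 1) x) ∪
              (Finset.range n).filter (fun y => p t y < p t x) := by
          intro y hy
          rw [Finset.mem_union]
          simp only [Finset.mem_filter, Finset.mem_range] at hy ⊢
          have : p t y ≠ p t x := fun h => by
            rw [hp.inj y hy.1 x hx h] at hy
            omega
          omega
        have := (Finset.card_le_card hsub).trans (Finset.card_union_le _ _)
        omega
    _ = ((Finset.range n ×ˢ Finset.range n).filter fun e =>
          p t e.1 < p t e.2 ∧ p (t + 1) e.2 < p (t + 1) e.1).card := by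
        rw [Finset.card_filter, Finset.sum_product]
        exact Finset.sum_congr rfl fun x _ => Finset.card_filter _ _
    _ ≤ _ := by
        refine Finset.card_le_card_of_injOn (fun e => (min e.1 e.2, max e.1 e.2)) ?_ ?_
        · rintro ⟨x, y⟩ he
          simp only [Finset.coe_filter, Finset.mem_product, Finset.mem_range,
            Set.mem_ofPred_eq] at he ⊢
          have hne : x ≠ y := by rintro rfl; omega
          unfold Inverts
          rcases lt_or_gt_of_ne hne with h | h
          · rw [min_eq_left h.le, max_eq_right h.le]; omega
          · rw [min_eq_right h.le, max_eq_left h.le]; omega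
        · rintro ⟨x, y⟩ he ⟨x', y'⟩ he' h
          simp only [Finset.coe_filter, Finset.mem_product, Finset.mem_range, Set.mem_ofPred_eq,
            Prod.mk.injEq] at he he' h ⊢
          by_contra hcon
          have h' : x = y' ∧ y = x' := by omega
          rw [h'.1, h'.2] at he
          omega

theorem layers_eq_of_no_event {n τ : ℕ} {p : ℕ → ℕ → ℕ} (hp : ∀ t < τ, IsPermOn n (p t))
    (h : ∀ t < τ, ∀ c ≤ n, ¬ IsEvent n p t c) {t : ℕ} (ht : t < τ) {x : ℕ} (hx : x < n) :
    p t x = p 0 x := by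
  induction t with
  | zero => rfl
  | succ t ih =>
    rw [← ih (by omega)]
    have h1 : ∀ c ≤ n, (p (t + 1) x < c ↔ p t x < c) := fun c hc => by
      by_contra hcon
      exact h (t + 1) ht c hc ⟨x, Finset.mem_range.mpr hx, hcon⟩
    have h2 := (hp (t + 1) ht).lt x hx
    have h3 := (hp t (by omega)).lt x hx
    have h4 := h1 (p t x + 1) (by omega)
    have h5 := h1 (p (t + 1) x + 1) (by omega)
    omega

/-- If all layers are equal, then the minimum separators come from a single scanline. -/
theorem hasBarrier_iff_of_no_event {n τ s z k : ℕ} {p : ℕ → ℕ → ℕ}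
    (hp : ∀ t < τ, IsPermOn n (p t)) (hτ : 1 ≤ τ) (hz : z < n)
    (h : ∀ t < τ, ∀ c ≤ n, ¬ IsEvent n p t c) :
    HasBarrier n τ s z k p ↔ ∃ β < n, ∃ c < n, s < β ∧ β ≤ z ∧ p 0 s < c ∧ c ≤ p 0 z ∧
      (cross n (p 0) β c).card ≤ k := by
  constructor
  · rintro ⟨S, hSn, hs, hzS, hk, β, hβ⟩
    obtain ⟨c, hc, hcS⟩ := hβ.exists_cross_subset hp hz (t := 0) (by omega)
    have h1 := hβ.start_lt 0 (by omega)
    have h2 := hβ.le_finish 0 (by omega)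
    have h3 : ¬ ¬ (s < β 0 ↔ p 0 s < c) := fun h => hs (hcS (mem_cross.mpr ⟨by omega, h⟩))
    have h4 : ¬ ¬ (z < β 0 ↔ p 0 z < c) := fun h => hzS (hcS (mem_cross.mpr ⟨by omega, h⟩))
    have h5 := (hp 0 (by omega)).lt z hz
    exact ⟨β 0, by omega, c, by omega, h1, h2, by omega, by omega,
      (Finset.card_le_card hcS).trans hk⟩
  · rintro ⟨β, hβn, c, hcn, h1, h2, h3, h4, hk⟩
    refine ⟨cross n (p 0) β c, Finset.filter_subset _ _, ?_, ?_, hk, fun _ => β,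
      ⟨fun _ _ _ _ => le_rfl, fun _ _ => h1, fun _ _ => h2, fun t ht x y hx hy hyn hxy => ?_⟩⟩
    · rw [mem_cross]; omega
    · rw [mem_cross]; omega
    · rw [layers_eq_of_no_event hp h ht hyn, layers_eq_of_no_event hp h ht (by omega)] at hxy
      rw [mem_cross, mem_cross]
      omega

/-! ### Branching over events -/

/-- Scanlines for all layers, with monotone first ends between `s` and `z`, that cross only
vertices of `S`. -/
structure IsScan (n τ s z : ℕ) (p : ℕ → ℕ → ℕ) (S : Finset ℕ) (β c : ℕ → ℕ) : Prop where
  mono : ∀ t t', t ≤ t' → t' < τ → β t ≤ β t'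
  start_lt : ∀ t < τ, s < β t
  le_finish : ∀ t < τ, β t ≤ z
  le : ∀ t < τ, c t ≤ n
  subset : ∀ t < τ, cross n (p t) (β t) (c t) ⊆ S

/-- The scanlines can be chosen such that each of them is used as early as possible: if the
scanlines of two consecutive layers differ, then the later one would cross a vertex outside `S`
in the earlier layer. -/
theorem IsScan.exists_eager {n τ s z : ℕ} {p : ℕ → ℕ → ℕ} {S : Finset ℕ} {β c : ℕ → ℕ}
    (h : IsScan n τ s z p S β c) : ∃ β' c', IsScan n τ s z p S β' c' ∧
      ∀ t, t + 1 < τ → (β' t = β' (t + 1) ∧ c' t = c' (t + 1)) ∨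
        ¬ cross n (p t) (β' (t + 1)) (c' (t + 1)) ⊆ S := by
  suffices H : ∀ j ≤ τ, ∃ β' c', IsScan n τ s z p S β' c' ∧
      ∀ t, τ - j ≤ t → t + 1 < τ → (β' t = β' (t + 1) ∧ c' t = c' (t + 1)) ∨
        ¬ cross n (p t) (β' (t + 1)) (c' (t + 1)) ⊆ S by
    obtain ⟨β', c', h1, h2⟩ := H τ le_rfl
    exact ⟨β', c', h1, fun t ht => h2 t (by omega) ht⟩
  intro j
  induction j with
  | zero => exact fun _ => ⟨β, c, h, fun t h1 h2 => absurd h1 (by omega)⟩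
  | succ j ih =>
    intro hj
    obtain ⟨β', c', h1, h2⟩ := ih (by omega)
    obtain ⟨m, hm⟩ : ∃ m, m = τ - (j + 1) := ⟨_, rfl⟩
    -- From the last layer backwards, replace a scanline by its successor if that crosses `S` only.
    by_cases hcase : m + 1 < τ ∧ cross n (p m) (β' (m + 1)) (c' (m + 1)) ⊆ S
    · refine ⟨Function.update β' m (β' (m + 1)), Function.update c' m (c' (m + 1)),
        ⟨fun t t' htt' ht' => ?_, fun t ht => ?_, fun t ht => ?_, fun t ht => ?_, fun t ht => ?_⟩,
        fun t ht ht' => ?_⟩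
      · have e1 := h1.mono t t' htt' ht'
        have e2 := h1.mono m (m + 1) (by omega) (by omega)
        simp only [Function.update_apply]
        split_ifs with ha hb hb
        · exact le_rfl
        · exact h1.mono _ _ (by omega) ht'
        · subst hb; omega
        · exact e1
      · simp only [Function.update_apply]
        split_ifs
        · exact h1.start_lt _ (by omega)
        · exact h1.start_lt _ ht
      · simp only [Function.update_apply]
        split_ifs
        · exact h1.le_finish _ (by omega)
        · exact h1.le_finish _ ht
      · simp only [Function.update_apply]
        split_ifs
        · exact h1.le _ (by omega)
        · exact h1.le _ ht
      · simp only [Function.update_apply]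
        split_ifs with ha
        · rw [ha]; exact hcase.2
        · exact h1.subset _ ht
      · rcases eq_or_ne t m with rfl | hne
        · left; simp
        · rw [Function.update_of_ne hne, Function.update_of_ne hne,
            Function.update_of_ne (by omega), Function.update_of_ne (by omega)]
          exact h2 t (by omega) ht'
    · refine ⟨β', c', h1, fun t ht ht' => ?_⟩
      rcases eq_or_ne t m with rfl | hne
      · exact .inr fun h => hcase ⟨ht', h⟩
      · exact h2 t (by omega) ht'

/-- The vertices that the scanline described by the item `e = (t, β + k, c)` crosses in layer `t`.
The shift by `k` keeps the second component nonnegative for all scanlines with `c ≤ β + k`. -/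
def itemCross (p : ℕ → ℕ → ℕ) (k : ℕ) (e : ℕ × ℕ × ℕ) (x : ℕ) : Prop :=
  ¬ (x + k < e.2.1 ↔ p e.1 x < e.2.2)

instance (p : ℕ → ℕ → ℕ) (k : ℕ) (e : ℕ × ℕ × ℕ) : DecidablePred (itemCross p k e) := by
  intro x; unfold itemCross; infer_instance

/-- `e` describes a scanline of layer `e.1 < τ` whose ends differ by at most `k`. -/
def IsItem (n τ k : ℕ) (e : ℕ × ℕ × ℕ) : Prop :=
  e.1 < τ ∧ e.2.2 ≤ n ∧ ∃ r < 2 * k + 1, e.2.1 = e.2.2 + r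

/-- If there is a separator of size at most `k`, then there is one that consists of the
(non-isolated) vertices crossed by at most `k` scanlines, all of which belong to events, with the
possible exception of one in layer `0`. Take eager scanlines for the given separator. When a
vertex is crossed for the first time after layer `0`, either its own position has moved across
the gap, or the scanline has just been changed, and then some vertex has moved across the gap
because the new scanline was not available in the layer before. -/
theorem HasBarrier.exists_items {n τ s z k : ℕ} {p : ℕ → ℕ → ℕ}
    (hp : ∀ t < τ, IsPermOn n (p t)) (hz : z < n) (h : HasBarrier n τ s z k p)
    {V : Finset ℕ} (hV : ∀ t < τ, ∀ x < n, ∀ y < n, Inverts (p t) x y → x ∈ V) :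
    ∃ L : List (ℕ × ℕ × ℕ), L.length ≤ k ∧
      (∀ i (hi : i < L.length), IsItem n τ k L[i] ∧
        (IsEvent n p L[i].1 L[i].2.2 ∨ (i = 0 ∧ L[i].1 = 0))) ∧
      ∀ S : Finset ℕ, (∀ x < n, x ∈ S ↔ x ∈ V ∧ ∃ e ∈ L, itemCross p k e x) → S ⊆ Finset.range n →
        s ∉ S ∧ z ∉ S ∧ S.card ≤ k ∧ ∃ β, IsBarrier n τ s z p S β := by
  obtain ⟨S, hSn, hs, hzS, hk, β₀, hβ₀⟩ := h
  have hc₀ : ∀ t, ∃ c, t < τ → c ≤ n ∧ cross n (p t) (β₀ t) c ⊆ S := fun t => by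
    by_cases ht : t < τ
    · obtain ⟨c, h1, h2⟩ := hβ₀.exists_cross_subset hp hz ht
      exact ⟨c, fun _ => ⟨h1, h2⟩⟩
    · exact ⟨0, fun h => absurd h ht⟩
  choose c₀ hc₀ using hc₀
  obtain ⟨β, c, hscan, heager⟩ := IsScan.exists_eager (S := S) (β := β₀) (c := c₀) (p := p)
    (n := n) (s := s) (z := z) (τ := τ) ⟨hβ₀.mono, hβ₀.start_lt, hβ₀.le_finish,
      fun t ht => (hc₀ t ht).1,
      fun t ht => (hc₀ t ht).2⟩
  let P : ℕ → ℕ → Prop := fun x t => t < τ ∧ x ∈ cross n (p t) (β t) (c t)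
  let U : Finset ℕ := (Finset.range τ).biUnion fun t => cross n (p t) (β t) (c t)
  have hUS : U ⊆ S := Finset.biUnion_subset.mpr fun t ht => hscan.subset t (Finset.mem_range.mp ht)
  have hU : ∀ x, x ∈ U → ∃ t, P x t := fun x hx => by
    obtain ⟨t, ht, hx⟩ := Finset.mem_biUnion.mp hx
    exact ⟨t, Finset.mem_range.mp ht, hx⟩
  classical
  -- `T x` is the first layer in which the scanline crosses `x`.
  let T : ℕ → ℕ := fun x => if h : ∃ t, P x t then Nat.find h else 0
  have hT : ∀ x, x ∈ U → P x (T x) ∧ ∀ t, t < T x → ¬ P x t := fun x hx => by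
    have h := hU x hx
    have : T x = Nat.find h := dif_pos h
    rw [this]
    exact ⟨Nat.find_spec h, fun t ht => Nat.find_min h ht⟩
  -- One scanline for each time at which a vertex is crossed first; there are at most `U.card ≤ k`.
  let D : Finset ℕ := U.image T
  let L : List (ℕ × ℕ × ℕ) := (D.sort (· ≤ ·)).map fun t => (t, β t + k, c t)
  have hshift : ∀ t x, itemCross p k (t, β t + k, c t) x ↔ ¬ (x < β t ↔ p t x < c t) := by
    intro t x; simp [itemCross]
  refine ⟨L, ?_, ?_, ?_⟩
  · simp only [L, List.length_map, Finset.length_sort]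
    exact Finset.card_image_le.trans ((Finset.card_le_card hUS).trans hk)
  · intro i hi
    have hi' : i < (D.sort (· ≤ ·)).length := by simpa [L] using hi
    obtain ⟨t, ht⟩ : ∃ t, t = (D.sort (· ≤ ·))[i] := ⟨_, rfl⟩
    have hL : L[i] = (t, β t + k, c t) := by simp [L, ht]
    have htD : t ∈ D := by
      rw [← Finset.mem_sort (· ≤ ·), ht]; exact List.getElem_mem hi'
    obtain ⟨x, hxU, hxt⟩ := Finset.mem_image.mp htD
    obtain ⟨⟨htτ, hx⟩, hmin⟩ := hT x hxU
    rw [hxt] at htτ hx hmin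
    rw [hL]
    refine ⟨⟨htτ, hscan.le t htτ, ?_⟩, ?_⟩
    · have h1 := hscan.le_finish t htτ
      have h2 := cross_card_bounds (hp t htτ) (β := β t) (by omega) (hscan.le t htτ)
      have h3 := (Finset.card_le_card (hscan.subset t htτ)).trans hk
      exact ⟨β t + k - c t, by omega, by dsimp only; omega⟩
    · rcases Nat.eq_zero_or_pos t with h0 | hpos
      · refine .inr ⟨?_, h0⟩
        by_contra hi0
        have h1 : (D.sort (· ≤ ·))[0] < (D.sort (· ≤ ·))[i] :=
          (Finset.sortedLT_sort D).strictMono_get (show (⟨0, by omega⟩ : Fin _) < ⟨i, hi'⟩ from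
            Nat.pos_of_ne_zero hi0)
        omega
      · left
        obtain ⟨t, rfl⟩ : ∃ t', t = t' + 1 := ⟨t - 1, by omega⟩
        rw [mem_cross] at hx
        dsimp only
        -- Either `x` itself moves across the gap, or the scanline is new and crosses in the layer
        -- before some `y` outside `S`, which it does not cross now.
        rcases heager t htτ with ⟨h1, h2⟩ | hnot
        · have hn : ¬ P x t := hmin t (Nat.lt_succ_self t)
          refine ⟨x, Finset.mem_range.mpr hx.1, fun hiff => hn ⟨by omega, ?_⟩⟩
          rw [mem_cross, h1, h2]
          simp only [Nat.add_sub_cancel] at hiff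
          exact ⟨hx.1, by rw [← hiff]; exact hx.2⟩
        · rw [Finset.not_subset] at hnot
          obtain ⟨y, hy, hyS⟩ := hnot
          have hy' : y ∉ cross n (p (t + 1)) (β (t + 1)) (c (t + 1)) := fun h =>
            hyS (hscan.subset (t + 1) htτ h)
          rw [mem_cross] at hy hy'
          refine ⟨y, Finset.mem_range.mpr hy.1, fun hiff => hy' ⟨hy.1, ?_⟩⟩
          simp only [Nat.add_sub_cancel] at hiff
          rw [hiff]; exact hy.2
  · intro S' hS' hS'n
    have hmemL : ∀ x < n, (∃ e ∈ L, itemCross p k e x) ↔ x ∈ U := by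
      intro x hxn
      constructor
      · rintro ⟨e, he, hex⟩
        obtain ⟨t, ht, rfl⟩ := List.mem_map.mp he
        rw [Finset.mem_sort] at ht
        obtain ⟨y, hyU, rfl⟩ := Finset.mem_image.mp ht
        exact Finset.mem_biUnion.mpr ⟨_, Finset.mem_range.mpr (hT y hyU).1.1,
          mem_cross.mpr ⟨hxn, (hshift _ x).mp hex⟩⟩
      · intro hx
        refine ⟨_, List.mem_map.mpr ⟨T x, ?_, rfl⟩, (hshift _ x).mpr (mem_cross.mp (hT x hx).1.2).2⟩
        rw [Finset.mem_sort]
        exact Finset.mem_image_of_mem _ hx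
    have hsub : S' ⊆ S := fun x hx => by
      have hxn := Finset.mem_range.mp (hS'n hx)
      exact hUS ((hmemL x hxn).mp ((hS' x hxn).mp hx).2)
    refine ⟨fun h => hs (hsub h), fun h => hzS (hsub h), (Finset.card_le_card hsub).trans hk, β,
      ⟨hscan.mono, hscan.start_lt, hscan.le_finish, fun t ht x y hx hy hyn hxy => ?_⟩⟩
    have hxn : x < n := by omega
    have hin : ∀ a < n, a ∈ V → ¬ (a < β t ↔ p t a < c t) → a ∈ S' := fun a ha haV hac =>
      (hS' a ha).mpr ⟨haV, (hmemL a ha).mpr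
        (Finset.mem_biUnion.mpr ⟨t, Finset.mem_range.mpr ht, mem_cross.mpr ⟨ha, hac⟩⟩)⟩
    have hinv : Inverts (p t) x y := .inl ⟨by omega, hxy⟩
    rcases lt_or_ge (p t x) (c t) with h | h
    · exact .inr (hin y hyn (hV t ht y hyn x hxn hinv.symm) (by omega))
    · exact .inl (hin x hxn (hV t ht x hxn y hyn hinv) (by omega))

/-! ### The sweep -/

/-- One step of the sweep: an edge `(t, u, v)` with `u < v` that avoids `S` and leads from the part
that has been reached beyond the frontier `f` moves the frontier to `v`. -/
def sweepStep (S : Finset ℕ) (f : ℕ) (e : ℕ × ℕ × ℕ) : ℕ :=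
  if e.2.1 ∉ S ∧ e.2.2 ∉ S ∧ e.2.1 ≤ f ∧ f < e.2.2 then e.2.2 else f

theorem le_sweepStep (S : Finset ℕ) (f : ℕ) (e : ℕ × ℕ × ℕ) : f ≤ sweepStep S f e := by
  unfold sweepStep; split_ifs with h
  · exact h.2.2.2.le
  · exact le_rfl

/-- The edges are sorted by time, and edges of the same time by their smaller endpoint. -/
def SweepSorted (l : List (ℕ × ℕ × ℕ)) : Prop :=
  l.Pairwise fun a b => a.1 < b.1 ∨ (a.1 = b.1 ∧ a.2.1 ≤ b.2.1)

theorem SweepSorted.append_singleton {l : List (ℕ × ℕ × ℕ)} {e : ℕ × ℕ × ℕ}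
    (h : SweepSorted (l ++ [e])) :
    SweepSorted l ∧ ∀ a ∈ l, a.1 < e.1 ∨ (a.1 = e.1 ∧ a.2.1 ≤ e.2.1) := by
  unfold SweepSorted at h
  rw [List.pairwise_append] at h
  exact ⟨h.1, fun a ha => h.2.2 a ha e (List.mem_singleton_self e)⟩

/-- The frontier after all edges up to time `t`. -/
def frontier (S : Finset ℕ) (s : ℕ) (l : List (ℕ × ℕ × ℕ)) (t : ℕ) : ℕ :=
  (l.filter fun e => e.1 ≤ t).foldl (sweepStep S) s

theorem frontier_append {S : Finset ℕ} {s : ℕ} {l : List (ℕ × ℕ × ℕ)} {e : ℕ × ℕ × ℕ} {t : ℕ} :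
    frontier S s (l ++ [e]) t =
      if e.1 ≤ t then sweepStep S (frontier S s l t) e else frontier S s l t := by
  unfold frontier
  rw [List.filter_append, List.foldl_append]
  by_cases h : e.1 ≤ t <;> simp [h]

theorem frontier_eq_foldl {S : Finset ℕ} {s : ℕ} {l : List (ℕ × ℕ × ℕ)} {t : ℕ}
    (h : ∀ e ∈ l, e.1 ≤ t) : frontier S s l t = l.foldl (sweepStep S) s := by
  unfold frontier
  rw [List.filter_eq_self.mpr]
  simpa using h

theorem le_frontier {S : Finset ℕ} {s : ℕ} {l : List (ℕ × ℕ × ℕ)} {t : ℕ} :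
    s ≤ frontier S s l t := by
  induction l using List.reverseRecOn with
  | nil => exact le_rfl
  | append_singleton l e ih =>
    rw [frontier_append]
    split_ifs
    · exact ih.trans (le_sweepStep _ _ _)
    · exact ih

theorem frontier_mono {S : Finset ℕ} {s : ℕ} {l : List (ℕ × ℕ × ℕ)} (hl : SweepSorted l) {t t' : ℕ}
    (htt' : t ≤ t') : frontier S s l t ≤ frontier S s l t' := by
  induction l using List.reverseRecOn with
  | nil => exact le_rfl
  | append_singleton l e ih =>
    obtain ⟨h1, h2⟩ := hl.append_singleton
    rw [frontier_append, frontier_append]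
    have h3 : ∀ a ∈ l, a.1 ≤ e.1 := fun a ha => by have := h2 a ha; omega
    split_ifs with ha hb hb
    · rw [frontier_eq_foldl fun a ha' => (h3 a ha').trans ha,
        frontier_eq_foldl fun a ha' => (h3 a ha').trans hb]
    · omega
    · exact (ih h1).trans (le_sweepStep _ _ _)
    · exact ih h1

/-- One pass over the edges of a layer suffices: an edge whose smaller endpoint is beyond the
frontier when it is considered stays beyond it, as the edges that follow start there too. -/
theorem frontier_closed {S : Finset ℕ} {s : ℕ} {l : List (ℕ × ℕ × ℕ)} (hl : SweepSorted l) :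
    ∀ e ∈ l, e.2.1 ∉ S → e.2.2 ∉ S → e.2.1 ≤ frontier S s l e.1 → e.2.2 ≤ frontier S s l e.1 := by
  induction l using List.reverseRecOn with
  | nil => simp
  | append_singleton l e ih =>
    obtain ⟨h1, h2⟩ := hl.append_singleton
    intro a ha hu hv
    rw [frontier_append]
    rcases List.mem_append.mp ha with ha' | ha'
    · have h3 := h2 a ha'
      have h4 := ih h1 a ha' hu hv
      split_ifs with hle
      · have heq : a.1 = e.1 := by omega
        unfold sweepStep
        split_ifs with hg
        · intro _
          exact (h4 (by omega)).trans hg.2.2.2.le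
        · exact h4
      · exact h4
    · rw [List.mem_singleton.mp ha'] at hu hv ⊢
      rw [if_pos le_rfl]
      unfold sweepStep
      split_ifs with hg
      · exact fun _ => le_rfl
      · intro h
        by_contra hcon
        exact hg ⟨hu, hv, h, not_le.mp hcon⟩

/-- The sweep tests in linear time whether `S` has a barrier. -/
theorem foldl_sweepStep_lt_iff {n τ s z : ℕ} {p : ℕ → ℕ → ℕ} {S : Finset ℕ}
    {l : List (ℕ × ℕ × ℕ)} (hl : SweepSorted l)
    (hmem : ∀ t u v, (t, u, v) ∈ l ↔ t < τ ∧ u < v ∧ v < n ∧ p t v < p t u) (hsz : s < z) :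
    l.foldl (sweepStep S) s < z ↔ ∃ β, IsBarrier n τ s z p S β := by
  constructor
  · intro h
    refine ⟨fun t => frontier S s l t + 1, ⟨fun t t' htt' _ => Nat.succ_le_succ
      (frontier_mono hl htt'),
      fun t _ => Nat.lt_succ_of_le le_frontier, fun t ht => ?_, fun t ht x y hx hy hyn hxy => ?_⟩⟩
    · have h1 := frontier_mono (S := S) (s := s) hl (le_max_left t τ)
      rw [frontier_eq_foldl (t := max t τ) fun e he => ((hmem e.1 e.2.1 e.2.2).mp he).1.le.trans
        (le_max_right t τ)] at h1
      omega
    · by_contra hcon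
      push Not at hcon
      have := frontier_closed (s := s) hl (t, x, y) ((hmem t x y).mpr ⟨ht, by omega, hyn, hxy⟩)
        hcon.1 hcon.2
      dsimp only at this hx hy
      omega
  · rintro ⟨β, hβ⟩
    have key : ∀ l' : List (ℕ × ℕ × ℕ), SweepSorted l' → (∀ e ∈ l', e ∈ l) →
        ∀ t < τ, (∀ e ∈ l', e.1 ≤ t) → l'.foldl (sweepStep S) s < β t := by
      intro l'
      induction l' using List.reverseRecOn with
      | nil => exact fun _ _ t ht _ => hβ.start_lt t ht
      | append_singleton l' e ih =>
        intro hs' hsub t ht hall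
        obtain ⟨h1, h2⟩ := hs'.append_singleton
        have ih' := ih h1 fun a ha => hsub a (List.mem_append_left _ ha)
        obtain ⟨he1, he2, he3, he4⟩ := (hmem e.1 e.2.1 e.2.2).mp
          (hsub e (List.mem_append_right _ (List.mem_singleton_self e)))
        have h3 := ih' e.1 he1 fun a ha => by have := h2 a ha; omega
        have h4 := ih' t ht fun a ha => hall a (List.mem_append_left _ ha)
        have h5 := hβ.mono e.1 t (hall e (List.mem_append_right _ (List.mem_singleton_self e))) ht
        rw [List.foldl_append, List.foldl_cons, List.foldl_nil]
        generalize l'.foldl (sweepStep S) s = f at h3 h4 ⊢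
        unfold sweepStep
        split_ifs with hg
        · by_contra hcon
          rcases hβ.hit e.1 he1 e.2.1 e.2.2 (by omega) (by omega) he3 he4 with h | h
          · exact hg.1 h
          · exact hg.2.1 h
        · exact h4
    rcases Nat.eq_zero_or_pos τ with h0 | hpos
    · have : l = [] := List.eq_nil_iff_forall_not_mem.mpr fun e he => by
        have := ((hmem e.1 e.2.1 e.2.2).mp he).1
        omega
      rw [this]; exact hsz
    · exact lt_of_lt_of_le (key l hl (fun _ h => h) (τ - 1) (by omega) fun e he => by
        have := ((hmem e.1 e.2.1 e.2.2).mp he).1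
        omega) (hβ.le_finish (τ - 1) (by omega))

end TemporalPermutation

/-! ### Reasoning about word RAM programs -/

namespace WordRAM

/-- Assignment to the register `x`. -/
def State.setReg (σ : State) (x v : ℕ) : State :=
  ⟨Function.update σ.reg x v, σ.arr⟩

/-- Assignment to the entry `i` of the array `a`. -/
def State.setArr (σ : State) (a i v : ℕ) : State :=
  ⟨σ.reg, Function.update σ.arr a (Function.update (σ.arr a) i v)⟩

@[simp] theorem State.setReg_reg (σ : State) (x v y : ℕ) :
    (σ.setReg x v).reg y = if y = x then v else σ.reg y := by
  simp [State.setReg, Function.update_apply]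

@[simp] theorem State.setReg_arr (σ : State) (x v : ℕ) : (σ.setReg x v).arr = σ.arr := rfl

@[simp] theorem State.setArr_reg (σ : State) (a i v : ℕ) : (σ.setArr a i v).reg = σ.reg := rfl

@[simp] theorem State.setArr_arr (σ : State) (a i v b j : ℕ) :
    (σ.setArr a i v).arr b j = if b = a ∧ j = i then v else σ.arr b j := by
  simp only [State.setArr, Function.update_apply]
  by_cases h : b = a
  · subst h; simp [Function.update_apply]
  · simp [h]

namespace Program

/-- The program contains an assignment to the register `x`. -/
def writesReg (x : ℕ) : Program → Bool
  | skip => false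
  | assign y _ => x == y
  | store _ _ _ => false
  | seq p q => p.writesReg x || q.writesReg x
  | ite _ p q => p.writesReg x || q.writesReg x
  | loop _ p => p.writesReg x

/-- The program contains an assignment to an entry of the array `a`. -/
def writesArr (a : ℕ) : Program → Bool
  | skip => false
  | assign _ _ => false
  | store b _ _ => a == b
  | seq p q => p.writesArr a || q.writesArr a
  | ite _ p q => p.writesArr a || q.writesArr a
  | loop _ p => p.writesArr a

/-- The program contains no loop. -/
def straight : Program → Bool
  | skip => true
  | assign _ _ => true
  | store _ _ _ => true
  | seq p q => p.straight && q.straight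
  | ite _ p q => p.straight && q.straight
  | loop _ _ => false

/-- The effect of a program without loops. -/
def apply (w : ℕ) : Program → State → State
  | skip, σ => σ
  | assign x e, σ => σ.setReg x (e.eval w σ)
  | store a i e, σ => σ.setArr a (i.eval w σ) (e.eval w σ)
  | seq p q, σ => q.apply w (p.apply w σ)
  | ite e p q, σ => if e.eval w σ = 0 then q.apply w σ else p.apply w σ
  | loop _ _, σ => σ

/-- A bound for the time of a program without loops. -/
def maxCost : Program → ℕ
  | skip => 1
  | assign _ e => e.cost + 1
  | store _ i e => i.cost + e.cost + 1
  | seq p q => p.maxCost + q.maxCost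
  | ite e p q => e.cost + 1 + (p.maxCost + q.maxCost)
  | loop _ _ => 0

/-- `for i := 0, …, reg b - 1 do p` -/
def forLoop (i b : ℕ) (p : Program) : Program :=
  .seq (.assign i (.const 0))
    (.loop (.lt (.reg i) (.reg b)) (.seq p (.assign i (.add (.reg i) (.const 1)))))

end Program

/-- The states agree on all registers and arrays to which `p` does not write. -/
structure Frame (p : Program) (σ σ' : State) : Prop where
  reg : ∀ x, p.writesReg x = false → σ'.reg x = σ.reg x
  arr : ∀ a, p.writesArr a = false → σ'.arr a = σ.arr a

theorem Frame.refl (p : Program) (σ : State) : Frame p σ σ :=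
  ⟨fun _ _ => rfl, fun _ _ => rfl⟩

theorem Frame.trans {p : Program} {σ σ' σ'' : State} (h : Frame p σ σ') (h' : Frame p σ' σ'') :
    Frame p σ σ'' :=
  ⟨fun x hx => (h'.reg x hx).trans (h.reg x hx), fun a ha => (h'.arr a ha).trans (h.arr a ha)⟩

theorem Frame.mono {p q : Program} {σ σ' : State} (h : Frame p σ σ')
    (hr : ∀ x, q.writesReg x = false → p.writesReg x = false)
    (ha : ∀ a, q.writesArr a = false → p.writesArr a = false) : Frame q σ σ' :=
  ⟨fun x hx => h.reg x (hr x hx), fun a h' => h.arr a (ha a h')⟩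

theorem Exec.frame {w : ℕ} {p : Program} {σ σ' : State} {T : ℕ} (h : Exec w p σ T σ') :
    Frame p σ σ' := by
  induction h with
  | skip σ => exact Frame.refl _ _
  | assign x e σ =>
    refine ⟨fun y hy => ?_, fun _ _ => rfl⟩
    have : y ≠ x := by simpa [Program.writesReg] using hy
    simp [this]
  | store a i e σ =>
    refine ⟨fun _ _ => rfl, fun b hb => ?_⟩
    have : b ≠ a := by simpa [Program.writesArr] using hb
    simp [this]
  | seq _ _ ih ih' =>
    exact (ih.mono (by simp +contextual [Program.writesReg]) (by simp +contextual
      [Program.writesArr])).trans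
      (ih'.mono (by simp +contextual [Program.writesReg]) (by simp +contextual [Program.writesArr]))
  | ite_true _ _ ih =>
    exact ih.mono (by simp +contextual [Program.writesReg]) (by simp +contextual
      [Program.writesArr])
  | ite_false _ _ ih =>
    exact ih.mono (by simp +contextual [Program.writesReg]) (by simp +contextual
      [Program.writesArr])
  | loop_true _ _ _ ih ih' =>
    exact (ih.mono (by simp +contextual [Program.writesReg])
      (by simp +contextual [Program.writesArr])).trans ih'
  | loop_false _ => exact Frame.refl _ _

/-- Total correctness with a time bound: started in `σ`, the program `p` stops after at most `B`
units of time in a state that satisfies `Q`. -/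
def Runs (w : ℕ) (p : Program) (σ : State) (B : ℕ) (Q : State → Prop) : Prop :=
  ∃ T σ', Exec w p σ T σ' ∧ T ≤ B ∧ Q σ'

theorem Runs.mono {w : ℕ} {p : Program} {σ : State} {B B' : ℕ} {Q Q' : State → Prop}
    (h : Runs w p σ B Q) (hB : B ≤ B') (hQ : ∀ σ', Frame p σ σ' → Q σ' → Q' σ') :
    Runs w p σ B' Q' := by
  obtain ⟨T, σ', h1, h2, h3⟩ := h
  exact ⟨T, σ', h1, h2.trans hB, hQ σ' h1.frame h3⟩

theorem Runs.seq {w : ℕ} {p q : Program} {σ : State} {B B' : ℕ} {Q Q' : State → Prop}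
    (h : Runs w p σ B Q) (h' : ∀ σ', Frame p σ σ' → Q σ' → Runs w q σ' B' Q') :
    Runs w (.seq p q) σ (B + B') Q' := by
  obtain ⟨T, σ', h1, h2, h3⟩ := h
  obtain ⟨T', σ'', h4, h5, h6⟩ := h' σ' h1.frame h3
  exact ⟨T + T', σ'', .seq h1 h4, by omega, h6⟩

theorem Runs.ite {w : ℕ} {e : Expr} {p q : Program} {σ : State} {B : ℕ} {Q : State → Prop}
    (h : e.eval w σ ≠ 0 → Runs w p σ B Q) (h' : e.eval w σ = 0 → Runs w q σ B Q) :
    Runs w (.ite e p q) σ (e.cost + 1 + B) Q := by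
  by_cases he : e.eval w σ = 0
  · obtain ⟨T, σ', h1, h2, h3⟩ := h' he
    exact ⟨_, σ', .ite_false he h1, by omega, h3⟩
  · obtain ⟨T, σ', h1, h2, h3⟩ := h he
    exact ⟨_, σ', .ite_true he h1, by omega, h3⟩

theorem Runs.straight {w : ℕ} {p : Program} (hp : p.straight = true) {σ : State} {B : ℕ}
    {Q : State → Prop} (hB : p.maxCost ≤ B) (hQ : Q (p.apply w σ)) : Runs w p σ B Q := by
  suffices H : ∀ σ, ∃ T, Exec w p σ T (p.apply w σ) ∧ T ≤ p.maxCost by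
    obtain ⟨T, h1, h2⟩ := H σ
    exact ⟨T, _, h1, h2.trans hB, hQ⟩
  clear hQ hB
  induction p with
  | skip => exact fun σ => ⟨1, .skip σ, le_rfl⟩
  | assign x e => exact fun σ => ⟨_, .assign x e σ, le_rfl⟩
  | store a i e => exact fun σ => ⟨_, .store a i e σ, le_rfl⟩
  | seq p q ihp ihq =>
    rw [Program.straight, Bool.and_eq_true] at hp
    intro σ
    obtain ⟨T, h1, h2⟩ := ihp hp.1 σ
    obtain ⟨T', h3, h4⟩ := ihq hp.2 (p.apply w σ)
    exact ⟨_, .seq h1 h3, by rw [Program.maxCost]; omega⟩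
  | ite e p q ihp ihq =>
    rw [Program.straight, Bool.and_eq_true] at hp
    intro σ
    rw [Program.apply, Program.maxCost]
    split_ifs with he
    · obtain ⟨T, h1, h2⟩ := ihq hp.2 σ
      exact ⟨_, .ite_false he h1, by omega⟩
    · obtain ⟨T, h1, h2⟩ := ihp hp.1 σ
      exact ⟨_, .ite_true he h1, by omega⟩
  | loop e p _ => simp [Program.straight] at hp

/-- Counting loops. In the step of an invariant, everything to which the loop does not write is
known to be unchanged. -/
theorem Runs.forLoop_sum {w i b N : ℕ} {p : Program} {σ : State} (Inv : ℕ → State → Prop)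
    (cost : ℕ → ℕ) (hb : σ.reg b = N) (hN : N < 2 ^ w) (hib : i ≠ b)
    (hpi : p.writesReg i = false) (hpb : p.writesReg b = false) (h0 : Inv 0 (σ.setReg i 0))
    (hstep : ∀ j < N, ∀ σ', σ'.reg i = j → Frame (.forLoop i b p) σ σ' → Inv j σ' →
      Runs w p σ' (cost j) fun σ'' => Inv (j + 1) (σ''.setReg i (j + 1))) :
    Runs w (.forLoop i b p) σ (∑ j ∈ Finset.range N, (cost j + 8) + 6) fun σ' => Inv N σ' := by
  have hwb : (Program.forLoop i b p).writesReg b = false := by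
    simp [Program.forLoop, Program.writesReg, hpb, hib.symm]
  have key : ∀ d j, j + d = N → ∀ σ', σ'.reg i = j → Frame (.forLoop i b p) σ σ' → Inv j σ' →
      Runs w (.loop (.lt (.reg i) (.reg b)) (.seq p (.assign i (.add (.reg i) (.const 1))))) σ'
        (∑ x ∈ Finset.Ico j N, (cost x + 8) + 4) fun σ' => Inv N σ' := by
    intro d
    induction d with
    | zero =>
      intro j hj σ' hi hf hinv
      obtain rfl : j = N := hj
      refine ⟨_, σ', .loop_false ?_, ?_, hinv⟩
      · simp [Expr.eval, hi, hf.reg b hwb, hb]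
      · simp [Expr.cost]
    | succ d ih =>
      intro j hj σ' hi hf hinv
      obtain ⟨T, σ'', h1, h2, h3⟩ := hstep j (by omega) σ' hi hf hinv
      have hi' : σ''.reg i = j := by rw [h1.frame.reg i hpi, hi]
      have hval : (Expr.add (.reg i) (.const 1)).eval w σ'' = j + 1 := by
        simp only [Expr.eval, hi']
        rw [Nat.mod_eq_of_lt (by omega : 1 < 2 ^ w), Nat.mod_eq_of_lt (by omega)]
      have h4 := Exec.assign (w := w) i (.add (.reg i) (.const 1)) σ''
      rw [hval] at h4
      have hf' : Frame (.forLoop i b p) σ' (σ''.setReg i (j + 1)) := by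
        refine (Frame.mono (q := .forLoop i b p) (Exec.seq h1 h4).frame ?_ ?_)
        · simp +contextual [Program.forLoop, Program.writesReg]
        · simp +contextual [Program.forLoop, Program.writesArr]
      obtain ⟨T', σ''', h5, h6, h7⟩ := ih (j + 1) (by omega) (σ''.setReg i (j + 1)) (by simp)
        (hf.trans hf') h3
      refine ⟨_, σ''', .loop_true ?_ (.seq h1 h4) h5, ?_, h7⟩
      · simp only [Expr.eval, hi, hf.reg b hwb, hb]
        rw [if_pos (by omega)]
        exact one_ne_zero
      · rw [Finset.sum_eq_sum_Ico_succ_bot (by omega)]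
        simp only [Expr.cost]
        omega
  have h1 := Exec.assign (w := w) i (.const 0) σ
  have hval : (Expr.const 0).eval w σ = 0 := by simp [Expr.eval]
  rw [hval] at h1
  have hf : Frame (.forLoop i b p) σ (σ.setReg i 0) := by
    refine h1.frame.mono ?_ ?_
    · simp +contextual [Program.forLoop, Program.writesReg]
    · simp +contextual [Program.forLoop, Program.writesArr]
  obtain ⟨T, σ', h2, h3, h4⟩ := key N 0 (by omega) (σ.setReg i 0) (by simp) hf h0
  refine ⟨_, σ', .seq h1 h2, ?_, h4⟩
  rw [← Finset.range_eq_Ico] at h3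
  simp only [Expr.cost]
  omega

theorem Runs.forLoop {w i b N B : ℕ} {p : Program} {σ : State} (Inv : ℕ → State → Prop)
    (hb : σ.reg b = N) (hN : N < 2 ^ w) (hib : i ≠ b)
    (hpi : p.writesReg i = false) (hpb : p.writesReg b = false) (h0 : Inv 0 (σ.setReg i 0))
    (hstep : ∀ j < N, ∀ σ', σ'.reg i = j → Frame (.forLoop i b p) σ σ' → Inv j σ' →
      Runs w p σ' B fun σ'' => Inv (j + 1) (σ''.setReg i (j + 1))) :
    Runs w (.forLoop i b p) σ (N * (B + 8) + 6) fun σ' => Inv N σ' :=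
  (Runs.forLoop_sum Inv (fun _ => B) hb hN hib hpi hpb h0 hstep).mono (by simp) fun _ _ h => h

/-- Loops with a measure that decreases in each iteration. -/
theorem Runs.loop {w B : ℕ} {e : Expr} {p : Program} (Inv : State → Prop) (μ : State → ℕ)
    (hstep : ∀ σ, Inv σ → e.eval w σ ≠ 0 → Runs w p σ B fun σ' => Inv σ' ∧ μ σ' < μ σ)
    {σ : State} (h : Inv σ) :
    Runs w (.loop e p) σ (μ σ * (e.cost + 1 + B) + (e.cost + 1)) fun σ' =>
      Inv σ' ∧ e.eval w σ' = 0 := by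
  obtain ⟨m, hm⟩ : ∃ m, m = μ σ := ⟨_, rfl⟩
  induction m using Nat.strong_induction_on generalizing σ with
  | _ m ih =>
    by_cases he : e.eval w σ = 0
    · exact ⟨_, σ, .loop_false he, by omega, h, he⟩
    · obtain ⟨T, σ', h1, h2, h3, h4⟩ := hstep σ h he
      obtain ⟨T', σ'', h5, h6, h7⟩ := ih (μ σ') (hm ▸ h4) h3 rfl
      refine ⟨_, σ'', .loop_true he h1 h5, ?_, h7⟩
      have : (μ σ' + 1) * (e.cost + 1 + B) ≤ μ σ * (e.cost + 1 + B) := Nat.mul_le_mul_right _ h4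
      rw [Nat.add_mul] at this
      omega

end WordRAM

/-! ### The program: preprocessing -/

namespace TemporalPermutation

open WordRAM

/-- Sequential composition of programs. -/
infixr:50 " ;; " => Program.seq

/-- The words are long enough for all numbers that occur: `n` vertices, lifetime `τ`, separator
size `k` and `m` time-edges. -/
structure Fits (w n τ k m : ℕ) : Prop where
  adj : τ * n * n < 2 ^ w
  items : (τ + 1) * (n + 1) * (2 * k + 1) < 2 ^ w
  input : 3 * m + 9 < 2 ^ w

theorem index_lt {a b i j : ℕ} (hi : i < a) (hj : j < b) : i * b + j < a * b := by
  have : (i + 1) * b ≤ a * b := Nat.mul_le_mul_right _ hi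
  rw [Nat.add_mul] at this
  omega

theorem index_inj {b i j i' j' : ℕ} (hj : j < b) (hj' : j' < b) (h : i * b + j = i' * b + j') :
    i = i' ∧ j = j' := by
  have h1 : (i * b + j) / b = i := by
    rw [Nat.mul_comm, Nat.mul_add_div (by omega), Nat.div_eq_of_lt hj, Nat.add_zero]
  have h2 : (i' * b + j') / b = i' := by
    rw [Nat.mul_comm, Nat.mul_add_div (by omega), Nat.div_eq_of_lt hj', Nat.add_zero]
  have : i = i' := by rw [← h1, h, h2]
  subst this
  exact ⟨rfl, by omega⟩

theorem Fits.k_lt {w n τ k m : ℕ} (h : Fits w n τ k m) : n + 2 * k + 1 < 2 ^ w := by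
  have h1 := h.items
  have : n + 2 * k + 1 ≤ (τ + 1) * (n + 1) * (2 * k + 1) := by
    calc n + 2 * k + 1 ≤ 1 * (n + 1) * (2 * k + 1) := by nlinarith [Nat.zero_le (n * k)]
      _ ≤ _ := by gcongr; omega
  omega

theorem ite_or_ite {A B C D : Prop} [Decidable A] [Decidable B] [Decidable C] [Decidable D]
    (h : D ↔ (A ∨ B) ∨ C) :
    (if A then 1 else if B then 1 else if C then 1 else 0) = if D then 1 else 0 := by
  by_cases hA : A <;> by_cases hB : B <;> by_cases hC : C <;> simp [h, hA, hB, hC]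

/-- Registers: `1` is the number of vertices, `2` the lifetime, `3` and `4` are the terminals,
    `5` is
the separator size `k`, `6` the number of time-edges, `11` is `2 * k + 1` and `12` the number of
gaps. Register `7` tells whether the vertices are renumbered in reverse order, which makes the
first terminal smaller than the second one. -/
def readHeader : Program :=
  .assign 1 (.load 0 (.const 0)) ;; .assign 2 (.load 0 (.const 1)) ;;
  .assign 3 (.load 0 (.const 2)) ;; .assign 4 (.load 0 (.const 3)) ;;
  .assign 5 (.load 0 (.const 4)) ;; .assign 6 (.load 0 (.const 5)) ;;
  .assign 11 (.add (.mul (.const 2) (.reg 5)) (.const 1)) ;;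
  .assign 12 (.add (.reg 1) (.const 1)) ;;
  .ite (.lt (.reg 4) (.reg 3))
    (.assign 7 (.const 1) ;;
      .assign 3 (.sub (.sub (.reg 1) (.const 1)) (.reg 3)) ;;
      .assign 4 (.sub (.sub (.reg 1) (.const 1)) (.reg 4)))
    .skip

/-- The new number of the vertex `x`. -/
def renumber (n : ℕ) (flip : Bool) (x : ℕ) : ℕ := if flip then n - 1 - x else x

/-- The registers that keep their values after the header has been read. -/
structure Header (n τ s z k m : ℕ) (σ : State) : Prop where
  n_eq : σ.reg 1 = n
  τ_eq : σ.reg 2 = τ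
  s_eq : σ.reg 3 = s
  z_eq : σ.reg 4 = z
  k_eq : σ.reg 5 = k
  m_eq : σ.reg 6 = m
  width : σ.reg 11 = 2 * k + 1
  gaps : σ.reg 12 = n + 1

theorem Header.frame {n τ s z k m : ℕ} {σ σ' : State} {p : Program} (h : Header n τ s z k m σ)
    (hf : Frame p σ σ') (hp : ([1, 2, 3, 4, 5, 6, 11, 12].all fun x => !p.writesReg x) = true) :
    Header n τ s z k m σ' := by
  simp only [List.all_cons, List.all_nil, Bool.and_true, Bool.and_eq_true, Bool.not_eq_true'] at hp
  obtain ⟨h1, h2, h3, h4, h5, h6, h11, h12⟩ := hp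
  exact ⟨by rw [hf.reg _ h1, h.n_eq], by rw [hf.reg _ h2, h.τ_eq], by rw [hf.reg _ h3, h.s_eq],
    by rw [hf.reg _ h4, h.z_eq], by rw [hf.reg _ h5, h.k_eq], by rw [hf.reg _ h6, h.m_eq],
    by rw [hf.reg _ h11, h.width], by rw [hf.reg _ h12, h.gaps]⟩

theorem readHeader_runs {w n τ k m s z : ℕ} (hw : Fits w n τ k m) {σ : State}
    (h0 : σ.arr 0 0 = n) (h1 : σ.arr 0 1 = τ) (h2 : σ.arr 0 2 = s) (h3 : σ.arr 0 3 = z)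
    (h4 : σ.arr 0 4 = k) (h5 : σ.arr 0 5 = m) (h7 : σ.reg 7 = 0) :
    Runs w readHeader σ 100 fun σ' =>
      Header n τ (renumber n (decide (z < s)) s) (renumber n (decide (z < s)) z) k m σ' ∧
      σ'.reg 7 = if z < s then 1 else 0 := by
  have hk := hw.k_lt
  have hin := hw.input
  have e0 : 0 < 2 ^ w := by omega
  have e1 : 1 < 2 ^ w := by omega
  have e2 : 2 < 2 ^ w := by omega
  have e3 : 3 < 2 ^ w := by omega
  have e4 : 4 < 2 ^ w := by omega
  have e5 : 5 < 2 ^ w := by omega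
  have e6 : 2 * k < 2 ^ w := by omega
  have e7 : 2 * k + 1 < 2 ^ w := by omega
  have e8 : n + 1 < 2 ^ w := by omega
  refine Runs.straight rfl (by decide) ?_
  by_cases hzs : z < s
  · constructor
    · constructor <;>
      simp [readHeader, Program.apply, Expr.eval, State.setReg_reg, State.setReg_arr,
        Nat.mod_eq_of_lt, e0, e1, e2, e3, e4, e5, e6, e7, e8, h0, h1, h2, h3, h4, h5, renumber, hzs]
    · simp [readHeader, Program.apply, Expr.eval, State.setReg_reg, State.setReg_arr,
        Nat.mod_eq_of_lt, e0, e1, e2, e3, e4, e5, e6, e7, e8, h0, h1, h2, h3, h4, h5, hzs]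
  · constructor
    · constructor <;>
      simp [readHeader, Program.apply, Expr.eval, State.setReg_reg, State.setReg_arr,
        Nat.mod_eq_of_lt, e0, e1, e2, e3, e4, e5, e6, e7, e8, h0, h1, h2, h3, h4, h5, renumber, hzs]
    · simp [readHeader, Program.apply, Expr.eval, State.setReg_reg, State.setReg_arr,
        Nat.mod_eq_of_lt, e0, e1, e2, e3, e4, e5, e6, e7, e8, h0, h1, h2, h3, h4, h5, hzs, h7]

/-- Fills array `1` with the adjacency matrices of the layers: the entry for the layer `t` and the
vertices `u`, `v` has the index `(t * n + u) * n + v`. -/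
def readEdges : Program :=
  .forLoop 20 6
    (.assign 30 (.load 0 (.add (.mul (.const 3) (.reg 20)) (.const 6))) ;;
    .assign 31 (.load 0 (.add (.mul (.const 3) (.reg 20)) (.const 7))) ;;
    .assign 32 (.load 0 (.add (.mul (.const 3) (.reg 20)) (.const 8))) ;;
    .ite (.reg 7)
      (.assign 30 (.sub (.sub (.reg 1) (.const 1)) (.reg 30)) ;;
      .assign 31 (.sub (.sub (.reg 1) (.const 1)) (.reg 31))) .skip ;;
    .store 1 (.add (.mul (.add (.mul (.reg 32) (.reg 1)) (.reg 30)) (.reg 1)) (.reg 31))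
      (.const 1) ;;
    .store 1 (.add (.mul (.add (.mul (.reg 32) (.reg 1)) (.reg 31)) (.reg 1)) (.reg 30)) (.const 1))

theorem readEdges_runs {w n τ k m s z : ℕ} (hw : Fits w n τ k m) {σ : State} {p : ℕ → ℕ → ℕ}
    (hσ : Header n τ s z k m σ) {flip : Bool} (h7 : σ.reg 7 = if flip then 1 else 0)
    {a b t : ℕ → ℕ} (ha : ∀ i < m, σ.arr 0 (3 * i + 6) = a i ∧ a i < n)
    (hb : ∀ i < m, σ.arr 0 (3 * i + 7) = b i ∧ b i < n)
    (ht : ∀ i < m, σ.arr 0 (3 * i + 8) = t i ∧ t i < τ)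
    (hp : ∀ x < τ, ∀ u < n, ∀ v < n, Inverts (p x) u v ↔ ∃ i < m, t i = x ∧
      ((renumber n flip (a i) = u ∧ renumber n flip (b i) = v) ∨
        (renumber n flip (a i) = v ∧ renumber n flip (b i) = u)))
    (h1 : ∀ i, σ.arr 1 i = 0) :
    Runs w readEdges σ (m * 100 + 6) fun σ' => ∀ x < τ, ∀ u < n, ∀ v < n,
      σ'.arr 1 ((x * n + u) * n + v) = if Inverts (p x) u v then 1 else 0 := by
  have hin := hw.input
  have hadj := hw.adj
  refine (Runs.forLoop (N := m) (B := 92)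
    (fun j σ' => ∀ x < τ, ∀ u < n, ∀ v < n, σ'.arr 1 ((x * n + u) * n + v) =
      if ∃ i < j, t i = x ∧ ((renumber n flip (a i) = u ∧ renumber n flip (b i) = v) ∨
        (renumber n flip (a i) = v ∧ renumber n flip (b i) = u)) then 1 else 0)
    hσ.m_eq (by omega) (by decide) rfl rfl ?_ ?_).mono le_rfl ?_
  · intro x _ u _ v _
    simp [h1]
  · intro j hj σ' hj' hf hinv
    obtain ⟨e1, e2⟩ := ha j hj
    obtain ⟨e3, e4⟩ := hb j hj
    obtain ⟨e5, e6⟩ := ht j hj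
    rw [← hf.arr 0 rfl] at e1 e3 e5
    rw [← hf.reg 7 rfl] at h7
    have hn : σ'.reg 1 = n := by rw [hf.reg 1 rfl, hσ.n_eq]
    have hr : ∀ y < n, renumber n flip y < n := fun y hy => by unfold renumber; split_ifs <;> omega
    have c1 : 1 < 2 ^ w := by omega
    have c3 : 3 < 2 ^ w := by omega
    have c6 : 6 < 2 ^ w := by omega
    have c7 : 7 < 2 ^ w := by omega
    have c8 : 8 < 2 ^ w := by omega
    have d0 : 3 * j < 2 ^ w := by omega
    have d6 : 3 * j + 6 < 2 ^ w := by omega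
    have d7 : 3 * j + 7 < 2 ^ w := by omega
    have d8 : 3 * j + 8 < 2 ^ w := by omega
    have hidx : ∀ u < n, ∀ v < n, t j * n < 2 ^ w ∧ t j * n + u < 2 ^ w ∧
        (t j * n + u) * n < 2 ^ w ∧ (t j * n + u) * n + v < 2 ^ w := fun u hu v hv => by
      have f1 := index_lt e6 hu
      have f2 := index_lt f1 hv
      have f3 : t j * n + u ≤ (t j * n + u) * n := Nat.le_mul_of_pos_right _ (by omega)
      omega
    obtain ⟨g1, g2, g3, g4⟩ := hidx _ (hr _ e2) _ (hr _ e4)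
    obtain ⟨-, g5, g6, g7⟩ := hidx _ (hr _ e4) _ (hr _ e2)
    refine Runs.straight rfl (by decide) ?_
    intro x hx u hu v hv
    have hcond : (∃ i < j + 1, t i = x ∧ ((renumber n flip (a i) = u ∧ renumber n flip (b i) = v) ∨
        (renumber n flip (a i) = v ∧ renumber n flip (b i) = u))) ↔
        ((x * n + u) * n + v = (t j * n + renumber n flip (b j)) * n + renumber n flip (a j) ∨
        (x * n + u) * n + v = (t j * n + renumber n flip (a j)) * n + renumber n flip (b j)) ∨
        ∃ i < j, t i = x ∧ ((renumber n flip (a i) = u ∧ renumber n flip (b i) = v) ∨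
        (renumber n flip (a i) = v ∧ renumber n flip (b i) = u)) := by
      have hinj : ∀ u' < n, ∀ v' < n, (x * n + u) * n + v = (t j * n + u') * n + v' ↔
          t j = x ∧ u' = u ∧ v' = v := by
        intro u' hu' v' hv'
        constructor
        · intro h
          obtain ⟨i1, i2⟩ := index_inj hv hv' h
          obtain ⟨i3, i4⟩ := index_inj hu hu' i1
          exact ⟨i3.symm, i4.symm, i2.symm⟩
        · rintro ⟨rfl, rfl, rfl⟩; rfl
      rw [hinj _ (hr _ e4) _ (hr _ e2), hinj _ (hr _ e2) _ (hr _ e4)]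
      constructor
      · rintro ⟨i, hi, h⟩
        rcases Nat.lt_succ_iff_lt_or_eq.mp hi with hi | rfl
        · exact .inr ⟨i, hi, h⟩
        · left; tauto
      · rintro (h | ⟨i, hi, h⟩)
        · exact ⟨j, Nat.lt_succ_self j, by tauto⟩
        · exact ⟨i, by omega, h⟩
    have hprev := hinv x hx u hu v hv
    have hread : ∀ σ'' : State, σ''.arr 1 = Function.update (Function.update (σ'.arr 1)
        ((t j * n + renumber n flip (a j)) * n + renumber n flip (b j)) 1)
        ((t j * n + renumber n flip (b j)) * n + renumber n flip (a j)) 1 →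
        σ''.arr 1 ((x * n + u) * n + v) =
        if ∃ i < j + 1, t i = x ∧ ((renumber n flip (a i) = u ∧ renumber n flip (b i) = v) ∨
        (renumber n flip (a i) = v ∧ renumber n flip (b i) = u)) then 1 else 0 := by
      intro σ'' h
      rw [h, Function.update_apply, Function.update_apply, hprev]
      exact ite_or_ite hcond
    apply hread
    rw [State.setReg_arr]
    cases flip
    · simp only [renumber, Bool.false_eq_true, if_false] at g1 g2 g3 g4 g5 g6 g7 h7 ⊢
      simp [Program.apply, Expr.eval, hj', hn, h7, e1, e3, e5, Nat.mod_eq_of_lt, c1, c3, c6, c7, c8,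
        d0, d6, d7, d8, g1, g2, g3, g4, g5, g6, g7, State.setArr]
    · simp only [renumber, if_true] at g1 g2 g3 g4 g5 g6 g7 h7 ⊢
      simp [Program.apply, Expr.eval, hj', hn, h7, e1, e3, e5, Nat.mod_eq_of_lt, c1, c3, c6, c7, c8,
        d0, d6, d7, d8, g1, g2, g3, g4, g5, g6, g7, State.setArr]
  · intro σ' _ h x hx u hu v hv
    rw [h x hx u hu v hv]
    simp only [hp x hx u hu v hv]

theorem card_filter_range_succ (P : ℕ → Prop) [DecidablePred P] (j : ℕ) :
    ((Finset.range (j + 1)).filter P).card =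
      ((Finset.range j).filter P).card + if P j then 1 else 0 := by
  rw [Finset.card_filter, Finset.sum_range_succ, ← Finset.card_filter]

/-- Array `1` holds the adjacency matrices of the layers. -/
def HoldsAdj (n τ : ℕ) (p : ℕ → ℕ → ℕ) (σ : State) : Prop :=
  ∀ t < τ, ∀ u < n, ∀ v < n, σ.arr 1 ((t * n + u) * n + v) = if Inverts (p t) u v then 1 else 0

/-- Array `2` holds the permutations of the layers. -/
def HoldsPos (n τ : ℕ) (p : ℕ → ℕ → ℕ) (σ : State) : Prop :=
  ∀ t < τ, ∀ x < n, σ.arr 2 (t * n + x) = p t x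

/-- Fills array `2` with the permutations of the layers: the position of a vertex is the number of
vertices that precede it. -/
def computePositions : Program :=
  .forLoop 20 2 (.forLoop 21 1 (.assign 30 (.const 0) ;;
    .forLoop 22 1 (.assign 30 (.add (.reg 30) (.sub (.const 1) (.eq (.lt (.reg 22) (.reg 21))
      (.load 1 (.add (.mul (.add (.mul (.reg 20) (.reg 1)) (.reg 22)) (.reg 1)) (.reg 21))))))) ;;
    .store 2 (.add (.mul (.reg 20) (.reg 1)) (.reg 21)) (.reg 30)))

theorem Fits.index {w n τ k m : ℕ} (hw : Fits w n τ k m) {t u v : ℕ} (ht : t < τ) (hu : u < n)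
    (hv : v < n) : t * n < 2 ^ w ∧ t * n + u < 2 ^ w ∧ (t * n + u) * n < 2 ^ w ∧
      (t * n + u) * n + v + 1 < 2 ^ w := by
  have h0 := hw.adj
  have f1 := index_lt ht hu
  have f2 := index_lt f1 hv
  have f3 : t * n + u ≤ (t * n + u) * n := Nat.le_mul_of_pos_right _ (by omega)
  omega

theorem Fits.n_lt {w n τ k m : ℕ} (h : Fits w n τ k m) : n + 1 < 2 ^ w := by
  have := h.k_lt
  have h1 := h.items
  have : n + 1 < (τ + 1) * (n + 1) * (2 * k + 1) ∨ τ = 0 ∧ k = 0 := by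
    by_cases h : τ = 0 ∧ k = 0
    · exact .inr h
    · left
      have : 2 ≤ (τ + 1) * (2 * k + 1) := by
        rcases Nat.eq_zero_or_pos τ with rfl | hτ
        · have : 1 ≤ k := by omega
          omega
        · nlinarith [Nat.zero_le (τ * k)]
      calc n + 1 < 2 * (n + 1) := by omega
        _ ≤ (τ + 1) * (2 * k + 1) * (n + 1) := Nat.mul_le_mul_right _ this
        _ = _ := by ring
  rcases this with h | ⟨rfl, rfl⟩ <;> omega

theorem Fits.τ_lt {w n τ k m : ℕ} (h : Fits w n τ k m) : τ < 2 ^ w := by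
  have h1 := h.items
  have : τ + 1 ≤ (τ + 1) * (n + 1) * (2 * k + 1) := by
    rw [Nat.mul_assoc]
    exact Nat.le_mul_of_pos_right _ (Nat.mul_pos (by omega) (by omega))
  omega

theorem computePositions_runs {w n τ k m s z : ℕ} (hw : Fits w n τ k m) {σ : State}
    {p : ℕ → ℕ → ℕ} (hσ : Header n τ s z k m σ) (hp : ∀ t < τ, IsPermOn n (p t))
    (hadj : HoldsAdj n τ p σ) :
    Runs w computePositions σ (τ * (n * (n * 100 + 100) + 100) + 6) (HoldsPos n τ p) := by
  have hn := hw.n_lt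
  have hτ := hw.τ_lt
  have hin := hw.input
  have c1 : 1 < 2 ^ w := by omega
  refine (Runs.forLoop (N := τ) (B := n * (n * 100 + 100) + 6) (fun T => HoldsPos n T p)
    hσ.τ_eq hτ (by decide) rfl rfl ?_ ?_).mono (Nat.add_le_add_right (Nat.mul_le_mul_left _
      (by omega)) _) fun _ _ h => h
  · exact fun t ht => absurd ht (by omega)
  intro T hT σ₁ h20 hf₁ hinv₁
  refine (Runs.forLoop (N := n) (B := n * 100 + 40) (fun X σ' => HoldsPos n T p σ' ∧
    ∀ x < X, σ'.arr 2 (T * n + x) = p T x)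
    (by rw [hf₁.reg 1 rfl, hσ.n_eq]) (by omega) (by decide) rfl rfl ?_ ?_).mono
      (Nat.add_le_add_right (Nat.mul_le_mul_left _ (by omega)) _) ?_
  · exact ⟨hinv₁, fun x hx => absurd hx (Nat.not_lt_zero x)⟩
  · intro X hX σ₂ h21 hf₂ hinv₂
    have hn₂ : σ₂.reg 1 = n := by rw [hf₂.reg 1 rfl, hf₁.reg 1 rfl, hσ.n_eq]
    have h20₂ : σ₂.reg 20 = T := by rw [hf₂.reg 20 rfl, h20]
    have ha₂ : σ₂.arr 1 = σ.arr 1 := by rw [hf₂.arr 1 rfl, hf₁.arr 1 rfl]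
    refine Runs.mono (B := 2 + ((n * (20 + 8) + 6) + 10)) (Runs.seq
      (Q := fun σ' => σ'.reg 30 = 0) (Runs.straight rfl (by decide) (by simp [Program.apply,
        Expr.eval])) ?_)
      (by omega) fun _ _ h => h
    intro σ₃ hf₃ h30
    refine Runs.seq (Q := fun σ' => σ'.reg 30 = p T X) ?_ ?_
    · refine (Runs.forLoop (N := n) (fun j σ' => σ'.reg 30 =
        ((Finset.range j).filter fun y => ¬ (y < X ↔ Inverts (p T) y X)).card)
        (by rw [hf₃.reg 1 rfl, hn₂]) (by omega) (by decide) rfl rfl ?_ ?_).mono le_rfl ?_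
      · simpa using h30
      · intro j hj σ₄ h22 hf₄ hinv₄
        have hn₄ : σ₄.reg 1 = n := by rw [hf₄.reg 1 rfl, hf₃.reg 1 rfl, hn₂]
        have h20₄ : σ₄.reg 20 = T := by rw [hf₄.reg 20 rfl, hf₃.reg 20 rfl, h20₂]
        have h21₄ : σ₄.reg 21 = X := by rw [hf₄.reg 21 rfl, hf₃.reg 21 rfl, h21]
        have ha₄ : σ₄.arr 1 ((T * n + j) * n + X) = if Inverts (p T) j X then 1 else 0 := by
          rw [hf₄.arr 1 rfl, hf₃.arr 1 rfl, ha₂]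
          exact hadj T hT j hj X hX
        obtain ⟨g1, g2, g3, g4⟩ := hw.index hT hj hX
        have g5 : (T * n + j) * n + X < 2 ^ w := by omega
        have hle : ((Finset.range j).filter fun y => ¬ (y < X ↔ Inverts (p T) y X)).card ≤ j :=
          (Finset.card_filter_le _ _).trans (Finset.card_range j).le
        have e1 : ((Finset.range j).filter fun y => ¬ (y < X ↔ Inverts
          (p T) y X)).card < 2 ^ w := by
          omega
        have e2 : ((Finset.range j).filter fun y => ¬ (y < X ↔ Inverts
          (p T) y X)).card + 1 < 2 ^ w := by
          omega
        refine Runs.straight rfl (by decide) ?_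
        rw [card_filter_range_succ]
        generalize ((Finset.range j).filter fun y => ¬ (y < X ↔ Inverts (p T) y X)).card = r at *
        by_cases h1 : j < X <;> by_cases h2 : Inverts (p T) j X <;>
          simp [Program.apply, Expr.eval, h22, hn₄, h20₄, h21₄, hinv₄, Nat.mod_eq_of_lt, c1, g1,
            g2, g3,
            g5, ha₄, h1, h2, e1, e2]
      · intro σ' _ h
        rw [h, (hp T hT).card_precede hX]
    · intro σ₄ hf₄ h30'
      obtain ⟨g1, g2, -, -⟩ := hw.index hT hX hX
      have hn₄ : σ₄.reg 1 = n := by rw [hf₄.reg 1 rfl, hf₃.reg 1 rfl, hn₂]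
      have h20₄ : σ₄.reg 20 = T := by rw [hf₄.reg 20 rfl, hf₃.reg 20 rfl, h20₂]
      have h21₄ : σ₄.reg 21 = X := by rw [hf₄.reg 21 rfl, hf₃.reg 21 rfl, h21]
      have ha₄ : σ₄.arr 2 = σ₂.arr 2 := by rw [hf₄.arr 2 rfl, hf₃.arr 2 rfl]
      refine Runs.straight rfl (by decide) ?_
      simp only [Program.apply, Expr.eval, hn₄, h20₄, h21₄, h30', Nat.mod_eq_of_lt, g1, g2,
        HoldsPos, State.setReg_arr, State.setArr_arr, true_and, ha₄]
      constructor
      · intro t ht x hx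
        rw [if_neg fun h => by have := (index_inj hx hX h).1; omega]
        exact hinv₂.1 t ht x hx
      · intro x hx
        split_ifs with h
        · rw [(index_inj (by omega) hX h).2]
        · exact hinv₂.2 x (by omega)
  · intro σ' _ h t ht x hx
    rcases Nat.lt_succ_iff_lt_or_eq.mp ht with ht | rfl
    · exact h.1 t ht x hx
    · exact h.2 x hx

/-- The first entries of the array `f` are the members of the list `L`. -/
def Holds (f : ℕ → ℕ) (L : List ℕ) : Prop := ∀ i (h : i < L.length), f i = L[i]

theorem Holds.append {f f' : ℕ → ℕ} {L : List ℕ} {x : ℕ} (h : Holds f L)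
    (hx : f' L.length = x) (hf : ∀ i < L.length, f' i = f i) : Holds f' (L ++ [x]) := by
  intro i hi
  rw [List.length_append, List.length_singleton] at hi
  rcases Nat.lt_succ_iff_lt_or_eq.mp hi with h' | rfl
  · rw [hf i h', h i h', List.getElem_append_left h']
  · simp [hx]

/-- `x` has an incident edge in some layer. -/
def NonIsolated (n τ : ℕ) (p : ℕ → ℕ → ℕ) (x : ℕ) : Prop :=
  ∃ t ∈ Finset.range τ, ∃ y ∈ Finset.range n, Inverts (p t) x y

instance (n τ : ℕ) (p : ℕ → ℕ → ℕ) : DecidablePred (NonIsolated n τ p) := by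
  intro x; unfold NonIsolated; infer_instance

/-- The non-isolated ones among the vertices `0, …, m - 1`. -/
def vertexList (n τ : ℕ) (p : ℕ → ℕ → ℕ) (m : ℕ) : List ℕ :=
  (List.range m).filter fun x => NonIsolated n τ p x

/-- Array `13` holds the list of the non-isolated vertices, and register `10` its length. -/
def HoldsVertices (σ : State) (L : List ℕ) : Prop :=
  σ.reg 10 = L.length ∧ Holds (σ.arr 13) L

/-- Lists the non-isolated vertices in array `13`. -/
def listVertices : Program :=
  .assign 10 (.const 0) ;; .forLoop 20 1 (.assign 30 (.const 0) ;;
    .forLoop 21 2 (.forLoop 22 1 (.ite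
      (.load 1 (.add (.mul (.add (.mul (.reg 21) (.reg 1)) (.reg 20)) (.reg 1)) (.reg 22)))
      (.assign 30 (.const 1)) .skip)) ;;
    .ite (.reg 30) (.store 13 (.reg 10) (.reg 20) ;; .assign 10 (.add (.reg 10) (.const 1))) .skip)

theorem listVertices_runs {w n τ k m s z : ℕ} (hw : Fits w n τ k m) {σ : State}
    {p : ℕ → ℕ → ℕ} (hσ : Header n τ s z k m σ) (hadj : HoldsAdj n τ p σ) :
    Runs w listVertices σ (n * (τ * (n * 100 + 100) + 100) + 100) fun σ' =>
      HoldsVertices σ' (vertexList n τ p n) := by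
  have hn := hw.n_lt
  have hτ := hw.τ_lt
  have hin := hw.input
  have c1 : 1 < 2 ^ w := by omega
  refine Runs.mono (B := 2 + (n * (2 + (τ * (n * (30 + 8) + 6 + 8) + 6 + 20) + 8) + 6))
    (Runs.seq (Q := fun σ' => σ'.reg 10 = 0)
      (Runs.straight rfl (by decide) (by simp [Program.apply, Expr.eval])) ?_)
    (by nlinarith [Nat.zero_le (n * τ), Nat.zero_le (n * (τ * n))]) fun _ _ h => h
  intro σ₀ hf₀ h10
  refine (Runs.forLoop (N := n) (fun X σ' => HoldsVertices σ' (vertexList n τ p X))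
    (by rw [hf₀.reg 1 rfl, hσ.n_eq]) (by omega) (by decide) rfl rfl ?_ ?_).mono le_rfl fun _ _ h
      => h
  · exact ⟨by simpa [vertexList] using h10, fun i hi => absurd hi (by simp [vertexList])⟩
  intro X hX σ₁ h20 hf₁ hinv₁
  refine Runs.seq (Q := fun σ' => σ'.reg 30 = 0)
    (Runs.straight rfl (by decide) (by simp [Program.apply, Expr.eval])) ?_
  intro σ₂ hf₂ h30
  refine Runs.seq (Q := fun σ' => σ'.reg 30 = 0 ↔ ¬ NonIsolated n τ p X) ?_ ?_
  · refine (Runs.forLoop (N := τ) (fun T σ' => σ'.reg 30 = 0 ↔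
      ∀ t < T, ∀ y < n, ¬ Inverts (p t) X y)
      (by rw [hf₂.reg 2 rfl, hf₁.reg 2 rfl, hf₀.reg 2 rfl, hσ.τ_eq]) hτ (by decide) rfl rfl
      ?_ ?_).mono le_rfl ?_
    · simpa using h30
    · intro T hT σ₃ h21 hf₃ hinv₃
      refine (Runs.forLoop (N := n) (fun Y σ' => σ'.reg 30 = 0 ↔
        (∀ t < T, ∀ y < n, ¬ Inverts (p t) X y) ∧ ∀ y < Y, ¬ Inverts (p T) X y)
        (by rw [hf₃.reg 1 rfl, hf₂.reg 1 rfl, hf₁.reg 1 rfl, hf₀.reg 1 rfl, hσ.n_eq]) (by omega)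
        (by decide) rfl rfl ?_ ?_).mono le_rfl ?_
      · simpa using hinv₃
      · intro Y hY σ₄ h22 hf₄ hinv₄
        have hn₄ : σ₄.reg 1 = n := by
          rw [hf₄.reg 1 rfl, hf₃.reg 1 rfl, hf₂.reg 1 rfl, hf₁.reg 1 rfl, hf₀.reg 1 rfl, hσ.n_eq]
        have h21₄ : σ₄.reg 21 = T := by rw [hf₄.reg 21 rfl, h21]
        have h20₄ : σ₄.reg 20 = X := by rw [hf₄.reg 20 rfl, hf₃.reg 20 rfl, hf₂.reg 20 rfl, h20]
        have ha₄ : σ₄.arr 1 ((T * n + X) * n + Y) = if Inverts (p T) X Y then 1 else 0 := by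
          rw [hf₄.arr 1 rfl, hf₃.arr 1 rfl, hf₂.arr 1 rfl, hf₁.arr 1 rfl, hf₀.arr 1 rfl]
          exact hadj T hT X hX Y hY
        obtain ⟨g1, g2, g3, g4⟩ := hw.index hT hX hY
        have g5 : (T * n + X) * n + Y < 2 ^ w := by omega
        refine Runs.straight rfl (by decide) ?_
        simp only [Nat.lt_succ_iff_lt_or_eq, or_imp, forall_and, forall_eq]
        by_cases h : Inverts (p T) X Y <;>
          simp [Program.apply, Expr.eval, h22, hn₄, h20₄, h21₄, Nat.mod_eq_of_lt, c1, g1, g2, g3,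
            g5, ha₄, h, hinv₄]
      · intro σ' _ h
        simp only [State.setReg_reg, Nat.lt_succ_iff_lt_or_eq, or_imp, forall_and, forall_eq]
        exact h
    · intro σ' _ h
      rw [h]
      simp [NonIsolated]
  · intro σ₃ hf₃ h30'
    have h10₃ : σ₃.reg 10 = (vertexList n τ p X).length := by
      rw [hf₃.reg 10 rfl, hf₂.reg 10 rfl, hinv₁.1]
    have h20₃ : σ₃.reg 20 = X := by rw [hf₃.reg 20 rfl, hf₂.reg 20 rfl, h20]
    have ha₃ : σ₃.arr 13 = σ₁.arr 13 := by rw [hf₃.arr 13 rfl, hf₂.arr 13 rfl]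
    have hlen : (vertexList n τ p X).length ≤ X :=
      (List.length_filter_le _ _).trans (List.length_range).le
    have e1 : (vertexList n τ p X).length + 1 < 2 ^ w := by omega
    refine Runs.straight rfl (by decide) ?_
    by_cases h : NonIsolated n τ p X
    · have hL : vertexList n τ p (X + 1) = vertexList n τ p X ++ [X] := by
        simp [vertexList, List.range_succ, h]
      have h30n : σ₃.reg 30 ≠ 0 := fun h' => (h30'.mp h') h
      rw [hL]
      constructor
      · simp [Program.apply, Expr.eval, h30n, h10₃, Nat.mod_eq_of_lt, c1, e1]
      · refine hinv₁.2.append ?_ fun i hi => ?_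
        · simp [Program.apply, Expr.eval, h30n, h10₃, h20₃]
        · simp [Program.apply, Expr.eval, h30n, h10₃, ha₃, hi.ne]
    · have hL : vertexList n τ p (X + 1) = vertexList n τ p X := by
        simp [vertexList, List.range_succ, h]
      have h30n : σ₃.reg 30 = 0 := h30'.mpr h
      rw [hL]
      constructor
      · simp [Program.apply, Expr.eval, h30n, h10₃]
      · simpa [Program.apply, Expr.eval, h30n, ha₃] using hinv₁.2

/-- The edges `(t, u, v)` with `v < m`. -/
def edgeRow (p : ℕ → ℕ → ℕ) (t u m : ℕ) : List (ℕ × ℕ × ℕ) :=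
  ((List.range m).filter fun v => u < v ∧ p t v < p t u).map fun v => (t, u, v)

/-- The edges `(t, u, v)` with `u < m`. -/
def edgeLayer (n : ℕ) (p : ℕ → ℕ → ℕ) (t m : ℕ) : List (ℕ × ℕ × ℕ) :=
  (List.range m).flatMap fun u => edgeRow p t u n

/-- The edges `(t, u, v)` with `t < m`, in lexicographic order. -/
def edgeList (n : ℕ) (p : ℕ → ℕ → ℕ) (m : ℕ) : List (ℕ × ℕ × ℕ) :=
  (List.range m).flatMap fun t => edgeLayer n p t n

theorem mem_edgeRow {p : ℕ → ℕ → ℕ} {t u m : ℕ} {e : ℕ × ℕ × ℕ} :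
    e ∈ edgeRow p t u m ↔ e.1 = t ∧ e.2.1 = u ∧ u < e.2.2 ∧ e.2.2 < m ∧ p t e.2.2 < p t u := by
  obtain ⟨a, b, c⟩ := e
  simp only [edgeRow, List.mem_map, List.mem_filter, List.mem_range, decide_eq_true_eq,
    Prod.mk.injEq]
  constructor
  · rintro ⟨v, ⟨h1, h2, h3⟩, rfl, rfl, rfl⟩; exact ⟨rfl, rfl, h2, h1, h3⟩
  · rintro ⟨rfl, rfl, h2, h1, h3⟩; exact ⟨c, ⟨h1, h2, h3⟩, rfl, rfl, rfl⟩

theorem mem_edgeList {n τ : ℕ} {p : ℕ → ℕ → ℕ} (t u v : ℕ) :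
    (t, u, v) ∈ edgeList n p τ ↔ t < τ ∧ u < v ∧ v < n ∧ p t v < p t u := by
  simp only [edgeList, edgeLayer, List.mem_flatMap, List.mem_range, mem_edgeRow]
  constructor
  · rintro ⟨t, ht, u, hu, rfl, rfl, h1, h2, h3⟩; exact ⟨ht, h1, h2, h3⟩
  · rintro ⟨ht, h1, h2, h3⟩; exact ⟨t, ht, u, by omega, rfl, rfl, h1, h2, h3⟩

theorem edgeList_sorted {n τ : ℕ} {p : ℕ → ℕ → ℕ} : SweepSorted (edgeList n p τ) := by
  unfold SweepSorted edgeList edgeLayer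
  rw [List.pairwise_flatMap]
  refine ⟨fun t _ => ?_, List.pairwise_lt_range.imp fun {t t'} htt' a ha b hb => ?_⟩
  · rw [List.pairwise_flatMap]
    refine ⟨fun u _ => ?_, List.pairwise_lt_range.imp fun {u u'} huu' a ha b hb => ?_⟩
    · refine List.pairwise_of_forall_mem_list fun a ha b hb => ?_
      rw [mem_edgeRow] at ha hb
      omega
    · rw [mem_edgeRow] at ha hb
      omega
  · simp only [List.mem_flatMap, mem_edgeRow] at ha hb
    obtain ⟨_, _, ha, _⟩ := ha
    obtain ⟨_, _, hb, _⟩ := hb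
    omega

theorem edgeList_nodup {n τ : ℕ} {p : ℕ → ℕ → ℕ} : (edgeList n p τ).Nodup := by
  unfold edgeList edgeLayer
  rw [List.nodup_flatMap]
  refine ⟨fun t _ => ?_, List.nodup_range.imp fun {t t'} htt' a ha hb => ?_⟩
  · rw [List.nodup_flatMap]
    refine ⟨fun u _ => ?_, List.nodup_range.imp fun {u u'} huu' a ha hb => ?_⟩
    · exact (List.nodup_range.filter _).map fun a b h => by simpa using h
    · rw [mem_edgeRow] at ha hb
      omega
  · simp only [List.mem_flatMap, mem_edgeRow] at ha hb
    obtain ⟨_, _, ha, _⟩ := ha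
    obtain ⟨_, _, hb, _⟩ := hb
    omega

/-- Arrays `3` and `4` hold the smaller and the larger endpoints of the edges in the list `L`, and
register `13` holds its length. -/
def HoldsEdges (σ : State) (L : List (ℕ × ℕ × ℕ)) : Prop :=
  σ.reg 13 = L.length ∧ Holds (σ.arr 3) (L.map fun e => e.2.1) ∧
    Holds (σ.arr 4) (L.map fun e => e.2.2)

/-- Lists the edges in lexicographic order. -/
def listEdges : Program :=
  .assign 13 (.const 0) ;; .forLoop 20 2 (.forLoop 21 1 (.forLoop 22 1 (
    .ite (.lt (.reg 21) (.reg 22))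
      (.ite (.load 1 (.add (.mul (.add (.mul (.reg 20) (.reg 1)) (.reg 21)) (.reg 1)) (.reg 22)))
        (.store 3 (.reg 13) (.reg 21) ;; .store 4 (.reg 13) (.reg 22) ;;
          .assign 13 (.add (.reg 13) (.const 1))) .skip) .skip)))

theorem listEdges_runs {w n τ k m s z : ℕ} (hw : Fits w n τ k m) {σ : State}
    {p : ℕ → ℕ → ℕ} (hσ : Header n τ s z k m σ) (hadj : HoldsAdj n τ p σ) :
    Runs w listEdges σ (τ * (n * (n * 100 + 100) + 100) + 100) fun σ' =>
      HoldsEdges σ' (edgeList n p τ) := by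
  have hn := hw.n_lt
  have hτ := hw.τ_lt
  have hin := hw.input
  have c1 : 1 < 2 ^ w := by omega
  refine Runs.mono (B := 2 + (τ * (n * (n * (92 + 8) + 6 + 8) + 6 + 8) + 6))
    (Runs.seq (Q := fun σ' => σ'.reg 13 = 0)
      (Runs.straight rfl (by decide) (by simp [Program.apply, Expr.eval])) ?_)
    (by nlinarith [Nat.zero_le (τ * n)]) fun _ _ h => h
  intro σ₀ hf₀ h13
  have hn₀ : σ₀.reg 1 = n := by rw [hf₀.reg 1 rfl, hσ.n_eq]
  refine (Runs.forLoop (N := τ) (fun T σ' => HoldsEdges σ' (edgeList n p T) ∧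
    σ'.reg 13 ≤ T * n * n)
    (by rw [hf₀.reg 2 rfl, hσ.τ_eq]) (by omega) (by decide) rfl rfl ?_ ?_).mono le_rfl
      fun _ _ h => h.1
  · exact ⟨⟨by simpa [edgeList] using h13, fun i hi => absurd hi (by simp [edgeList]),
      fun i hi => absurd hi (by simp [edgeList])⟩, by simp [h13]⟩
  intro T hT σ₁ h20 hf₁ hinv₁
  refine (Runs.forLoop (N := n) (fun U σ' => HoldsEdges σ' (edgeList n p T ++ edgeLayer n p T U) ∧
    σ'.reg 13 ≤ (T * n + U) * n)
    (by rw [hf₁.reg 1 rfl, hn₀]) (by omega) (by decide) rfl rfl ?_ ?_).mono le_rfl ?_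
  · simpa [edgeLayer, HoldsEdges] using hinv₁
  · intro U hU σ₂ h21 hf₂ hinv₂
    refine (Runs.forLoop (N := n) (fun V σ' =>
      HoldsEdges σ' (edgeList n p T ++ edgeLayer n p T U ++ edgeRow p T U V) ∧
      σ'.reg 13 ≤ (T * n + U) * n + V)
      (by rw [hf₂.reg 1 rfl, hf₁.reg 1 rfl, hn₀]) (by omega) (by decide) rfl rfl ?_ ?_).mono
        le_rfl ?_
    · simpa [edgeRow, HoldsEdges] using hinv₂
    · intro V hV σ₃ h22 hf₃ hinv₃
      have hn₃ : σ₃.reg 1 = n := by rw [hf₃.reg 1 rfl, hf₂.reg 1 rfl, hf₁.reg 1 rfl, hn₀]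
      have h20₃ : σ₃.reg 20 = T := by rw [hf₃.reg 20 rfl, hf₂.reg 20 rfl, h20]
      have h21₃ : σ₃.reg 21 = U := by rw [hf₃.reg 21 rfl, h21]
      have ha₃ : σ₃.arr 1 ((T * n + U) * n + V) = if Inverts (p T) U V then 1 else 0 := by
        rw [hf₃.arr 1 rfl, hf₂.arr 1 rfl, hf₁.arr 1 rfl, hf₀.arr 1 rfl]
        exact hadj T hT U hU V hV
      obtain ⟨g1, g2, g3, g4⟩ := hw.index hT hU hV
      have g5 : (T * n + U) * n + V < 2 ^ w := by omega
      refine Runs.straight rfl (by decide) ?_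
      obtain ⟨⟨i1, i2, i3⟩, i4⟩ := hinv₃
      have hrow : edgeRow p T U (V + 1) =
          edgeRow p T U V ++ if U < V ∧ p T V < p T U then [(T, U, V)] else [] := by
        unfold edgeRow
        rw [List.range_succ, List.filter_append, List.map_append]
        by_cases h : U < V ∧ p T V < p T U <;> simp [h]
      rw [hrow, ← List.append_assoc]
      generalize edgeList n p T ++ edgeLayer n p T U ++ edgeRow p T U V = L at *
      by_cases h : U < V ∧ p T V < p T U
      · have hI : Inverts (p T) U V := .inl h
        have e1 : L.length + 1 < 2 ^ w := by omega
        rw [if_pos h]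
        refine ⟨⟨?_, ?_, ?_⟩, ?_⟩
        · simp [Program.apply, Expr.eval, h22, hn₃, h20₃, h21₃, Nat.mod_eq_of_lt, c1, g1, g2, g3,
            g5, ha₃, h, hI, i1, e1]
        · rw [List.map_append]
          refine i2.append ?_ fun i hi => ?_
          · simp [Program.apply, Expr.eval, h22, hn₃, h20₃, h21₃, Nat.mod_eq_of_lt, c1, g1, g2, g3,
              g5, ha₃, h, hI, i1]
          · rw [List.length_map] at hi
            simp [Program.apply, Expr.eval, h22, hn₃, h20₃, h21₃, Nat.mod_eq_of_lt, c1, g1, g2, g3,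
              g5, ha₃, h, hI, i1, hi.ne]
        · rw [List.map_append]
          refine i3.append ?_ fun i hi => ?_
          · simp [Program.apply, Expr.eval, h22, hn₃, h20₃, h21₃, Nat.mod_eq_of_lt, c1, g1, g2, g3,
              g5, ha₃, h, hI, i1]
          · rw [List.length_map] at hi
            simp [Program.apply, Expr.eval, h22, hn₃, h20₃, h21₃, Nat.mod_eq_of_lt, c1, g1, g2, g3,
              g5, ha₃, h, hI, i1, hi.ne]
        · rw [i1] at i4
          simp [Program.apply, Expr.eval, h22, hn₃, h20₃, h21₃, Nat.mod_eq_of_lt, c1, g1, g2, g3,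
            g5, ha₃, h, hI, i1, e1]
          omega
      · rw [if_neg h, List.append_nil]
        by_cases h' : U < V
        · have hI : ¬ Inverts (p T) U V := fun hI => by unfold Inverts at hI; omega
          simp [Program.apply, Expr.eval, h22, hn₃, h20₃, h21₃, Nat.mod_eq_of_lt, g1, g2, g3,
            g5, ha₃, h', hI, HoldsEdges, i1, i2, i3]
          omega
        · simp [Program.apply, Expr.eval, h22, h21₃, h', HoldsEdges, i1, i2, i3]
          omega
    · intro σ' _ h
      have : edgeLayer n p T (U + 1) = edgeLayer n p T U ++ edgeRow p T U n := by
        simp [edgeLayer, List.range_succ]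
      rw [this, ← List.append_assoc]
      refine ⟨by simpa [HoldsEdges] using h.1, ?_⟩
      have h2 := h.2
      rw [State.setReg_reg, if_neg (by decide), ← Nat.add_assoc, Nat.add_mul (T * n + U)]
      omega
  · intro σ' _ h
    have : edgeList n p (T + 1) = edgeList n p T ++ edgeLayer n p T n := by
      simp [edgeList, List.range_succ]
    rw [this]
    refine ⟨by simpa [HoldsEdges] using h.1, ?_⟩
    have h2 := h.2
    rw [State.setReg_reg, if_neg (by decide), Nat.add_mul T 1 n, Nat.one_mul]
    exact h2

/-- The items for the event `(t, c)`, with the first `m` values of the offset. -/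
def itemsAt (t c m : ℕ) : List (ℕ × ℕ × ℕ) := (List.range m).map fun r => (t, c + r, c)

/-- Arrays `7`, `8` and `9` hold the components of the items in the list `L`, the first of them
multiplied by `n`, and register `8` holds the length of `L`. -/
def HoldsItems (n : ℕ) (σ : State) (L : List (ℕ × ℕ × ℕ)) : Prop :=
  σ.reg 8 = L.length ∧ Holds (σ.arr 7) (L.map fun e => e.1 * n) ∧
    Holds (σ.arr 8) (L.map fun e => e.2.1) ∧ Holds (σ.arr 9) (L.map fun e => e.2.2)

/-- Appends the items for the event given by the registers `20` and `21`. -/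
def appendItems : Program :=
  .forLoop 23 11 (.store 7 (.reg 8) (.mul (.reg 20) (.reg 1)) ;;
    .store 8 (.reg 8) (.add (.reg 21) (.reg 23)) ;; .store 9 (.reg 8) (.reg 21) ;;
    .assign 8 (.add (.reg 8) (.const 1)))

theorem appendItems_runs {w n τ k m s z : ℕ} (hw : Fits w n τ k m) {σ : State}
    (hσ : Header n τ s z k m σ) {L : List (ℕ × ℕ × ℕ)} (hL : HoldsItems n σ L) {t c : ℕ}
    (ht : σ.reg 20 = t) (hc : σ.reg 21 = c) (htn : t * n < 2 ^ w) (hcn : c ≤ n)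
    (hlen : L.length + (2 * k + 1) < 2 ^ w) :
    Runs w appendItems σ ((2 * k + 1) * 60 + 6) fun σ' =>
      HoldsItems n σ' (L ++ itemsAt t c (2 * k + 1)) := by
  have hk := hw.k_lt
  have hin := hw.input
  have c1 : 1 < 2 ^ w := by omega
  refine (Runs.forLoop (N := 2 * k + 1) (B := 52) (fun r σ' => HoldsItems n σ' (L ++ itemsAt t c r))
    hσ.width (by omega) (by decide) rfl rfl ?_ ?_).mono le_rfl fun _ _ h => h
  · simpa [HoldsItems, itemsAt] using hL
  intro r hr σ₁ h23 hf₁ hinv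
  have hn₁ : σ₁.reg 1 = n := by rw [hf₁.reg 1 rfl, hσ.n_eq]
  have h20 : σ₁.reg 20 = t := by rw [hf₁.reg 20 rfl, ht]
  have h21 : σ₁.reg 21 = c := by rw [hf₁.reg 21 rfl, hc]
  have hrow : itemsAt t c (r + 1) = itemsAt t c r ++ [(t, c + r, c)] := by
    simp [itemsAt, List.range_succ]
  have hlen' : (L ++ itemsAt t c r).length + 1 < 2 ^ w := by
    simp [itemsAt]; omega
  rw [hrow, ← List.append_assoc]
  generalize L ++ itemsAt t c r = L' at *
  obtain ⟨i1, i2, i3, i4⟩ := hinv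
  have e1 : c + r < 2 ^ w := by omega
  refine Runs.straight rfl (by decide) ⟨?_, ?_, ?_, ?_⟩
  · simp [Program.apply, Expr.eval, Nat.mod_eq_of_lt, c1, i1, hlen']
  · rw [List.map_append]
    refine i2.append ?_ fun i hi => ?_
    · simp [Program.apply, Expr.eval, hn₁, h20, Nat.mod_eq_of_lt, i1, htn]
    · rw [List.length_map] at hi
      simp [Program.apply, Expr.eval, i1, hi.ne]
  · rw [List.map_append]
    refine i3.append ?_ fun i hi => ?_
    · simp [Program.apply, Expr.eval, h21, h23, Nat.mod_eq_of_lt, i1, e1]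
    · rw [List.length_map] at hi
      simp [Program.apply, Expr.eval, i1, hi.ne]
  · rw [List.map_append]
    refine i4.append ?_ fun i hi => ?_
    · simp [Program.apply, Expr.eval, h21, i1]
    · rw [List.length_map] at hi
      simp [Program.apply, Expr.eval, i1, hi.ne]

/-- The items for the events at time `t` at the first `m` gaps. -/
def eventRow (n k : ℕ) (p : ℕ → ℕ → ℕ) (t m : ℕ) : List (ℕ × ℕ × ℕ) :=
  (List.range m).flatMap fun c => if IsEvent n p t c then itemsAt t c (2 * k + 1) else []

/-- The items for the events before time `m`. -/
def eventItems (n k : ℕ) (p : ℕ → ℕ → ℕ) (m : ℕ) : List (ℕ × ℕ × ℕ) :=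
  (List.range m).flatMap fun t => eventRow n k p t (n + 1)

theorem eventRow_succ (n k : ℕ) (p : ℕ → ℕ → ℕ) (t m : ℕ) : eventRow n k p t (m + 1) =
    eventRow n k p t m ++ if IsEvent n p t m then itemsAt t m (2 * k + 1) else [] := by
  simp [eventRow, List.range_succ]

theorem eventItems_succ (n k : ℕ) (p : ℕ → ℕ → ℕ) (m : ℕ) : eventItems n k p (m + 1) =
    eventItems n k p m ++ eventRow n k p m (n + 1) := by
  simp [eventItems, List.range_succ]

theorem length_eventRow (n k : ℕ) (p : ℕ → ℕ → ℕ) (t m : ℕ) : (eventRow n k p t m).length =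
    ∑ c ∈ Finset.range m, if IsEvent n p t c then 2 * k + 1 else 0 := by
  induction m with
  | zero => simp [eventRow]
  | succ m ih =>
    rw [eventRow_succ, List.length_append, ih, Finset.sum_range_succ]
    congr 1
    split_ifs <;> simp [itemsAt]

theorem length_eventItems (n k : ℕ) (p : ℕ → ℕ → ℕ) (m : ℕ) : (eventItems n k p m).length =
    ∑ t ∈ Finset.range m, (eventRow n k p t (n + 1)).length := by
  induction m with
  | zero => simp [eventItems]
  | succ m ih => rw [eventItems_succ, List.length_append, ih, Finset.sum_range_succ]

theorem length_eventRow_le (n k : ℕ) (p : ℕ → ℕ → ℕ) (t m : ℕ) :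
    (eventRow n k p t m).length ≤ m * (2 * k + 1) := by
  rw [length_eventRow]
  refine (Finset.sum_le_card_nsmul _ _ (2 * k + 1) fun c _ => ?_).trans (by simp)
  split_ifs <;> omega

theorem length_eventItems_le (n k : ℕ) (p : ℕ → ℕ → ℕ) (m : ℕ) :
    (eventItems n k p m).length ≤ m * (n + 1) * (2 * k + 1) := by
  rw [length_eventItems]
  refine (Finset.sum_le_card_nsmul _ _ ((n + 1) * (2 * k + 1)) fun t _ =>
    length_eventRow_le n k p t _).trans ?_
  rw [Finset.card_range, smul_eq_mul, Nat.mul_assoc]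

theorem mem_eventItems {n τ k : ℕ} {p : ℕ → ℕ → ℕ} {e : ℕ × ℕ × ℕ} (he : IsItem n τ k e)
    (hev : IsEvent n p e.1 e.2.2) : e ∈ eventItems n k p τ := by
  obtain ⟨t, b, c⟩ := e
  obtain ⟨h1, h2, r, hr, h3⟩ := he
  dsimp only at h1 h2 h3 hev
  refine List.mem_flatMap.mpr ⟨t, List.mem_range.mpr h1, List.mem_flatMap.mpr
    ⟨c, List.mem_range.mpr (by omega), ?_⟩⟩
  rw [if_pos hev]
  exact List.mem_map.mpr ⟨r, List.mem_range.mpr hr, by rw [h3]⟩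

/-- Lists the items for all events. -/
def listEventItems : Program :=
  .assign 8 (.const 0) ;; .forLoop 20 2 (.forLoop 21 12 (.assign 30 (.const 0) ;;
    .forLoop 22 1 (.ite (.eq
        (.lt (.load 2 (.add (.mul (.reg 20) (.reg 1)) (.reg 22))) (.reg 21))
        (.lt (.load 2 (.add (.mul (.sub (.reg 20) (.const 1)) (.reg 1)) (.reg 22))) (.reg 21)))
      .skip (.assign 30 (.const 1))) ;;
    .ite (.reg 30) appendItems .skip))

theorem listEventItems_runs {w n τ k m s z : ℕ} (hw : Fits w n τ k m) {σ : State}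
    {p : ℕ → ℕ → ℕ} (hσ : Header n τ s z k m σ) (hpos : HoldsPos n τ p σ) :
    Runs w listEventItems σ (τ * ((n + 1) * (n * 100 + 100) + 100) + 100 +
      (eventItems n k p τ).length * 100) fun σ' => HoldsItems n σ' (eventItems n k p τ) := by
  have hn := hw.n_lt
  have hτ := hw.τ_lt
  have hin := hw.input
  have hk := hw.k_lt
  have c1 : 1 < 2 ^ w := by omega
  have hcost : ∀ t, ∑ c ∈ Finset.range (n + 1), ((n * 100 + 40 +
      if IsEvent n p t c then (2 * k + 1) * 100 else 0) + 8) + 6 ≤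
      (n + 1) * (n * 100 + 100) + 20 + (eventRow n k p t (n + 1)).length * 100 := by
    intro t
    rw [length_eventRow, Finset.sum_mul]
    have : ∀ c, (if IsEvent n p t c then 2 * k + 1 else 0) * 100 =
        if IsEvent n p t c then (2 * k + 1) * 100 else 0 := fun c => by split_ifs <;> simp
    simp only [this, Finset.sum_add_distrib, Finset.sum_const, Finset.card_range, smul_eq_mul]
    rw [Nat.mul_add (n + 1)]
    omega
  refine Runs.mono (B := 2 + (∑ t ∈ Finset.range τ, (((n + 1) * (n * 100 + 100) + 20 +
      (eventRow n k p t (n + 1)).length * 100) + 8) + 6))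
    (Runs.seq (Q := fun σ' => σ'.reg 8 = 0)
      (Runs.straight rfl (by decide) (by simp [Program.apply, Expr.eval])) ?_) ?_ fun _ _ h => h
  swap
  · rw [length_eventItems, Finset.sum_mul]
    simp only [Finset.sum_add_distrib, Finset.sum_const, Finset.card_range, smul_eq_mul]
    rw [Nat.mul_add τ]
    omega
  intro σ₀ hf₀ h8
  have hσ₀ := hσ.frame hf₀ rfl
  refine (Runs.forLoop_sum (N := τ) (fun T σ' => HoldsItems n σ' (eventItems n k p T)) _
    hσ₀.τ_eq (by omega) (by decide) rfl rfl ?_ ?_).mono le_rfl fun _ _ h => h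
  · simpa [HoldsItems, eventItems, Holds] using h8
  intro T hT σ₁ h20 hf₁ hinv₁
  have hσ₁ := hσ₀.frame hf₁ rfl
  refine (Runs.forLoop_sum (N := n + 1)
    (fun c σ' => HoldsItems n σ' (eventItems n k p T ++ eventRow n k p T c)) _
    hσ₁.gaps (by omega) (by decide) rfl rfl ?_ ?_).mono (hcost T) ?_
  · simpa [HoldsItems, eventRow] using hinv₁
  · intro c hc σ₂ h21 hf₂ hinv₂
    have hσ₂ := hσ₁.frame hf₂ rfl
    have h20₂ : σ₂.reg 20 = T := by rw [hf₂.reg 20 rfl, h20]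
    have ha₂ : HoldsPos n τ p σ₂ := fun t ht x hx => by
      rw [hf₂.arr 2 rfl, hf₁.arr 2 rfl, hf₀.arr 2 rfl]; exact hpos t ht x hx
    refine Runs.mono (B := 2 + ((n * (50 + 8) + 6) + (1 + 1 +
        (10 + if IsEvent n p T c then (2 * k + 1) * 100 else 0))))
      (Runs.seq (Q := fun σ' => σ'.reg 30 = 0)
        (Runs.straight rfl (by decide) (by simp [Program.apply, Expr.eval])) ?_)
      (by split_ifs <;> omega) fun _ _ h => h
    intro σ₃ hf₃ h30
    have hσ₃ := hσ₂.frame hf₃ rfl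
    refine Runs.seq (Q := fun σ' => σ'.reg 30 = 0 ↔ ¬ IsEvent n p T c) ?_ ?_
    · refine (Runs.forLoop (N := n) (fun X σ' => σ'.reg 30 = 0 ↔
        ∀ x < X, (p T x < c ↔ p (T - 1) x < c)) hσ₃.n_eq (by omega) (by decide) rfl rfl
        ?_ ?_).mono le_rfl ?_
      · simpa using h30
      · intro X hX σ₄ h22 hf₄ hinv₄
        have hσ₄ := hσ₃.frame hf₄ rfl
        have h20₄ : σ₄.reg 20 = T := by rw [hf₄.reg 20 rfl, hf₃.reg 20 rfl, h20₂]
        have h21₄ : σ₄.reg 21 = c := by rw [hf₄.reg 21 rfl, hf₃.reg 21 rfl, h21]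
        have ha₄ : σ₄.arr 2 = σ₂.arr 2 := by rw [hf₄.arr 2 rfl, hf₃.arr 2 rfl]
        obtain ⟨g1, g2, -, -⟩ := hw.index hT hX hX
        obtain ⟨g3, g4, -, -⟩ := hw.index (show T - 1 < τ by omega) hX hX
        have b1 := ha₂ T hT X hX
        have b2 := ha₂ (T - 1) (by omega) X hX
        rw [← ha₄] at b1 b2
        refine Runs.straight rfl (by decide) ?_
        simp only [Nat.lt_succ_iff_lt_or_eq, or_imp, forall_and, forall_eq]
        by_cases h1 : p T X < c <;> by_cases h2 : p (T - 1) X < c <;>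
          simp [Program.apply, Expr.eval, h22, hσ₄.n_eq, h20₄, h21₄, Nat.mod_eq_of_lt, c1, g1, g2,
            g3, g4, b1, b2, h1, h2, hinv₄]
      · intro σ' _ h
        rw [h]
        simp [IsEvent]
    · intro σ₄ hf₄ h30'
      have hσ₄ := hσ₃.frame hf₄ rfl
      have hL : HoldsItems n σ₄ (eventItems n k p T ++ eventRow n k p T c) := by
        unfold HoldsItems
        rw [hf₄.reg 8 rfl, hf₃.reg 8 rfl, hf₄.arr 7 rfl, hf₃.arr 7 rfl, hf₄.arr 8 rfl,
          hf₃.arr 8 rfl, hf₄.arr 9 rfl, hf₃.arr 9 rfl]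
        exact hinv₂
      have h20₄ : σ₄.reg 20 = T := by rw [hf₄.reg 20 rfl, hf₃.reg 20 rfl, h20₂]
      have h21₄ : σ₄.reg 21 = c := by rw [hf₄.reg 21 rfl, hf₃.reg 21 rfl, h21]
      rw [eventRow_succ, ← List.append_assoc]
      refine Runs.ite ?_ ?_
      · intro h
        have hev : IsEvent n p T c := by
          by_contra hcon
          exact h (h30'.mpr hcon)
        rw [if_pos hev, if_pos hev]
        refine (appendItems_runs hw hσ₄ hL h20₄ h21₄ ?_ (by omega) ?_).mono (by omega) ?_
        · rcases Nat.eq_zero_or_pos n with rfl | hpos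
          · omega
          · exact (hw.index hT hpos hpos).1
        · have h1 := length_eventItems_le n k p T
          have h2 := length_eventRow_le n k p T c
          rw [List.length_append]
          have h3 : (T * (n + 1) + c + 1 + 1) * (2 * k + 1) ≤ (τ + 1) * (n + 1) * (2 * k + 1) := by
            refine Nat.mul_le_mul_right _ ?_
            have := index_lt hT hc
            rw [Nat.add_mul τ]
            omega
          have h4 := hw.items
          rw [Nat.add_mul, Nat.add_mul, Nat.add_mul] at h3
          omega
        · intro σ' _ h
          simpa [HoldsItems] using h
      · intro h
        have hev : ¬ IsEvent n p T c := h30'.mp h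
        rw [if_neg hev, if_neg hev, List.append_nil]
        refine Runs.straight rfl (by decide) ?_
        simpa [HoldsItems, Program.apply] using hL
  · intro σ' _ h
    rw [eventItems_succ]
    simpa [HoldsItems] using h

/-- Items for all scanlines of layer `0` whose first end is at one of the first `m` gaps of the
order of the layer. -/
def initialItems (k m : ℕ) : List (ℕ × ℕ × ℕ) :=
  (List.range m).flatMap fun c => itemsAt 0 c (2 * k + 1)

theorem initialItems_succ (k m : ℕ) :
    initialItems k (m + 1) = initialItems k m ++ itemsAt 0 m (2 * k + 1) := by
  simp [initialItems, List.range_succ]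

theorem length_initialItems (k m : ℕ) : (initialItems k m).length = m * (2 * k + 1) := by
  induction m with
  | zero => simp [initialItems]
  | succ m ih => rw [initialItems_succ, List.length_append, ih]; simp [itemsAt]; ring

theorem mem_initialItems {n τ k : ℕ} {e : ℕ × ℕ × ℕ} (he : IsItem n τ k e) (h0 : e.1 = 0) :
    e ∈ initialItems k (n + 1) := by
  obtain ⟨t, b, c⟩ := e
  obtain ⟨-, h2, r, hr, h3⟩ := he
  dsimp only at h0 h2 h3
  subst h0 h3
  exact List.mem_flatMap.mpr ⟨c, List.mem_range.mpr (by omega),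
    List.mem_map.mpr ⟨r, List.mem_range.mpr hr, rfl⟩⟩

/-- Appends the items for the scanlines of layer `0`. The number of items for events is kept in
register `14`. -/
def listInitialItems : Program :=
  .assign 14 (.reg 8) ;; .assign 20 (.const 0) ;; .forLoop 21 12 appendItems

theorem listInitialItems_runs {w n τ k m s z : ℕ} (hw : Fits w n τ k m) {σ : State}
    {p : ℕ → ℕ → ℕ} (hσ : Header n τ s z k m σ) (hL : HoldsItems n σ (eventItems n k p τ)) :
    Runs w listInitialItems σ ((n + 1) * ((2 * k + 1) * 100) + 100) fun σ' =>
      HoldsItems n σ' (eventItems n k p τ ++ initialItems k (n + 1)) ∧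
      σ'.reg 14 = (eventItems n k p τ).length := by
  have hn := hw.n_lt
  have hin := hw.input
  refine Runs.mono (B := 2 + (2 + ((n + 1) * ((2 * k + 1) * 60 + 6 + 8) + 6)))
    (Runs.seq (Q := fun σ' => σ'.reg 14 = (eventItems n k p τ).length)
      (Runs.straight rfl (by decide) (by simp [Program.apply, Expr.eval, hL.1])) ?_)
    (by nlinarith [Nat.zero_le ((n + 1) * k)]) fun _ _ h => h
  intro σ₁ hf₁ h14
  refine Runs.seq (Q := fun σ' => σ'.reg 20 = 0)
    (Runs.straight rfl (by decide) (by simp [Program.apply, Expr.eval])) ?_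
  intro σ₂ hf₂ h20
  have hσ₂ := (hσ.frame hf₁ rfl).frame hf₂ rfl
  refine (Runs.forLoop (N := n + 1) (fun c σ' =>
    HoldsItems n σ' (eventItems n k p τ ++ initialItems k c))
    hσ₂.gaps (by omega) (by decide) rfl rfl ?_ ?_).mono le_rfl ?_
  · have : initialItems k 0 = [] := rfl
    rw [this, List.append_nil]
    unfold HoldsItems at hL ⊢
    simp only [State.setReg_arr, State.setReg_reg]
    rw [if_neg (by decide), hf₂.reg 8 rfl, hf₁.reg 8 rfl, hf₂.arr 7 rfl, hf₁.arr 7 rfl,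
      hf₂.arr 8 rfl, hf₁.arr 8 rfl, hf₂.arr 9 rfl, hf₁.arr 9 rfl]
    exact hL
  · intro c hc σ₃ h21 hf₃ hinv
    have hσ₃ := hσ₂.frame hf₃ rfl
    rw [initialItems_succ, ← List.append_assoc]
    refine (appendItems_runs hw hσ₃ hinv (t := 0) (by rw [hf₃.reg 20 rfl, h20]) h21 (by omega)
      (by omega) ?_).mono le_rfl ?_
    · have h1 := length_eventItems_le n k p τ
      rw [List.length_append, length_initialItems]
      have h4 := hw.items
      have h5 : (c + 1) * (2 * k + 1) ≤ (n + 1) * (2 * k + 1) := Nat.mul_le_mul_right _ (by omega)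
      rw [Nat.add_mul τ 1, Nat.add_mul (τ * (n + 1)), Nat.one_mul] at h4
      rw [Nat.add_mul c] at h5
      omega
    · intro σ' _ h
      simpa [HoldsItems] using h
  · intro σ' hf h
    exact ⟨h, by rw [hf.reg 14 rfl, hf₂.reg 14 rfl, h14]⟩

/-! ### The program: static graphs -/

/-- Runs `p` if all expressions in the list are nonzero. -/
def whenAll : List Expr → Program → Program
  | [], p => p
  | e :: es, p => .ite e (whenAll es p) .skip

theorem apply_whenAll (w : ℕ) (es : List Expr) (p : Program) (σ : State) :
    (whenAll es p).apply w σ = if ∀ e ∈ es, e.eval w σ ≠ 0 then p.apply w σ else σ := by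
  induction es with
  | nil => simp [whenAll]
  | cons e es ih =>
    simp only [whenAll, Program.apply, ih, List.forall_mem_cons]
    by_cases h : e.eval w σ = 0 <;> simp [h]

/-- The negation of a truth value. -/
def notE (e : Expr) : Expr := .eq e (.const 0)

theorem eval_notE_ne (w : ℕ) (σ : State) (e : Expr) : (notE e).eval w σ ≠ 0 ↔ e.eval w σ = 0 := by
  by_cases h : e.eval w σ = 0 <;> simp [notE, Expr.eval, h]

/-- The number of crossed vertices when the second end of a scanline moves over the vertex `u`. -/
theorem card_cross_succ {n : ℕ} {q : ℕ → ℕ} (hq : IsPermOn n q) {β u : ℕ} (hu : u < n) :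
    (u < β → (cross n q β (q u)).card = (cross n q β (q u + 1)).card + 1) ∧
      (β ≤ u → (cross n q β (q u + 1)).card = (cross n q β (q u)).card + 1) := by
  have hq' : ∀ x < n, q x = q u → x = u := fun x hx h => hq.inj x hx u hu h
  constructor
  · intro h
    have : cross n q β (q u) = insert u (cross n q β (q u + 1)) := by
      ext x
      rw [Finset.mem_insert, mem_cross, mem_cross]
      by_cases hx : x = u
      · subst hx; omega
      · have := hq' x
        omega
    rw [this, Finset.card_insert_of_notMem (by rw [mem_cross]; omega)]
  · intro h
    have : cross n q β (q u + 1) = insert u (cross n q β (q u)) := by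
      ext x
      rw [Finset.mem_insert, mem_cross, mem_cross]
      by_cases hx : x = u
      · subst hx; omega
      · have := hq' x
        omega
    rw [this, Finset.card_insert_of_notMem (by rw [mem_cross]; omega)]

/-- Decides the problem for static graphs: computes the number of crossed vertices for all
scanlines `(β, c)` with the inverse permutation in array `12`. -/
def scanStatic : Program :=
  .forLoop 20 1 (.store 12 (.load 2 (.reg 20)) (.reg 20)) ;;
  .forLoop 20 1 (.assign 30 (.reg 20) ;; .forLoop 21 1 (
    whenAll [.lt (.reg 3) (.reg 20), notE (.lt (.reg 4) (.reg 20)),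
      .lt (.load 2 (.reg 3)) (.reg 21), notE (.lt (.load 2 (.reg 4)) (.reg 21)),
      notE (.lt (.reg 5) (.reg 30))] (.assign 0 (.const 1)) ;;
    .ite (.lt (.load 12 (.reg 21)) (.reg 20))
      (.assign 30 (.sub (.reg 30) (.const 1))) (.assign 30 (.add (.reg 30) (.const 1)))))

theorem scanStatic_runs {w n τ k m s z : ℕ} (hw : Fits w n τ k m) {σ : State}
    {p : ℕ → ℕ → ℕ} (hσ : Header n τ s z k m σ) (hpos : HoldsPos n τ p σ) (hτ : 1 ≤ τ)
    (hp : ∀ t < τ, IsPermOn n (p t)) (hs : s < n) (hz : z < n) (h0 : σ.reg 0 = 0) :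
    Runs w scanStatic σ (n * (n * 100 + 100) + 100) fun σ' =>
      (σ'.reg 0 = 0 ∨ σ'.reg 0 = 1) ∧ (σ'.reg 0 ≠ 0 ↔ ∃ β < n, ∃ c < n, s < β ∧ β ≤ z ∧
        p 0 s < c ∧ c ≤ p 0 z ∧ (cross n (p 0) β c).card ≤ k) := by
  have hn := hw.n_lt
  have hin := hw.input
  have c1 : 1 < 2 ^ w := by omega
  have hq := hp 0 (by omega)
  have hpos' : ∀ x < n, σ.arr 2 x = p 0 x := fun x hx => by
    have := hpos 0 (by omega) x hx
    rwa [Nat.zero_mul, Nat.zero_add] at this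
  refine Runs.mono (B := (n * (10 + 8) + 6) + (n * (2 + (n * (70 + 8) + 6) + 8) + 6))
    (Runs.seq (Q := fun σ' => ∀ x < n, σ'.arr 12 (p 0 x) = x) ?_ ?_)
    (by nlinarith [Nat.zero_le n]) fun _ _ h => h
  · refine (Runs.forLoop (N := n) (fun X σ' => ∀ x < X, σ'.arr 12 (p 0 x) = x) hσ.n_eq (by omega)
      (by decide) rfl rfl (fun x hx => absurd hx (Nat.not_lt_zero x)) ?_).mono le_rfl fun _ _ h => h
    intro X hX σ₁ h20 hf₁ hinv
    refine Runs.straight rfl (by decide) fun x hx => ?_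
    have ha : σ₁.arr 2 X = p 0 X := by rw [hf₁.arr 2 rfl]; exact hpos' X hX
    simp only [Program.apply, Expr.eval, h20, ha, State.setReg_arr, State.setArr_arr, true_and]
    split_ifs with h
    · exact (hq.inj x (by omega) X hX h).symm
    · rcases Nat.lt_succ_iff_lt_or_eq.mp hx with hx | rfl
      · exact hinv x hx
      · exact absurd rfl h
  intro σ₁ hf₁ hinv
  have hσ₁ := hσ.frame hf₁ rfl
  refine (Runs.forLoop (N := n) (fun B σ' => (σ'.reg 0 = 0 ∨ σ'.reg 0 = 1) ∧
    (σ'.reg 0 ≠ 0 ↔ ∃ β < B, ∃ c < n, s < β ∧ β ≤ z ∧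
      p 0 s < c ∧ c ≤ p 0 z ∧ (cross n (p 0) β c).card ≤ k)) hσ₁.n_eq (by omega)
    (by decide) rfl rfl ?_ ?_).mono le_rfl fun _ _ h => h
  · simp [hf₁.reg 0 rfl, h0]
  intro β hβ σ₂ h20 hf₂ hinv₂
  have hσ₂ := hσ₁.frame hf₂ rfl
  refine Runs.seq (Q := fun σ' => σ'.reg 30 = β)
    (Runs.straight rfl (by decide) (by simp [Program.apply, Expr.eval, h20])) ?_
  intro σ₃ hf₃ h30
  have hσ₃ := hσ₂.frame hf₃ rfl
  have h20₃ : σ₃.reg 20 = β := by rw [hf₃.reg 20 rfl, h20]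
  refine (Runs.forLoop (N := n) (fun C σ' => ((σ'.reg 0 = 0 ∨ σ'.reg 0 = 1) ∧
    (σ'.reg 0 ≠ 0 ↔ (∃ b < β, ∃ c < n, s < b ∧ b ≤ z ∧
      p 0 s < c ∧ c ≤ p 0 z ∧ (cross n (p 0) b c).card ≤ k) ∨ ∃ c < C, s < β ∧ β ≤ z ∧
      p 0 s < c ∧ c ≤ p 0 z ∧ (cross n (p 0) β c).card ≤ k)) ∧
    σ'.reg 30 = (cross n (p 0) β C).card) hσ₃.n_eq (by omega)
    (by decide) rfl rfl ?_ ?_).mono le_rfl ?_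
  · refine ⟨by simpa [hf₃.reg 0 rfl] using hinv₂, ?_⟩
    have : cross n (p 0) β 0 = Finset.range β := by
      ext x; rw [mem_cross, Finset.mem_range]; omega
    simp [h30, this]
  · intro c hc σ₄ h21 hf₄ hinv₄
    have hσ₄ := hσ₃.frame hf₄ rfl
    have h20₄ : σ₄.reg 20 = β := by rw [hf₄.reg 20 rfl, h20₃]
    have ha₄ : ∀ x < n, σ₄.arr 2 x = p 0 x := fun x hx => by
      rw [hf₄.arr 2 rfl, hf₃.arr 2 rfl, hf₂.arr 2 rfl, hf₁.arr 2 rfl]; exact hpos' x hx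
    have hi₄ : ∀ x < n, σ₄.arr 12 (p 0 x) = x := fun x hx => by
      rw [hf₄.arr 12 rfl, hf₃.arr 12 rfl, hf₂.arr 12 rfl]; exact hinv x hx
    obtain ⟨u, hu, rfl⟩ := hq.exists_eq hc
    have hinvu := hi₄ u hu
    obtain ⟨i1, i2⟩ := hinv₄
    have hcard := card_cross_succ hq (β := β) hu
    have hle : ∀ c, (cross n (p 0) β c).card ≤ n := fun c =>
      (Finset.card_filter_le _ _).trans (Finset.card_range n).le
    have hle₁ := hle (p 0 u)
    refine Runs.straight rfl (by decide) ?_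
    have hcond : (∀ e ∈ [Expr.lt (.reg 3) (.reg 20), notE (.lt (.reg 4) (.reg 20)),
        .lt (.load 2 (.reg 3)) (.reg 21), notE (.lt (.load 2 (.reg 4)) (.reg 21)),
        notE (.lt (.reg 5) (.reg 30))], e.eval w σ₄ ≠ 0) ↔ (s < β ∧ β ≤ z ∧
        p 0 s < p 0 u ∧ p 0 u ≤ p 0 z ∧ (cross n (p 0) β (p 0 u)).card ≤ k) := by
      simp only [List.forall_mem_cons, eval_notE_ne, Expr.eval, hσ₄.s_eq,
        hσ₄.z_eq, hσ₄.k_eq, h20₄, h21, i2, ha₄ s hs, ha₄ z hz]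
      simp
    have hex : (∃ c < p 0 u + 1, s < β ∧ β ≤ z ∧ p 0 s < c ∧ c ≤ p 0 z ∧
        (cross n (p 0) β c).card ≤ k) ↔ (∃ c < p 0 u, s < β ∧ β ≤ z ∧ p 0 s < c ∧ c ≤ p 0 z ∧
        (cross n (p 0) β c).card ≤ k) ∨ (s < β ∧ β ≤ z ∧ p 0 s < p 0 u ∧ p 0 u ≤ p 0 z ∧
        (cross n (p 0) β (p 0 u)).card ≤ k) := by
      constructor
      · rintro ⟨c, hc, h⟩
        rcases Nat.lt_succ_iff_lt_or_eq.mp hc with hc | rfl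
        · exact .inl ⟨c, hc, h⟩
        · exact .inr h
      · rintro (⟨c, hc, h⟩ | h)
        · exact ⟨c, by omega, h⟩
        · exact ⟨_, Nat.lt_succ_self _, h⟩
    obtain ⟨D, hD⟩ : ∃ D : Prop, D ↔ (s < β ∧ β ≤ z ∧ p 0 s < p 0 u ∧ p 0 u ≤ p 0 z ∧
      (cross n (p 0) β (p 0 u)).card ≤ k) := ⟨_, Iff.rfl⟩
    rw [hex, ← hD]
    rw [← hD] at hcond
    generalize (∃ c < p 0 u, s < β ∧ β ≤ z ∧ p 0 s < c ∧ c ≤ p 0 z ∧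
      (cross n (p 0) β c).card ≤ k) = A at i1 ⊢
    generalize (∃ b < β, ∃ c < n, s < b ∧ b ≤ z ∧ p 0 s < c ∧ c ≤ p 0 z ∧
      (cross n (p 0) b c).card ≤ k) = A' at i1 ⊢
    generalize (cross n (p 0) β (p 0 u)).card = r at i2 hcard hle₁ ⊢
    generalize (cross n (p 0) β (p 0 u + 1)).card = r' at hcard ⊢
    have c2 : r + 1 < 2 ^ w := by omega
    rw [← or_assoc]
    simp only [Program.apply, apply_whenAll]
    by_cases hg : D
    · rw [if_pos (hcond.mpr hg)]
      by_cases hub : u < β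
      · have := hcard.1 hub
        simp [Expr.eval, hg, h21, h20₄, hinvu, hub, i2, Nat.mod_eq_of_lt, c1]; omega
      · have := hcard.2 (by omega)
        simp [Expr.eval, hg, h21, h20₄, hinvu, hub, i2, Nat.mod_eq_of_lt, c1, c2]; omega
    · rw [if_neg (mt hcond.mp hg)]
      by_cases hub : u < β
      · have := hcard.1 hub
        simp [Expr.eval, hg, h21, h20₄, hinvu, hub, i2, Nat.mod_eq_of_lt, c1]
        exact ⟨by simpa using i1, by omega⟩
      · have := hcard.2 (by omega)
        simp [Expr.eval, hg, h21, h20₄, hinvu, hub, i2, Nat.mod_eq_of_lt, c1, c2]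
        exact ⟨by simpa using i1, by omega⟩
  · intro σ' _ h
    refine ⟨by simpa using h.1.1, ?_⟩
    simp only [State.setReg_reg]
    rw [if_neg (by decide), h.1.2]
    constructor
    · rintro (⟨b, hb, h'⟩ | h')
      · exact ⟨b, by omega, h'⟩
      · exact ⟨β, Nat.lt_succ_self β, h'⟩
    · rintro ⟨b, hb, h'⟩
      rcases Nat.lt_succ_iff_lt_or_eq.mp hb with hb | rfl
      · exact .inl ⟨b, hb, h'⟩
      · exact .inr h'

/-! ### The program: tests and marks -/

/-- All items: those for the events come first, those for layer `0` follow. -/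
def allItems (n τ k : ℕ) (p : ℕ → ℕ → ℕ) : List (ℕ × ℕ × ℕ) :=
  eventItems n k p τ ++ initialItems k (n + 1)

/-- The item with the index `i`. -/
def item (n τ k : ℕ) (p : ℕ → ℕ → ℕ) (i : ℕ) : ℕ × ℕ × ℕ := (allItems n τ k p).getD i (0, 0, 0)

theorem isItem_of_mem_allItems {n τ k : ℕ} {p : ℕ → ℕ → ℕ} (hτ : 1 ≤ τ) {e : ℕ × ℕ × ℕ}
    (he : e ∈ allItems n τ k p) : IsItem n τ k e := by
  have hat : ∀ t < τ, ∀ c ≤ n, e ∈ itemsAt t c (2 * k + 1) → IsItem n τ k e := by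
    intro t ht c hc h
    obtain ⟨r, hr, rfl⟩ := List.mem_map.mp h
    exact ⟨ht, hc, r, List.mem_range.mp hr, rfl⟩
  rcases List.mem_append.mp he with h | h
  · obtain ⟨t, ht, h⟩ := List.mem_flatMap.mp h
    obtain ⟨c, hc, h⟩ := List.mem_flatMap.mp h
    split_ifs at h
    · exact hat t (List.mem_range.mp ht) c (by rw [List.mem_range] at hc; omega) h
    · simp at h
  · obtain ⟨c, hc, h⟩ := List.mem_flatMap.mp h
    exact hat 0 (by omega) c (by rw [List.mem_range] at hc; omega) h

theorem item_mem {n τ k : ℕ} {p : ℕ → ℕ → ℕ} {i : ℕ} (hi : i < (allItems n τ k p).length) :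
    item n τ k p i ∈ allItems n τ k p := by
  unfold item
  rw [List.getD_eq_getElem _ _ hi]
  exact List.getElem_mem hi

/-- The number of items that may be chosen at the level `l` of the search tree. Items that need not
belong to an event are allowed at the root only; this is what makes the number of vertices a factor
of the running time instead of a part of the base of the power. -/
def limit (n τ k : ℕ) (p : ℕ → ℕ → ℕ) (l : ℕ) : ℕ :=
  if l = 0 then (allItems n τ k p).length else (eventItems n k p τ).length

theorem limit_le {n τ k : ℕ} {p : ℕ → ℕ → ℕ} {l : ℕ} :
    limit n τ k p l ≤ (allItems n τ k p).length := by
  unfold limit allItems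
  split_ifs <;> simp

/-- The results of the preprocessing. -/
structure SearchData (n τ s z k m : ℕ) (p : ℕ → ℕ → ℕ) (σ : State) : Prop where
  header : Header n τ s z k m σ
  pos : HoldsPos n τ p σ
  vertices : HoldsVertices σ (vertexList n τ p n)
  edges : HoldsEdges σ (edgeList n p τ)
  items : HoldsItems n σ (allItems n τ k p)
  events : σ.reg 14 = (eventItems n k p τ).length

theorem SearchData.frame {n τ s z k m : ℕ} {p : ℕ → ℕ → ℕ} {σ σ' : State} {q : Program}
    (h : SearchData n τ s z k m p σ) (hf : Frame q σ σ')
    (hr : ([1, 2, 3, 4, 5, 6, 8, 10, 11, 12, 13, 14].all fun x => !q.writesReg x) = true)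
    (ha : ([2, 3, 4, 7, 8, 9, 13].all fun a => !q.writesArr a) = true) :
    SearchData n τ s z k m p σ' := by
  simp only [List.all_cons, List.all_nil, Bool.and_true, Bool.and_eq_true,
    Bool.not_eq_true'] at hr ha
  obtain ⟨r1, r2, r3, r4, r5, r6, r8, r10, r11, r12, r13, r14⟩ := hr
  obtain ⟨a2, a3, a4, a7, a8, a9, a13⟩ := ha
  refine ⟨h.header.frame hf ?_, ?_, ?_, ?_, ?_, ?_⟩
  · simp [r1, r2, r3, r4, r5, r6, r11, r12]
  · have := h.pos
    unfold HoldsPos at *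
    rwa [hf.arr 2 a2]
  · have := h.vertices
    unfold HoldsVertices at *
    rwa [hf.reg 10 r10, hf.arr 13 a13]
  · have := h.edges
    unfold HoldsEdges at *
    rwa [hf.reg 13 r13, hf.arr 3 a3, hf.arr 4 a4]
  · have := h.items
    unfold HoldsItems at *
    rwa [hf.reg 8 r8, hf.arr 7 a7, hf.arr 8 a8, hf.arr 9 a9]
  · rw [hf.reg 14 r14, h.events]

theorem SearchData.item_eq {n τ s z k m : ℕ} {p : ℕ → ℕ → ℕ} {σ : State}
    (h : SearchData n τ s z k m p σ) {i : ℕ} (hi : i < (allItems n τ k p).length) :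
    σ.arr 7 i = (item n τ k p i).1 * n ∧ σ.arr 8 i = (item n τ k p i).2.1 ∧
      σ.arr 9 i = (item n τ k p i).2.2 := by
  obtain ⟨-, h7, h8, h9⟩ := h.items
  unfold item
  rw [List.getD_eq_getElem _ _ hi]
  refine ⟨?_, ?_, ?_⟩
  · rw [h7 i (by simpa using hi), List.getElem_map]
  · rw [h8 i (by simpa using hi), List.getElem_map]
  · rw [h9 i (by simpa using hi), List.getElem_map]

theorem mem_vertexList {n τ : ℕ} {p : ℕ → ℕ → ℕ} {x : ℕ} :
    x ∈ vertexList n τ p n ↔ x < n ∧ NonIsolated n τ p x := by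
  simp [vertexList]

theorem vertexList_nodup {n τ : ℕ} {p : ℕ → ℕ → ℕ} : (vertexList n τ p n).Nodup :=
  List.nodup_range.filter _

/-- Removes the marks of the levels above the current one, which is in register `16`, and counts the
remaining marks in register `30`. -/
def cleanMarks : Program :=
  .forLoop 20 10 (.assign 31 (.load 13 (.reg 20)) ;;
    .ite (.lt (.reg 16) (.load 10 (.reg 31))) (.store 10 (.reg 31) (.const 0))
      (.ite (.load 10 (.reg 31)) (.assign 30 (.add (.reg 30) (.const 1))) .skip))

theorem length_vertexList_le {n τ : ℕ} {p : ℕ → ℕ → ℕ} : (vertexList n τ p n).length ≤ n :=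
  (List.length_filter_le _ _).trans List.length_range.le

theorem cleanMarks_runs {w n τ k m s z : ℕ} (hw : Fits w n τ k m) {σ : State}
    {p : ℕ → ℕ → ℕ} (hσ : SearchData n τ s z k m p σ) {lev : ℕ} (h16 : σ.reg 16 = lev)
    (h30 : σ.reg 30 = 0) (hmark : ∀ x, x ∉ vertexList n τ p n → σ.arr 10 x = 0) :
    Runs w cleanMarks σ ((vertexList n τ p n).length * 60 + 6) fun σ' =>
      (∀ x, σ'.arr 10 x = if lev < σ.arr 10 x then 0 else σ.arr 10 x) ∧
      ∃ S ⊆ Finset.range n, (∀ x, x ∈ S ↔ σ'.arr 10 x ≠ 0) ∧ σ'.reg 30 = S.card := by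
  have hn := hw.n_lt
  have hin := hw.input
  have c1 : 1 < 2 ^ w := by omega
  have hlen := length_vertexList_le (n := n) (τ := τ) (p := p)
  obtain ⟨V, hV⟩ : ∃ V, V = vertexList n τ p n := ⟨_, rfl⟩
  have hnd : V.Nodup := hV ▸ vertexList_nodup
  have hmem : ∀ x ∈ V, x < n := fun x hx => by rw [hV, mem_vertexList] at hx; exact hx.1
  obtain ⟨v1, v2⟩ := hσ.vertices
  rw [← hV] at hlen hmark v1 v2 ⊢
  refine (Runs.forLoop (N := V.length) (B := 52) (fun j σ' =>
    (∀ x, σ'.arr 10 x = if x ∈ V.take j ∧ lev < σ.arr 10 x then 0 else σ.arr 10 x) ∧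
    σ'.reg 30 = ((V.take j).filter fun x => ¬ lev < σ.arr 10 x ∧ σ.arr 10 x ≠ 0).length)
    v1 (by omega) (by decide) rfl rfl ?_ ?_).mono le_rfl ?_
  · simp [h30]
  · intro j hj σ₁ h20 hf₁ hinv
    obtain ⟨i1, i2⟩ := hinv
    have h16₁ : σ₁.reg 16 = lev := by rw [hf₁.reg 16 rfl, h16]
    have hv : σ₁.arr 13 j = V[j] := by rw [hf₁.arr 13 rfl, v2 j hj]
    have htake : V.take (j + 1) = V.take j ++ [V[j]] := (List.take_append_getElem hj).symm
    have hnot : V[j] ∉ V.take j := by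
      have : (V.take (j + 1)).Nodup := hnd.sublist (List.take_sublist _ _)
      rw [htake, List.nodup_append] at this
      intro h
      exact this.2.2 _ h _ (List.mem_singleton_self _) rfl
    have hcur : σ₁.arr 10 V[j] = σ.arr 10 V[j] := by rw [i1, if_neg fun h => hnot h.1]
    have hr : ((V.take j).filter fun x => ¬ lev < σ.arr 10 x ∧ σ.arr 10 x ≠ 0).length ≤ n :=
      (List.length_filter_le _ _).trans ((List.length_take_le _ _).trans (by omega))
    rw [htake, List.filter_append, List.length_append]
    generalize
      ((V.take j).filter fun x => ¬ lev < σ.arr 10 x ∧ σ.arr 10 x ≠ 0).length = r at i2 hr ⊢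
    have e1 : r + 1 < 2 ^ w := by omega
    have hset : ∀ x, (x ∈ V.take j ++ [V[j]] ∧ lev < σ.arr 10 x) ↔
        (x ∈ V.take j ∧ lev < σ.arr 10 x) ∨ (x = V[j] ∧ lev < σ.arr 10 V[j]) := by
      intro x
      rw [List.mem_append, List.mem_singleton]
      constructor
      · rintro ⟨h | rfl, h'⟩
        · exact .inl ⟨h, h'⟩
        · exact .inr ⟨rfl, h'⟩
      · rintro (⟨h, h'⟩ | ⟨rfl, h'⟩)
        · exact ⟨.inl h, h'⟩
        · exact ⟨.inr rfl, h'⟩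
    simp only [hset]
    refine Runs.straight rfl (by decide) ?_
    by_cases ha : lev < σ.arr 10 V[j]
    · have ha' := ha.not_ge
      constructor
      · intro x
        by_cases hx : x = V[j]
        · simp [Program.apply, Expr.eval, h20, hv, hcur, h16₁, ha, hx]
        · simp [Program.apply, Expr.eval, h20, hv, hcur, h16₁, ha, hx, i1]
      · simp [Program.apply, Expr.eval, h20, hv, hcur, h16₁, ha, i2, ha']
    · by_cases hb : σ.arr 10 V[j] = 0
      · constructor
        · intro x
          simp [Program.apply, Expr.eval, h20, hv, hcur, h16₁, i1, hb]
        · simp [Program.apply, Expr.eval, h20, hv, hcur, h16₁, i2, hb]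
      · have ha' := not_lt.mp ha
        constructor
        · intro x
          simp [Program.apply, Expr.eval, h20, hv, hcur, h16₁, ha, i1, hb]
        · simp [Program.apply, Expr.eval, h20, hv, hcur, h16₁, ha, i2, hb, ha', Nat.mod_eq_of_lt,
            c1, e1]
  · rintro σ' - ⟨h1, h2⟩
    rw [List.take_length] at h1 h2
    have h3 : ∀ x, σ'.arr 10 x = if lev < σ.arr 10 x then 0 else σ.arr 10 x := by
      intro x
      rw [h1]
      by_cases hx : x ∈ V
      · simp [hx]
      · simp [hx, hmark x hx]
    refine ⟨h3, (V.filter fun x => ¬ lev < σ.arr 10 x ∧ σ.arr 10 x ≠ 0).toFinset, ?_, ?_, ?_⟩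
    · intro x hx
      rw [List.mem_toFinset, List.mem_filter] at hx
      exact Finset.mem_range.mpr (hmem x hx.1)
    · intro x
      rw [List.mem_toFinset, List.mem_filter, h3]
      by_cases hx : x ∈ V
      · by_cases hl : lev < σ.arr 10 x <;> simp [hx, hl]
      · simp [hx, hmark x hx]
    · rw [h2, List.toFinset_card_of_nodup (hnd.filter _)]

/-- The sweep over the edges that avoid the marked vertices, with the frontier in register `32`. -/
def sweep : Program :=
  .assign 32 (.reg 3) ;; .forLoop 20 13 (.assign 31 (.load 3 (.reg 20)) ;;
    .assign 33 (.load 4 (.reg 20)) ;;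
    whenAll [notE (.load 10 (.reg 31)), notE (.load 10 (.reg 33)), notE (.lt (.reg 32) (.reg 31)),
      .lt (.reg 32) (.reg 33)] (.assign 32 (.reg 33)))

theorem sweep_runs {w n τ k m s z : ℕ} {σ : State}
    {p : ℕ → ℕ → ℕ} (hσ : SearchData n τ s z k m p σ) (hlen : (edgeList n p τ).length < 2 ^ w)
    {S : Finset ℕ} (hS : ∀ x, x ∈ S ↔ σ.arr 10 x ≠ 0) :
    Runs w sweep σ ((edgeList n p τ).length * 60 + 10) fun σ' =>
      σ'.reg 32 = (edgeList n p τ).foldl (sweepStep S) s := by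
  refine Runs.mono (B := 2 + ((edgeList n p τ).length * (52 + 8) + 6))
    (Runs.seq (Q := fun σ' => σ'.reg 32 = s)
      (Runs.straight rfl (by decide) (by simp [Program.apply, Expr.eval, hσ.header.s_eq])) ?_)
    (by omega) fun _ _ h => h
  intro σ₁ hf₁ h32
  obtain ⟨e1, e2, e3⟩ := (hσ.frame hf₁ rfl rfl).edges
  obtain ⟨E, hE⟩ : ∃ E, E = edgeList n p τ := ⟨_, rfl⟩
  rw [← hE] at hlen e1 e2 e3 ⊢
  refine (Runs.forLoop (N := E.length) (fun j σ' => σ'.reg 32 = (E.take j).foldl (sweepStep S) s)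
    e1 hlen (by decide) rfl rfl ?_ ?_).mono le_rfl ?_
  · simpa using h32
  · intro j hj σ₂ h20 hf₂ hinv
    have hu : σ₂.arr 3 j = E[j].2.1 := by
      rw [hf₂.arr 3 rfl, e2 j (by simpa using hj), List.getElem_map]
    have hv : σ₂.arr 4 j = E[j].2.2 := by
      rw [hf₂.arr 4 rfl, e3 j (by simpa using hj), List.getElem_map]
    have hm : ∀ x, σ₂.arr 10 x = 0 ↔ x ∉ S := fun x => by
      rw [hf₂.arr 10 rfl, hf₁.arr 10 rfl, hS, not_not]
    have htake : E.take (j + 1) = E.take j ++ [E[j]] := (List.take_append_getElem hj).symm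
    rw [htake, List.foldl_append, List.foldl_cons, List.foldl_nil]
    generalize (E.take j).foldl (sweepStep S) s = f at hinv ⊢
    refine Runs.straight rfl (by decide) ?_
    have hcond : (∀ e ∈ [notE (.load 10 (.reg 31)), notE (.load 10 (.reg 33)),
        notE (.lt (.reg 32) (.reg 31)), .lt (.reg 32) (.reg 33)],
        Expr.eval w ((σ₂.setReg 31 E[j].2.1).setReg 33 E[j].2.2) e ≠ 0) ↔
        E[j].2.1 ∉ S ∧ E[j].2.2 ∉ S ∧ E[j].2.1 ≤ f ∧ f < E[j].2.2 := by
      simp only [List.forall_mem_cons, eval_notE_ne, Expr.eval, State.setReg_reg, State.setReg_arr]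
      simp [hinv, hm]
    simp only [Program.apply, apply_whenAll, Expr.eval, h20, hu, hv, State.setReg_reg,
      State.setReg_arr, Nat.reduceEqDiff, reduceIte]
    unfold sweepStep
    by_cases hc : E[j].2.1 ∉ S ∧ E[j].2.2 ∉ S ∧ E[j].2.1 ≤ f ∧ f < E[j].2.2
    · rw [if_pos (hcond.mpr hc), if_pos hc]
      simp
    · rw [if_neg (mt hcond.mp hc), if_neg hc]
      simp [hinv]
  · intro σ' _ h
    rwa [List.take_length] at h

/-- Marks all unmarked vertices that are crossed by the scanline of the item whose index is in
register `35`, with the number in register `15`. -/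
def markItem : Program :=
  .forLoop 20 10 (.assign 31 (.load 13 (.reg 20)) ;;
    whenAll [notE (.load 10 (.reg 31)), notE (.eq
        (.lt (.add (.reg 31) (.reg 5)) (.load 8 (.reg 35)))
        (.lt (.load 2 (.add (.load 7 (.reg 35)) (.reg 31))) (.load 9 (.reg 35))))]
      (.store 10 (.reg 31) (.reg 15)))

theorem markItem_runs {w n τ k m s z : ℕ} (hw : Fits w n τ k m) (hτ : 1 ≤ τ) {σ : State}
    {p : ℕ → ℕ → ℕ} (hσ : SearchData n τ s z k m p σ) {i v : ℕ} (h35 : σ.reg 35 = i)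
    (h15 : σ.reg 15 = v) (hv0 : v ≠ 0) (hi : i < (allItems n τ k p).length) :
    Runs w markItem σ ((vertexList n τ p n).length * 60 + 6) fun σ' =>
      ∀ x, σ'.arr 10 x = if x ∈ vertexList n τ p n ∧ σ.arr 10 x = 0 ∧
        itemCross p k (item n τ k p i) x then v else σ.arr 10 x := by
  have hn := hw.n_lt
  have hk := hw.k_lt
  have hlen := length_vertexList_le (n := n) (τ := τ) (p := p)
  obtain ⟨V, hV⟩ : ∃ V, V = vertexList n τ p n := ⟨_, rfl⟩
  have hmem : ∀ x ∈ V, x < n := fun x hx => by rw [hV, mem_vertexList] at hx; exact hx.1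
  obtain ⟨v1, v2⟩ := hσ.vertices
  rw [← hV] at hlen v1 v2 ⊢
  obtain ⟨t1, t2, -⟩ := isItem_of_mem_allItems hτ (item_mem hi)
  refine (Runs.forLoop (N := V.length) (B := 52) (fun j σ' =>
    ∀ x, σ'.arr 10 x = if x ∈ V.take j ∧ σ.arr 10 x = 0 ∧ itemCross p k (item n τ k p i) x
      then v else σ.arr 10 x)
    v1 (by omega) (by decide) rfl rfl ?_ ?_).mono le_rfl ?_
  · simp
  · intro j hj σ₁ h20 hf₁ hinv
    have hσ₁ := hσ.frame hf₁ rfl rfl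
    obtain ⟨a7, a8, a9⟩ := hσ₁.item_eq hi
    have h35₁ : σ₁.reg 35 = i := by rw [hf₁.reg 35 rfl, h35]
    have h15₁ : σ₁.reg 15 = v := by rw [hf₁.reg 15 rfl, h15]
    have hx : σ₁.arr 13 j = V[j] := by rw [hf₁.arr 13 rfl, v2 j hj]
    have hxn := hmem V[j] (List.getElem_mem hj)
    have hpos := hσ₁.pos _ t1 _ hxn
    obtain ⟨g1, g2, -, -⟩ := hw.index t1 hxn hxn
    have g3 : V[j] + k < 2 ^ w := by omega
    have htake : V.take (j + 1) = V.take j ++ [V[j]] := (List.take_append_getElem hj).symm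
    rw [htake]
    refine Runs.straight rfl (by decide) fun x => ?_
    have hcond : (∀ e ∈ [notE (.load 10 (.reg 31)), notE (.eq
        (.lt (.add (.reg 31) (.reg 5)) (.load 8 (.reg 35)))
        (.lt (.load 2 (.add (.load 7 (.reg 35)) (.reg 31))) (.load 9 (.reg 35))))],
        Expr.eval w (σ₁.setReg 31 V[j]) e ≠ 0) ↔
        σ₁.arr 10 V[j] = 0 ∧ itemCross p k (item n τ k p i) V[j] := by
      simp only [List.forall_mem_cons, eval_notE_ne, Expr.eval, State.setReg_reg, State.setReg_arr,
        Nat.reduceEqDiff, reduceIte, h35₁, hσ₁.header.k_eq, a7, a8, a9, Nat.mod_eq_of_lt g2,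
        Nat.mod_eq_of_lt g3, itemCross, hpos]
      by_cases q1 : V[j] + k < (item n τ k p i).2.1 <;>
        by_cases q2 : p (item n τ k p i).1 V[j] < (item n τ k p i).2.2 <;> simp [q1, q2]
    simp only [Program.apply, apply_whenAll, Expr.eval, h20, hx]
    rw [State.setReg_arr]
    by_cases hc : σ₁.arr 10 V[j] = 0 ∧ itemCross p k (item n τ k p i) V[j]
    · rw [if_pos (hcond.mpr hc)]
      simp only [State.setArr_arr, State.setReg_reg, State.setReg_arr, h15₁, true_and, if_true,
        List.mem_append, List.mem_singleton]
      by_cases hxj : x = V[j]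
      · subst hxj
        have h0 := hinv V[j]
        rw [hc.1] at h0
        have hz : σ.arr 10 V[j] = 0 := by
          split_ifs at h0 with h'
          · exact absurd h0.symm hv0
          · exact h0.symm
        simp [hz, hc.2]
      · rw [if_neg hxj, hinv x]
        simp [hxj]
    · rw [if_neg (mt hcond.mp hc)]
      rw [State.setReg_arr, hinv x]
      simp only [List.mem_append, List.mem_singleton]
      by_cases hxj : x = V[j]
      · subst hxj
        by_cases h' : V[j] ∈ V.take j
        · simp [h']
        · have h0 := hinv V[j]
          rw [if_neg fun h => h' h.1] at h0
          rw [h0] at hc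
          simp [h', hc]
      · simp [hxj]
  · intro σ' _ h
    rwa [List.take_length] at h

/-! ### The program: depth-first search -/

/-- The first `j` of the chosen items `a 0, a 1, …` form a leaf of the search tree whose marked
vertices are a separator. -/
structure IsTarget (n τ s z k : ℕ) (p : ℕ → ℕ → ℕ) (a : ℕ → ℕ) (j : ℕ) : Prop where
  le : j ≤ k
  lt_limit : ∀ i < j, a i < limit n τ k p i
  success : ∀ S ⊆ Finset.range n, (∀ x, x ∈ S ↔ x ∈ vertexList n τ p n ∧
    ∃ i < j, itemCross p k (item n τ k p (a i)) x) →
    s ∉ S ∧ z ∉ S ∧ S.card ≤ k ∧ ∃ β, IsBarrier n τ s z p S β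

/-- The branch `a 0, …, a (j - 1)` has not been visited yet: either the search is at its end, or it
has followed the branch up to some level `r` at which the item `a r` is still to be tried. -/
def Pending (lev : ℕ) (idx a : ℕ → ℕ) (j : ℕ) : Prop :=
  (∃ r < lev, r < j ∧ idx r ≤ a r ∧ ∀ i < r, idx i = a i + 1) ∨
    (lev = j + 1 ∧ ∀ i < j, idx i = a i + 1)

/-- The invariant of the search. Register `15` holds the number of the levels on the stack,
    and array
`11` the number of items that have been tried at each level. A vertex carries the number of the
first level at which it has been marked, or an outdated larger number. -/
structure SearchInv (n τ s z k m : ℕ) (p : ℕ → ℕ → ℕ) (σ : State) : Prop where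
  data : SearchData n τ s z k m p σ
  level_le : σ.reg 15 ≤ k + 1
  idx_le : ∀ l < σ.reg 15, σ.arr 11 l ≤ limit n τ k p l
  unmarked : ∀ x, x ∉ vertexList n τ p n → σ.arr 10 x = 0
  marks : ∀ j < σ.reg 15, ∀ x ∈ vertexList n τ p n, (σ.arr 10 x ≠ 0 ∧ σ.arr 10 x ≤ j) ↔
    ∃ l < j, itemCross p k (item n τ k p (σ.arr 11 l - 1)) x
  sound : σ.reg 0 = 0 ∨ (σ.reg 0 = 1 ∧ HasBarrier n τ s z k p)
  complete : ∀ a j, IsTarget n τ s z k p a j → σ.reg 0 = 1 ∨ Pending (σ.reg 15) (σ.arr 11) a j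

/-- Tests whether the marked vertices form a separator. -/
def testMarks : Program :=
  .assign 16 (.sub (.reg 15) (.const 1)) ;; .assign 30 (.const 0) ;; cleanMarks ;; sweep ;;
  whenAll [notE (.lt (.reg 5) (.reg 30)), .lt (.reg 32) (.reg 4), notE (.load 10 (.reg 3)),
    notE (.load 10 (.reg 4))] (.assign 0 (.const 1))

/-- The test preserves the invariant and recognizes a separator at the current node. -/
theorem testMarks_runs {w n τ k m s z : ℕ} (hw : Fits w n τ k m) {σ : State}
    {p : ℕ → ℕ → ℕ} (hσ : SearchInv n τ s z k m p σ) (hlen : (edgeList n p τ).length < 2 ^ w)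
    (hsz : s < z) {lev : ℕ} (h15 : σ.reg 15 = lev + 1) :
    Runs w testMarks σ ((vertexList n τ p n).length * 60 + (edgeList n p τ).length * 60 + 200)
      fun σ' => SearchInv n τ s z k m p σ' ∧ σ'.reg 16 = lev ∧ (∀ x, σ'.arr 10 x ≤ lev) ∧
        ∀ a, IsTarget n τ s z k p a lev → (∀ i < lev, σ'.arr 11 i = a i + 1) → σ'.reg 0 = 1 := by
  have hin := hw.input
  have c1 : 1 < 2 ^ w := by omega
  refine Runs.mono (B := 6 + (6 + (((vertexList n τ p n).length * 60 + 6) +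
    (((edgeList n p τ).length * 60 + 10) + 100)))) (Q := fun σ' => σ'.reg 16 = lev ∧
      (∀ x, σ'.arr 10 x = if lev < σ.arr 10 x then 0 else σ.arr 10 x) ∧
      ∃ S ⊆ Finset.range n, (∀ x, x ∈ S ↔ σ'.arr 10 x ≠ 0) ∧
        ((s ∉ S ∧ z ∉ S ∧ S.card ≤ k ∧ ∃ β, IsBarrier n τ s z p S β) ∧ σ'.reg 0 = 1 ∨
          ¬ (s ∉ S ∧ z ∉ S ∧ S.card ≤ k ∧ ∃ β, IsBarrier n τ s z p S β) ∧ σ'.reg 0 = σ.reg 0))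
    ?_ (by omega) ?_
  · refine Runs.seq (Q := fun σ' => σ'.reg 16 = lev) (Runs.straight rfl (by decide)
      (by simp [Program.apply, Expr.eval, h15, Nat.mod_eq_of_lt, c1])) fun σ₁ hf₁ h16₁ => ?_
    refine Runs.seq (Q := fun σ' => σ'.reg 30 = 0) (Runs.straight rfl (by decide)
      (by simp [Program.apply, Expr.eval])) fun σ₂ hf₂ h30 => ?_
    have h16₂ : σ₂.reg 16 = lev := by rw [hf₂.reg 16 rfl, h16₁]
    have ha₂ : σ₂.arr 10 = σ.arr 10 := by rw [hf₂.arr 10 rfl, hf₁.arr 10 rfl]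
    have hd₂ := (hσ.data.frame hf₁ rfl rfl).frame hf₂ rfl rfl
    refine Runs.seq (cleanMarks_runs hw hd₂ h16₂ h30 (ha₂ ▸ hσ.unmarked)) ?_
    rintro σ₃ hf₃ ⟨h10₃, S, hSn, hS, h30₃⟩
    have hd₃ := hd₂.frame hf₃ rfl rfl
    refine Runs.seq (sweep_runs hd₃ hlen hS) fun σ₄ hf₄ h32 => ?_
    have hd₄ := hd₃.frame hf₄ rfl rfl
    have ha₄ : σ₄.arr 10 = σ₃.arr 10 := hf₄.arr 10 rfl
    have hbar := foldl_sweepStep_lt_iff (S := S) (s := s) (z := z) (n := n) (p := p) (τ := τ)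
      edgeList_sorted (fun t u v => mem_edgeList t u v) hsz
    rw [← h32] at hbar
    have h30₄ : σ₄.reg 30 = S.card := by rw [hf₄.reg 30 rfl, h30₃]
    have h16₄ : σ₄.reg 16 = lev := by rw [hf₄.reg 16 rfl, hf₃.reg 16 rfl, h16₂]
    have h0₄ : σ₄.reg 0 = σ.reg 0 := by
      rw [hf₄.reg 0 rfl, hf₃.reg 0 rfl, hf₂.reg 0 rfl, hf₁.reg 0 rfl]
    have hnot : ∀ x, x ∉ S ↔ σ₄.arr 10 x = 0 := fun x => by rw [hS, not_not, ha₄]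
    have hcond : (∀ e ∈ [notE (.lt (.reg 5) (.reg 30)), .lt (.reg 32) (.reg 4),
        notE (.load 10 (.reg 3)), notE (.load 10 (.reg 4))], Expr.eval w σ₄ e ≠ 0) ↔
        (s ∉ S ∧ z ∉ S ∧ S.card ≤ k ∧ ∃ β, IsBarrier n τ s z p S β) := by
      rw [← hbar, hnot, hnot]
      simp only [List.forall_mem_cons, eval_notE_ne, Expr.eval, hd₄.header.k_eq, hd₄.header.z_eq,
        hd₄.header.s_eq, h30₄]
      simp only [ite_eq_right_iff, one_ne_zero, imp_false, not_lt, ne_eq, not_le,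
        List.not_mem_nil, false_imp_iff, implies_true, and_true]
      tauto
    refine Runs.straight rfl (by decide) ?_
    rw [apply_whenAll]
    by_cases hc : s ∉ S ∧ z ∉ S ∧ S.card ≤ k ∧ ∃ β, IsBarrier n τ s z p S β
    · rw [if_pos (hcond.mpr hc)]
      refine ⟨?_, ?_, S, hSn, ?_, .inl ⟨hc, ?_⟩⟩
      · simp [Program.apply, h16₄]
      · simp [Program.apply, ha₄, h10₃, ha₂]
      · simp [Program.apply, ha₄, hS]
      · simp [Program.apply, Expr.eval, Nat.mod_eq_of_lt, c1]
    · rw [if_neg (mt hcond.mp hc)]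
      refine ⟨h16₄, ?_, S, hSn, ?_, .inr ⟨hc, h0₄⟩⟩
      · simp [ha₄, h10₃, ha₂]
      · simp [ha₄, hS]
  · rintro σ' hf ⟨h16, h10, S, hSn, hS, h0⟩
    have h15' : σ'.reg 15 = lev + 1 := by rw [hf.reg 15 rfl, h15]
    have h11 : σ'.arr 11 = σ.arr 11 := hf.arr 11 rfl
    have hmark : ∀ j ≤ lev, ∀ x, (σ'.arr 10 x ≠ 0 ∧ σ'.arr 10 x ≤ j) ↔
        (σ.arr 10 x ≠ 0 ∧ σ.arr 10 x ≤ j) := by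
      intro j hj x
      rw [h10]
      split_ifs <;> omega
    have hle : ∀ x, σ'.arr 10 x ≤ lev := by
      intro x
      rw [h10]
      split_ifs <;> omega
    have hdone : ∀ a, IsTarget n τ s z k p a lev → (∀ i < lev, σ'.arr 11 i = a i + 1) →
        σ'.reg 0 = 1 := by
      intro a ha hi
      have := ha.success S hSn fun x => by
        by_cases hx : x ∈ vertexList n τ p n
        · have h1 := hσ.marks lev (by omega) x hx
          rw [← hmark lev le_rfl x] at h1
          rw [hS, show (σ'.arr 10 x ≠ 0 ↔ σ'.arr 10 x ≠ 0 ∧ σ'.arr 10 x ≤ lev) from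
            ⟨fun h => ⟨h, hle x⟩, And.left⟩, h1]
          simp only [hx, true_and]
          refine exists_congr fun l => and_congr_right fun hl => ?_
          rw [← h11, hi l hl, Nat.add_sub_cancel]
        · rw [hS, h10, hσ.unmarked x hx]
          simp [hx]
      rcases h0 with h0 | h0
      · exact h0.2
      · exact absurd this h0.1
    refine ⟨⟨hσ.data.frame hf rfl rfl, by rw [h15', ← h15]; exact hσ.level_le, ?_, ?_, ?_, ?_, ?_⟩,
      h16, hle, hdone⟩
    · rw [h11, h15', ← h15]; exact hσ.idx_le
    · intro x hx
      rw [h10, hσ.unmarked x hx]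
      simp
    · intro j hj x hx
      rw [hmark j (by omega), h11]
      exact hσ.marks j (by omega) x hx
    · rcases h0 with h0 | h0
      · exact .inr ⟨h0.2, S, hSn, h0.1⟩
      · rw [h0.2]; exact hσ.sound
    · intro a j ha
      rcases hσ.complete a j ha with h | h
      · rcases h0 with h0 | h0
        · exact .inl h0.2
        · exact .inl (h0.2.trans h)
      · right
        rw [h15', ← h15, h11]
        exact h

/-- Goes on to the next node of the search tree: tries the next item if there is one, and returns to
the level below otherwise. -/
def nextNode : Program :=
  .ite (.reg 16) (.assign 34 (.reg 14)) (.assign 34 (.reg 8)) ;;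
  .ite (.mul (.lt (.load 11 (.reg 16)) (.reg 34)) (.lt (.reg 16) (.reg 5)))
    (.assign 35 (.load 11 (.reg 16)) ;; .store 11 (.reg 16) (.add (.reg 35) (.const 1)) ;;
      markItem ;; .store 11 (.reg 15) (.const 0) ;; .assign 15 (.add (.reg 15) (.const 1)))
    (.assign 15 (.reg 16))

theorem length_allItems_lt {w n τ k m : ℕ} (hw : Fits w n τ k m) (p : ℕ → ℕ → ℕ) :
    (allItems n τ k p).length < 2 ^ w := by
  have h1 := hw.items
  have h2 := length_eventItems_le n k p τ
  rw [allItems, List.length_append, length_initialItems]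
  rw [Nat.add_mul τ, Nat.add_mul, Nat.one_mul] at h1
  omega

/-- The time that remains below a node of the search tree with `j` further levels,
    in which `M` items
may be chosen at each of the levels below the first. -/
def subtree (M : ℕ) : ℕ → ℕ
  | 0 => 0
  | j + 1 => 2 + M * subtree M j

/-- An upper bound for the number of iterations that the search still needs. -/
def remaining (n τ k : ℕ) (p : ℕ → ℕ → ℕ) (lev : ℕ) (idx : ℕ → ℕ) : ℕ :=
  ∑ l ∈ Finset.range lev,
    (1 + subtree (eventItems n k p τ).length (k - l) * (limit n τ k p l - idx l))

/-- A new level adds less to the bound than the next item at the old level takes away from it. -/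
theorem remaining_push {n τ k : ℕ} {p : ℕ → ℕ → ℕ} {lev : ℕ} {idx idx' : ℕ → ℕ}
    (hlev : lev < k) (hi : idx lev < limit n τ k p lev) (h1 : ∀ i < lev, idx' i = idx i)
    (h2 : idx' lev = idx lev + 1) (h3 : idx' (lev + 1) = 0) :
    remaining n τ k p (lev + 2) idx' < remaining n τ k p (lev + 1) idx := by
  unfold remaining
  rw [Finset.sum_range_succ, Finset.sum_range_succ, Finset.sum_range_succ,
    Finset.sum_congr rfl fun l hl => by rw [h1 l (Finset.mem_range.mp hl)], h2, h3]
  obtain ⟨j, rfl⟩ : ∃ j, k = lev + j + 1 := ⟨k - lev - 1, by omega⟩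
  obtain ⟨d, hd⟩ : ∃ d, limit n τ (lev + j + 1) p lev = idx lev + 1 + d :=
    ⟨limit n τ (lev + j + 1) p lev - idx lev - 1, by omega⟩
  have e1 : lev + j + 1 - lev = j + 1 := by omega
  have e2 : lev + j + 1 - (lev + 1) = j := by omega
  have e3 : limit n τ (lev + j + 1) p (lev + 1) = (eventItems n (lev + j + 1) p τ).length := rfl
  rw [hd, e1, e2, e3, show idx lev + 1 + d - (idx lev + 1) = d by omega,
    show idx lev + 1 + d - idx lev = d + 1 by omega, Nat.mul_add (subtree _ (j + 1)) d 1,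
    Nat.mul_one]
  conv_rhs => rw [subtree]
  rw [Nat.sub_zero, Nat.mul_comm (subtree _ j), subtree]
  omega

theorem nextNode_runs {w n τ k m s z : ℕ} (hw : Fits w n τ k m) (hτ : 1 ≤ τ) {σ : State}
    {p : ℕ → ℕ → ℕ} (hσ : SearchInv n τ s z k m p σ) {lev : ℕ} (h15 : σ.reg 15 = lev + 1)
    (h16 : σ.reg 16 = lev) (hclean : ∀ x, σ.arr 10 x ≤ lev)
    (hdone : ∀ a, IsTarget n τ s z k p a lev → (∀ i < lev, σ.arr 11 i = a i + 1) → σ.reg 0 = 1) :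
    Runs w nextNode σ ((vertexList n τ p n).length * 60 + 100) fun σ' =>
      SearchInv n τ s z k m p σ' ∧ remaining n τ k p (σ'.reg 15) (σ'.arr 11) <
        remaining n τ k p (σ.reg 15) (σ.arr 11) := by
  have hin := hw.input
  have hkw := hw.k_lt
  have hN := length_allItems_lt hw p
  have c1 : 1 < 2 ^ w := by omega
  refine Runs.mono (B := 20 + (8 + 1 + ((vertexList n τ p n).length * 60 + 60)))
    (Runs.seq (Q := fun σ' => σ'.reg 34 = limit n τ k p lev) (Runs.straight rfl (by decide) ?_) ?_)
    (by omega) fun _ _ h => h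
  · simp only [Program.apply, Expr.eval, h16, limit]
    split_ifs
    · simp [hσ.data.items.1]
    · simp [hσ.data.events]
  intro σ₁ hf₁ h34
  have hd₁ := hσ.data.frame hf₁ rfl rfl
  have h16₁ : σ₁.reg 16 = lev := by rw [hf₁.reg 16 rfl, h16]
  have h15₁ : σ₁.reg 15 = lev + 1 := by rw [hf₁.reg 15 rfl, h15]
  have h11₁ : σ₁.arr 11 = σ.arr 11 := hf₁.arr 11 rfl
  have h10₁ : σ₁.arr 10 = σ.arr 10 := hf₁.arr 10 rfl
  have h0₁ : σ₁.reg 0 = σ.reg 0 := hf₁.reg 0 rfl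
  have hcond : Expr.eval w σ₁ (.mul (.lt (.load 11 (.reg 16)) (.reg 34)) (.lt (.reg 16) (.reg 5))) ≠
      0 ↔ σ.arr 11 lev < limit n τ k p lev ∧ lev < k := by
    simp only [Expr.eval, h16₁, h34, hd₁.header.k_eq, h11₁]
    by_cases q1 : σ.arr 11 lev < limit n τ k p lev <;> by_cases q2 : lev < k <;>
      simp [q1, q2, Nat.mod_eq_of_lt c1]
  have hlev := hσ.level_le
  refine Runs.ite ?_ ?_
  · intro hc
    obtain ⟨hi, hk⟩ := hcond.mp hc
    have hiN : σ.arr 11 lev < (allItems n τ k p).length := hi.trans_le limit_le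
    refine Runs.mono (B := 5 + (8 + (((vertexList n τ p n).length * 60 + 6) + (5 + 8))))
      (Q := fun σ' => (∀ x, σ'.arr 10 x = if x ∈ vertexList n τ p n ∧ σ.arr 10 x = 0 ∧
        itemCross p k (item n τ k p (σ.arr 11 lev)) x then lev + 1 else σ.arr 10 x) ∧
        (∀ l, σ'.arr 11 l = if l = lev + 1 then 0 else if l = lev then σ.arr 11 lev + 1 else
          σ.arr 11 l) ∧ σ'.reg 15 = lev + 2) ?_ (by omega) ?_
    · refine Runs.seq (Q := fun σ' => σ'.reg 35 = σ.arr 11 lev) (Runs.straight rfl (by decide)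
        (by simp [Program.apply, Expr.eval, h16₁, h11₁])) fun σ₂ hf₂ h35 => ?_
      have hd₂ := hd₁.frame hf₂ rfl rfl
      have e1 : σ.arr 11 lev + 1 < 2 ^ w := by omega
      refine Runs.seq (Q := fun σ' => ∀ l, σ'.arr 11 l = if l = lev then σ.arr 11 lev + 1 else
          σ.arr 11 l) (Runs.straight rfl (by decide) ?_) fun σ₃ hf₃ h11₃ => ?_
      · intro l
        simp [Program.apply, Expr.eval, h35, hf₂.reg 16 rfl, h16₁, hf₂.arr 11 rfl, h11₁,
          Nat.mod_eq_of_lt, c1, e1]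
      have hd₃ := hd₂.frame hf₃ rfl rfl
      have h35₃ : σ₃.reg 35 = σ.arr 11 lev := by rw [hf₃.reg 35 rfl, h35]
      have h15₃ : σ₃.reg 15 = lev + 1 := by rw [hf₃.reg 15 rfl, hf₂.reg 15 rfl, h15₁]
      have h10₃ : σ₃.arr 10 = σ.arr 10 := by rw [hf₃.arr 10 rfl, hf₂.arr 10 rfl, h10₁]
      refine Runs.seq (markItem_runs hw hτ hd₃ h35₃ h15₃ (by omega) hiN) fun σ₄ hf₄ h10₄ => ?_
      have h15₄ : σ₄.reg 15 = lev + 1 := by rw [hf₄.reg 15 rfl, h15₃]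
      have h11₄ : σ₄.arr 11 = σ₃.arr 11 := hf₄.arr 11 rfl
      have e2 : lev + 1 + 1 < 2 ^ w := by omega
      refine Runs.straight (p := .store 11 (.reg 15) (.const 0) ;;
        .assign 15 (.add (.reg 15) (.const 1))) rfl (by decide) ⟨?_, ?_, ?_⟩
      · intro x
        simp [Program.apply, h10₄, h10₃]
      · intro l
        simp [Program.apply, Expr.eval, h15₄, h11₄, h11₃]
      · simp [Program.apply, Expr.eval, h15₄, Nat.mod_eq_of_lt, c1, e2]
    · rintro σ' hf ⟨h10', h11', h15'⟩
      have h0' : σ'.reg 0 = σ.reg 0 := by rw [hf.reg 0 rfl, h0₁]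
      have hlow : ∀ l < lev, σ'.arr 11 l = σ.arr 11 l := fun l hl => by
        rw [h11', if_neg (by omega), if_neg (by omega)]
      have hnow : σ'.arr 11 lev = σ.arr 11 lev + 1 := by rw [h11', if_neg (by omega), if_pos rfl]
      have hnew : σ'.arr 11 (lev + 1) = 0 := by rw [h11', if_pos rfl]
      refine ⟨⟨hd₁.frame hf rfl rfl, by omega, ?_, ?_, ?_, ?_, ?_⟩, ?_⟩
      · intro l hl
        rcases (by omega : l < lev ∨ l = lev ∨ l = lev + 1) with h | rfl | rfl
        · rw [hlow l h]; exact hσ.idx_le l (by omega)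
        · rw [hnow]; exact hi
        · rw [hnew]; exact Nat.zero_le _
      · intro x hx
        rw [h10', if_neg fun h => hx h.1, hσ.unmarked x hx]
      · intro j hj x hx
        -- The new marks are larger than `lev`, so only the last level sees them.
        rcases (by omega : j ≤ lev ∨ j = lev + 1) with h | rfl
        · have h1 := hσ.marks j (by omega) x hx
          rw [show (∃ l < j, itemCross p k (item n τ k p (σ'.arr 11 l - 1)) x) ↔
            ∃ l < j, itemCross p k (item n τ k p (σ.arr 11 l - 1)) x from
            exists_congr fun l => and_congr_right fun hl => by rw [hlow l (by omega)], ← h1, h10']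
          split_ifs with h2
          · have := h2.2.1
            omega
          · rfl
        · have h1 := hσ.marks lev (by omega) x hx
          have h2 := hclean x
          have h3 : (∃ l < lev + 1, itemCross p k (item n τ k p (σ'.arr 11 l - 1)) x) ↔
              (∃ l < lev, itemCross p k (item n τ k p (σ.arr 11 l - 1)) x) ∨
                itemCross p k (item n τ k p (σ.arr 11 lev)) x := by
            simp only [Nat.lt_succ_iff_lt_or_eq, or_and_right, exists_or, exists_eq_left, hnow,
              Nat.add_sub_cancel]
            refine or_congr_left (exists_congr fun l => and_congr_right fun hl => by
              rw [hlow l hl])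
          rw [h3, ← h1, h10']
          split_ifs with h4
          · simp [h4.2.2]
          · by_cases h5 : σ.arr 10 x = 0
            · have : ¬ itemCross p k (item n τ k p (σ.arr 11 lev)) x := fun h => h4 ⟨hx, h5, h⟩
              simp [h5, this]
            · simp only [h5, ne_eq, not_false_eq_true, true_and]
              omega
      · rw [h0']; exact hσ.sound
      · intro a j ha
        rw [h0', h15']
        rcases hσ.complete a j ha with h | ⟨r, hr, hrj, hle, hpre⟩ | ⟨hj, hpre⟩
        · exact .inl h
        · right
          rw [h15] at hr
          rcases (by omega : r < lev ∨ r = lev) with hr' | rfl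
          · exact .inl ⟨r, by omega, hrj, by rw [hlow r hr']; exact hle, fun i hir => by
              rw [hlow i (by omega), hpre i hir]⟩
          · rcases hle.lt_or_eq with hlt | heq
            · exact .inl ⟨r, by omega, hrj, by rw [hnow]; exact hlt, fun i hir => by
                rw [hlow i hir, hpre i hir]⟩
            · have hpre' : ∀ i < r + 1, σ'.arr 11 i = a i + 1 := fun i hir => by
                rcases (by omega : i < r ∨ i = r) with h | rfl
                · rw [hlow i h, hpre i h]
                · rw [hnow, heq]
              rcases (by omega : j = r + 1 ∨ r + 1 < j) with rfl | hj
              · exact .inr ⟨rfl, hpre'⟩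
              · exact .inl ⟨r + 1, by omega, hj, by rw [hnew]; exact Nat.zero_le _, hpre'⟩
        · left
          obtain rfl : j = lev := by omega
          exact hdone a ha hpre
      · rw [h15', h15]
        exact remaining_push hk hi hlow hnow hnew
  · intro hc
    have hc' : ¬ (σ.arr 11 lev < limit n τ k p lev ∧ lev < k) := fun h => hcond.mpr h hc
    refine (Runs.straight (p := .assign 15 (.reg 16)) (Q := fun σ' => σ'.reg 15 = lev) rfl
      (by simp [Program.maxCost, Expr.cost]) (by simp [Program.apply, Expr.eval, h16₁])).mono
      le_rfl ?_
    intro σ' hf h15'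
    have h11' : σ'.arr 11 = σ.arr 11 := by rw [hf.arr 11 rfl, h11₁]
    have h10' : σ'.arr 10 = σ.arr 10 := by rw [hf.arr 10 rfl, h10₁]
    have h0' : σ'.reg 0 = σ.reg 0 := by rw [hf.reg 0 rfl, h0₁]
    refine ⟨⟨hd₁.frame hf rfl rfl, by omega, ?_, ?_, ?_, ?_, ?_⟩, ?_⟩
    · rw [h11', h15']
      exact fun l hl => hσ.idx_le l (by omega)
    · rw [h10']; exact hσ.unmarked
    · rw [h10', h11', h15']
      exact fun j hj => hσ.marks j (by omega)
    · rw [h0']; exact hσ.sound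
    · intro a j ha
      rw [h0', h15', h11']
      rcases hσ.complete a j ha with h | ⟨r, hr, hrj, hle, hpre⟩ | ⟨hj, hpre⟩
      · exact .inl h
      · rcases (by omega : r < lev ∨ r = lev) with hr' | rfl
        · exact .inr (.inl ⟨r, hr', hrj, hle, hpre⟩)
        · exact absurd ⟨hle.trans_lt (ha.lt_limit r hrj), hrj.trans_le ha.le⟩ hc'
      · left
        obtain rfl : j = lev := by omega
        exact hdone a ha hpre
    · rw [h15', h15, h11', remaining, remaining, Finset.sum_range_succ]
      omega

/-- If there is a separator, then some node of the search tree finds one: the items of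
`HasBarrier.exists_items`, of which only the first may lie outside the list of items for events. -/
theorem exists_isTarget {n τ s z k : ℕ} {p : ℕ → ℕ → ℕ} (hp : ∀ t < τ, IsPermOn n (p t))
    (hz : z < n) (h : HasBarrier n τ s z k p) : ∃ a j, IsTarget n τ s z k p a j := by
  obtain ⟨L, hLk, hL, hS⟩ := h.exists_items hp hz (V := (vertexList n τ p n).toFinset)
    fun t ht x hx y hy hxy => by
      rw [List.mem_toFinset, mem_vertexList]
      exact ⟨hx, t, Finset.mem_range.mpr ht, y, Finset.mem_range.mpr hy, hxy⟩
  have hidx : ∀ i, ∃ q, ∀ hi : i < L.length, q < limit n τ k p i ∧ item n τ k p q = L[i] := by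
    intro i
    by_cases hi : i < L.length
    swap
    · exact ⟨0, fun h => absurd h hi⟩
    obtain ⟨h1, h2⟩ := hL i hi
    rcases h2 with h2 | ⟨rfl, h2⟩
    · obtain ⟨q, hq, hqe⟩ := List.getElem_of_mem (mem_eventItems h1 h2)
      have hq' : q < (allItems n τ k p).length := by
        rw [allItems, List.length_append]
        omega
      refine ⟨q, fun _ => ⟨?_, ?_⟩⟩
      · unfold limit
        split_ifs
        · exact hq'
        · exact hq
      · rw [item, List.getD_eq_getElem _ _ hq', ← hqe]
        exact List.getElem_append_left hq
    · obtain ⟨q, hq, hqe⟩ := List.getElem_of_mem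
        (List.mem_append_right (eventItems n k p τ) (mem_initialItems h1 h2))
      refine ⟨q, fun _ => ⟨hq, ?_⟩⟩
      rw [item, List.getD_eq_getElem (allItems n τ k p) _ hq]
      exact hqe
  choose a ha using hidx
  refine ⟨a, L.length, hLk, fun i hi => (ha i hi).1, fun S hSn hSx => hS S (fun x _ => ?_) hSn⟩
  rw [hSx, List.mem_toFinset]
  refine and_congr_right fun _ => ⟨?_, ?_⟩
  · rintro ⟨i, hi, hc⟩
    exact ⟨L[i], List.getElem_mem hi, (ha i hi).2 ▸ hc⟩
  · rintro ⟨e, he, hc⟩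
    obtain ⟨i, hi, rfl⟩ := List.getElem_of_mem he
    exact ⟨i, hi, (ha i hi).2 ▸ hc⟩

/-- Depth-first search in the tree of all choices of at most `k` items. -/
def search : Program :=
  .assign 15 (.const 1) ;; .store 11 (.const 0) (.const 0) ;; .loop (.reg 15)
    (testMarks ;; nextNode)

theorem search_runs {w n τ k m s z : ℕ} (hw : Fits w n τ k m) (hτ : 1 ≤ τ) {σ : State}
    {p : ℕ → ℕ → ℕ} (hσ : SearchData n τ s z k m p σ) (hlen : (edgeList n p τ).length < 2 ^ w)
    (hp : ∀ t < τ, IsPermOn n (p t)) (hsz : s < z) (hz : z < n) (h0 : σ.reg 0 = 0)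
    (h10 : ∀ x, σ.arr 10 x = 0) :
    Runs w search σ ((1 + subtree (eventItems n k p τ).length k * (allItems n τ k p).length) *
      ((vertexList n τ p n).length * 120 + (edgeList n p τ).length * 60 + 302) + 10) fun σ' =>
      (HasBarrier n τ s z k p → σ'.reg 0 = 1) ∧ (¬ HasBarrier n τ s z k p → σ'.reg 0 = 0) := by
  have hin := hw.input
  have c1 : 1 < 2 ^ w := by omega
  have e1 : (1 + subtree (eventItems n k p τ).length k * (allItems n τ k p).length) *
      (1 + 1 + (((vertexList n τ p n).length * 60 + (edgeList n p τ).length * 60 + 200) +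
        ((vertexList n τ p n).length * 60 + 100))) =
      (1 + subtree (eventItems n k p τ).length k * (allItems n τ k p).length) *
      ((vertexList n τ p n).length * 120 + (edgeList n p τ).length * 60 + 302) := by ring
  rw [← e1]
  refine Runs.mono (B := 2 + (3 + ((1 + subtree (eventItems n k p τ).length k *
    (allItems n τ k p).length) * (1 + 1 + (((vertexList n τ p n).length * 60 +
      (edgeList n p τ).length * 60 + 200) + ((vertexList n τ p n).length * 60 + 100))) + (1 + 1))))
    (Runs.seq (Q := fun σ' => σ'.reg 15 = 1) (Runs.straight rfl (by decide)
      (by simp [Program.apply, Expr.eval, Nat.mod_eq_of_lt, c1])) ?_) (by omega) fun _ _ h => h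
  intro σ₁ hf₁ h15₁
  refine Runs.seq (Q := fun σ' => σ'.arr 11 0 = 0) (Runs.straight rfl (by decide)
    (by simp [Program.apply, Expr.eval])) fun σ₂ hf₂ h11 => ?_
  have h15 : σ₂.reg 15 = 1 := by rw [hf₂.reg 15 rfl, h15₁]
  have h10₂ : ∀ x, σ₂.arr 10 x = 0 := fun x => by rw [hf₂.arr 10 rfl, hf₁.arr 10 rfl, h10]
  have hinit : SearchInv n τ s z k m p σ₂ := by
    refine ⟨(hσ.frame hf₁ rfl rfl).frame hf₂ rfl rfl, by omega, ?_, fun x _ => h10₂ x, ?_,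
      .inl (by rw [hf₂.reg 0 rfl, hf₁.reg 0 rfl, h0]), ?_⟩
    · intro l hl
      obtain rfl : l = 0 := by omega
      rw [h11]
      exact Nat.zero_le _
    · intro j hj x _
      obtain rfl : j = 0 := by omega
      simp [h10₂]
    · intro a j _
      right
      rcases Nat.eq_zero_or_pos j with rfl | hj
      · exact .inr ⟨h15, by simp⟩
      · exact .inl ⟨0, by omega, hj, by rw [h11]; exact Nat.zero_le _, by simp⟩
  have hμ : remaining n τ k p (σ₂.reg 15) (σ₂.arr 11) =
      1 + subtree (eventItems n k p τ).length k * (allItems n τ k p).length := by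
    rw [h15, remaining, Finset.sum_range_one, h11]
    rfl
  rw [← hμ]
  refine (Runs.loop (SearchInv n τ s z k m p)
    (fun σ' => remaining n τ k p (σ'.reg 15) (σ'.arr 11)) ?_ hinit).mono le_rfl ?_
  · intro σ₃ h₃ hne
    obtain ⟨lev, hlev⟩ : ∃ lev, σ₃.reg 15 = lev + 1 := Nat.exists_eq_succ_of_ne_zero hne
    refine Runs.seq (testMarks_runs hw h₃ hlen hsz hlev) ?_
    rintro σ₄ hf₄ ⟨h1, h2, h3, h4⟩
    have h15₄ : σ₄.reg 15 = σ₃.reg 15 := hf₄.reg 15 rfl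
    have h11₄ : σ₄.arr 11 = σ₃.arr 11 := hf₄.arr 11 rfl
    rw [← h15₄, ← h11₄]
    exact nextNode_runs hw hτ h1 (h15₄.trans hlev) h2 h3 h4
  · rintro σ₃ - ⟨h₃, hzero⟩
    refine ⟨fun h => ?_, fun h => ?_⟩
    · obtain ⟨a, j, ha⟩ := exists_isTarget hp hz h
      rcases h₃.complete a j ha with h' | ⟨r, hr, -⟩ | ⟨hj, -⟩
      · exact h'
      · rw [show σ₃.reg 15 = 0 from hzero] at hr
        omega
      · rw [show σ₃.reg 15 = 0 from hzero] at hj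
        omega
    · rcases h₃.sound with h' | h'
      · exact h'
      · exact absurd h'.2 h

/-! ### The complete program -/

/-- The program that decides Temporal `(s, z)`-Separation on temporal permutation graphs. If there
is no event, then the layers are equal, and the factor `d_Σ` of the time bound may vanish; hence
    this
case is decided without branching. -/
def solve : Program :=
  readHeader ;; readEdges ;; computePositions ;; listVertices ;; listEdges ;; listEventItems ;;
    .ite (.reg 8) (listInitialItems ;; search) scanStatic

/-- The time bound of the preprocessing for `M` items. -/
def prepareTime (n τ m M : ℕ) : ℕ :=
  100 + ((m * 100 + 6) + ((τ * (n * (n * 100 + 100) + 100) + 6) +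
    ((n * (τ * (n * 100 + 100) + 100) + 100) + ((τ * (n * (n * 100 + 100) + 100) + 100) +
      (τ * ((n + 1) * (n * 100 + 100) + 100) + 100 + M * 100)))))

/-- The time bound of the search with `M` items for events, `v` vertices and `e` edges. -/
def searchTime (n k M v e : ℕ) : ℕ :=
  (n + 1) * ((2 * k + 1) * 100) + 100 +
    ((1 + subtree M k * (M + (n + 1) * (2 * k + 1))) * (v * 120 + e * 60 + 302) + 10)

theorem no_event_of_eventItems_eq_nil {n τ k : ℕ} {p : ℕ → ℕ → ℕ}
    (h : (eventItems n k p τ).length = 0) : ∀ t < τ, ∀ c ≤ n, ¬ IsEvent n p t c := by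
  intro t ht c hc hev
  have := mem_eventItems (τ := τ) (k := k) (e := (t, c, c)) ⟨ht, hc, 0, by omega, rfl⟩ hev
  rw [List.length_eq_zero_iff.mp h] at this
  simp at this

/-- The program in terms of the arrays that hold the input. The layers are given by `p` with respect
to the new numbers of the vertices. -/
theorem solve_runs {w n τ k m s z : ℕ} (hw : Fits w n τ k m) (hτ : 1 ≤ τ) {σ : State}
    {p : ℕ → ℕ → ℕ} (hp : ∀ t < τ, IsPermOn n (p t)) {flip : Bool} (hflip : flip = decide (z < s))
    (hlen : (edgeList n p τ).length < 2 ^ w)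
    (h0 : σ.arr 0 0 = n) (h1 : σ.arr 0 1 = τ) (h2 : σ.arr 0 2 = s) (h3 : σ.arr 0 3 = z)
    (h4 : σ.arr 0 4 = k) (h5 : σ.arr 0 5 = m) (hreg : ∀ x, σ.reg x = 0)
    (harr : ∀ a i, a ≠ 0 → σ.arr a i = 0)
    {a b t : ℕ → ℕ} (ha : ∀ i < m, σ.arr 0 (3 * i + 6) = a i ∧ a i < n)
    (hb : ∀ i < m, σ.arr 0 (3 * i + 7) = b i ∧ b i < n)
    (ht : ∀ i < m, σ.arr 0 (3 * i + 8) = t i ∧ t i < τ)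
    (hedge : ∀ x < τ, ∀ u < n, ∀ v < n, Inverts (p x) u v ↔ ∃ i < m, t i = x ∧
      ((renumber n flip (a i) = u ∧ renumber n flip (b i) = v) ∨
        (renumber n flip (a i) = v ∧ renumber n flip (b i) = u)))
    (hsz : renumber n flip s < renumber n flip z) (hz : renumber n flip z < n) :
    Runs w solve σ (prepareTime n τ m (eventItems n k p τ).length + (2 +
      if (eventItems n k p τ).length = 0 then n * (n * 100 + 100) + 100 else
        searchTime n k (eventItems n k p τ).length (vertexList n τ p n).length
          (edgeList n p τ).length)) fun σ' =>
      (HasBarrier n τ (renumber n flip s) (renumber n flip z) k p → σ'.reg 0 = 1) ∧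
        (¬ HasBarrier n τ (renumber n flip s) (renumber n flip z) k p → σ'.reg 0 = 0) := by
  generalize hB : (if (eventItems n k p τ).length = 0 then n * (n * 100 + 100) + 100 else
    searchTime n k (eventItems n k p τ).length (vertexList n τ p n).length
      (edgeList n p τ).length) = B
  refine Runs.mono (B := 100 + ((m * 100 + 6) + ((τ * (n * (n * 100 + 100) + 100) + 6) +
    ((n * (τ * (n * 100 + 100) + 100) + 100) + ((τ * (n * (n * 100 + 100) + 100) + 100) +
      ((τ * ((n + 1) * (n * 100 + 100) + 100) + 100 + (eventItems n k p τ).length * 100) +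
        (1 + 1 + B)))))))
    (Runs.seq (readHeader_runs hw h0 h1 h2 h3 h4 h5 (hreg 7)) ?_)
    (by rw [prepareTime]; omega) fun _ _ h => h
  rintro σ₁ hf₁ ⟨hh₁, h7⟩
  rw [← hflip] at hh₁
  generalize renumber n flip s = s' at *
  generalize renumber n flip z = z' at *
  refine Runs.seq (readEdges_runs (flip := flip) hw hh₁ (by rw [h7, hflip]; simp)
    (fun i hi => by rw [hf₁.arr 0 rfl]; exact ha i hi) (fun i hi =>
      by rw [hf₁.arr 0 rfl]; exact hb i hi)
    (fun i hi => by rw [hf₁.arr 0 rfl]; exact ht i hi) hedge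
    (fun i => by rw [hf₁.arr 1 rfl]; exact harr 1 i (by decide))) fun σ₂ hf₂ hadj => ?_
  have hh₂ := hh₁.frame hf₂ rfl
  refine Runs.seq (computePositions_runs hw hh₂ hp hadj) fun σ₃ hf₃ hpos => ?_
  have hh₃ := hh₂.frame hf₃ rfl
  have hadj₃ : HoldsAdj n τ p σ₃ := by
    unfold HoldsAdj
    rw [hf₃.arr 1 rfl]
    exact hadj
  refine Runs.seq (listVertices_runs hw hh₃ hadj₃) fun σ₄ hf₄ hV => ?_
  have hh₄ := hh₃.frame hf₄ rfl
  have hadj₄ : HoldsAdj n τ p σ₄ := by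
    unfold HoldsAdj
    rw [hf₄.arr 1 rfl]
    exact hadj₃
  refine Runs.seq (listEdges_runs hw hh₄ hadj₄) fun σ₅ hf₅ hE => ?_
  have hh₅ := hh₄.frame hf₅ rfl
  have hpos₅ : HoldsPos n τ p σ₅ := by
    unfold HoldsPos
    rw [hf₅.arr 2 rfl, hf₄.arr 2 rfl]
    exact hpos
  refine Runs.seq (listEventItems_runs hw hh₅ hpos₅) fun σ₆ hf₆ hI => ?_
  have hh₆ := hh₅.frame hf₆ rfl
  have hpos₆ : HoldsPos n τ p σ₆ := by
    unfold HoldsPos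
    rw [hf₆.arr 2 rfl]
    exact hpos₅
  have h0₆ : σ₆.reg 0 = 0 := by
    rw [hf₆.reg 0 rfl, hf₅.reg 0 rfl, hf₄.reg 0 rfl, hf₃.reg 0 rfl, hf₂.reg 0 rfl, hf₁.reg 0 rfl,
      hreg]
  have h8 : Expr.eval w σ₆ (.reg 8) = (eventItems n k p τ).length := hI.1
  refine Runs.ite ?_ ?_
  · intro hne
    rw [h8] at hne
    rw [if_neg hne] at hB
    subst hB
    refine Runs.seq (listInitialItems_runs hw hh₆ hI) ?_
    rintro σ₇ hf₇ ⟨hI₇, h14⟩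
    have hall : (allItems n τ k p).length =
        (eventItems n k p τ).length + (n + 1) * (2 * k + 1) := by
      rw [allItems, List.length_append, length_initialItems]
    rw [← hall]
    have hV₇ : HoldsVertices σ₇ (vertexList n τ p n) := by
      unfold HoldsVertices
      rw [hf₇.reg 10 rfl, hf₇.arr 13 rfl, hf₆.reg 10 rfl, hf₆.arr 13 rfl, hf₅.reg 10 rfl,
        hf₅.arr 13 rfl]
      exact hV
    have hE₇ : HoldsEdges σ₇ (edgeList n p τ) := by
      unfold HoldsEdges
      rw [hf₇.reg 13 rfl, hf₇.arr 3 rfl, hf₇.arr 4 rfl, hf₆.reg 13 rfl, hf₆.arr 3 rfl,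
        hf₆.arr 4 rfl]
      exact hE
    have hpos₇ : HoldsPos n τ p σ₇ := by
      unfold HoldsPos
      rw [hf₇.arr 2 rfl]
      exact hpos₆
    refine search_runs hw hτ ⟨hh₆.frame hf₇ rfl, hpos₇, hV₇, hE₇, hI₇, h14⟩ hlen hp hsz hz
      (by rw [hf₇.reg 0 rfl, h0₆]) fun x => ?_
    rw [hf₇.arr 10 rfl, hf₆.arr 10 rfl, hf₅.arr 10 rfl, hf₄.arr 10 rfl, hf₃.arr 10 rfl,
      hf₂.arr 10 rfl, hf₁.arr 10 rfl, harr 10 x (by decide)]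
  · intro heq
    rw [h8] at heq
    rw [if_pos heq] at hB
    subst hB
    refine (scanStatic_runs hw hh₆ hpos₆ hτ hp (hsz.trans hz) hz h0₆).mono le_rfl ?_
    rintro σ' - ⟨h, h'⟩
    rw [← hasBarrier_iff_of_no_event hp hτ hz (no_event_of_eventItems_eq_nil heq)] at h'
    refine ⟨fun hbar => ?_, fun hbar => ?_⟩
    · have := h'.mpr hbar
      omega
    · by_contra hne
      exact hbar (h'.mp hne)

/-! ### The running time -/

/-- The strict inequality makes the induction work. -/
theorem subtree_lt {M j : ℕ} (hM : 3 ≤ M) : subtree M (j + 1) < 3 * M ^ j := by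
  induction j with
  | zero => simp [subtree]
  | succ j ih =>
    rw [subtree, pow_succ]
    nlinarith [Nat.mul_le_mul_left M ih]

theorem prepareTime_le {n τ m M : ℕ} (hn : 2 ≤ n) (hτ : 1 ≤ τ) (hm : m ≤ τ * n ^ 2) :
    prepareTime n τ m M ≤ 3000 * (τ * n ^ 2) + 100 * M := by
  have h1 : τ ≤ τ * n := Nat.le_mul_of_pos_right _ (by omega)
  have h2 : τ * n ≤ τ * n * n := Nat.le_mul_of_pos_right _ (by omega)
  have h3 : n ≤ τ * n := Nat.le_mul_of_pos_left _ (by omega)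
  rw [prepareTime]
  ring_nf at *
  omega

/-- The time of the search is dominated by the number of nodes of the search tree times the number
of time-edges. -/
theorem searchTime_le {n τ k M v e E D : ℕ} (hn : 2 ≤ n) (hτ : 1 ≤ τ) (hE : 1 ≤ E)
    (hEn : E ≤ τ * n ^ 2) (hM : 2 * k + 1 ≤ M) (hMD : M ≤ D) (hv : v ≤ 2 * E) (he : e ≤ E) :
    searchTime n k M v e ≤ 10000 * (D ^ k * n * E + τ * n ^ 2) := by
  have hnY : n + 2 ≤ 2 * (τ * n ^ 2) := by nlinarith [Nat.mul_le_mul hτ (le_refl (n ^ 2))]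
  have hc : v * 120 + e * 60 + 302 ≤ 602 * E := by omega
  rcases k with _ | j
  · rw [searchTime, subtree]
    have := Nat.zero_le (D ^ 0 * n * E)
    omega
  · have hM3 : 3 ≤ M := by omega
    have hN : M + (n + 1) * (2 * (j + 1) + 1) ≤ 3 * (n * M) := by
      have := Nat.mul_le_mul_left (n + 1) hM
      nlinarith
    have hP : n * M ≤ M ^ (j + 1) * n := by
      rw [pow_succ]
      have : 1 * (M * n) ≤ M ^ j * (M * n) := Nat.mul_le_mul_right _ (Nat.one_le_pow _ _ (by omega))
      nlinarith
    have hP1 : 1 ≤ M ^ (j + 1) * n := Nat.mul_pos (Nat.pow_pos (by omega)) (by omega)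
    have hsub : subtree M (j + 1) * (M + (n + 1) * (2 * (j + 1) + 1)) ≤ 9 * (M ^ (j + 1) * n) := by
      calc _ ≤ (3 * M ^ j) * (3 * (n * M)) := Nat.mul_le_mul (subtree_lt hM3).le hN
        _ = _ := by ring
    have hW : M ^ (j + 1) * n * E ≤ D ^ (j + 1) * n * E := by gcongr
    have h1 : (1 + subtree M (j + 1) * (M + (n + 1) * (2 * (j + 1) + 1))) *
        (v * 120 + e * 60 + 302) ≤ (10 * (M ^ (j + 1) * n)) * (602 * E) :=
      Nat.mul_le_mul (by omega) hc
    have h2 : M ^ (j + 1) * n ≤ M ^ (j + 1) * n * E := Nat.le_mul_of_pos_right _ hE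
    have h3 : (10 * (M ^ (j + 1) * n)) * (602 * E) = 6020 * (M ^ (j + 1) * n * E) := by ring
    have h4 : (n + 1) * ((2 * (j + 1) + 1) * 100) = 100 * ((n + 1) * (2 * (j + 1) + 1)) := by ring
    rw [searchTime, h4]
    omega

/-- The fifth power exceeds all numbers that occur, the largest of which are of the order `τ * n *
    k`
and `τ * n ^ 2`. -/
theorem fits_of_pow_le {w n τ k m : ℕ} (hn : 2 ≤ n) (hτ : 1 ≤ τ)
    (h : (n + τ + k + m) ^ 5 ≤ 2 ^ w) : Fits w n τ k m := by
  obtain ⟨X, hX⟩ : ∃ X, X = n + τ + k + m := ⟨_, rfl⟩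
  rw [← hX] at h
  have hX3 : 3 ≤ X := by omega
  have h3 : X ^ 3 < X ^ 5 := Nat.pow_lt_pow_right (by omega) (by omega)
  have h4 : X ^ 4 < X ^ 5 := Nat.pow_lt_pow_right (by omega) (by omega)
  have h2 : X ^ 2 < X ^ 5 := Nat.pow_lt_pow_right (by omega) (by omega)
  refine ⟨?_, ?_, ?_⟩
  · have : τ * n * n ≤ X * X * X := by gcongr <;> omega
    have : X * X * X = X ^ 3 := by ring
    omega
  · have : (τ + 1) * (n + 1) * (2 * k + 1) ≤ X * X * (X * X) := by
      gcongr
      · omega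
      · omega
      · nlinarith
    have : X * X * (X * X) = X ^ 4 := by ring
    omega
  · have : 3 * X ≤ X ^ 2 := by nlinarith
    omega

/-! ### The numbers of edges and of non-isolated vertices -/

section Instance

variable {n τ m : ℕ} {p : ℕ → ℕ → ℕ} {a b t : ℕ → ℕ}

theorem length_le_of_subset_image {α : Type*} [DecidableEq α] {L : List α} (hL : L.Nodup)
    {f : ℕ → α} {M : ℕ} (h : ∀ x ∈ L, ∃ i < M, f i = x) : L.length ≤ M := by
  rw [← List.toFinset_card_of_nodup hL, ← Finset.card_range M]
  refine (Finset.card_le_card (t := (Finset.range M).image f) fun x hx => ?_).trans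
    Finset.card_image_le
  obtain ⟨i, hi, rfl⟩ := h x (List.mem_toFinset.mp hx)
  exact Finset.mem_image_of_mem f (Finset.mem_range.mpr hi)

theorem length_edgeList_le (hedge : ∀ x < τ, ∀ u < n, ∀ v < n, Inverts (p x) u v →
    ∃ i < m, t i = x ∧ ((a i = u ∧ b i = v) ∨ (a i = v ∧ b i = u))) :
    (edgeList n p τ).length ≤ m := by
  refine length_le_of_subset_image edgeList_nodup
    (f := fun i => (t i, min (a i) (b i), max (a i) (b i))) ?_
  rintro ⟨x, u, v⟩ h
  rw [mem_edgeList] at h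
  obtain ⟨h1, h2, h3, h4⟩ := h
  obtain ⟨i, hi, rfl, h⟩ := hedge x h1 u (by omega) v h3 (.inl ⟨h2, h4⟩)
  refine ⟨i, hi, ?_⟩
  simp only [Prod.mk.injEq, true_and]
  omega

theorem length_vertexList_le_two_mul (hedge : ∀ x < τ, ∀ u < n, ∀ v < n, Inverts (p x) u v →
    ∃ i < m, t i = x ∧ ((a i = u ∧ b i = v) ∨ (a i = v ∧ b i = u))) :
    (vertexList n τ p n).length ≤ 2 * m := by
  refine length_le_of_subset_image vertexList_nodup
    (f := fun i => if i < m then a i else b (i - m)) ?_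
  intro u h
  rw [mem_vertexList] at h
  obtain ⟨h1, x, hx, v, hv, h⟩ := h
  obtain ⟨i, hi, -, h | h⟩ := hedge x (Finset.mem_range.mp hx) u h1 v (Finset.mem_range.mp hv) h
  · exact ⟨i, by omega, by simp [hi, h.1]⟩
  · exact ⟨m + i, by omega, by simp [h.2]⟩

end Instance

/-! ### Events and the Kendall tau distance -/

theorem renumber_lt {n : ℕ} {flip : Bool} {x : ℕ} (hx : x < n) : renumber n flip x < n := by
  unfold renumber
  split_ifs <;> omega

theorem renumber_renumber {n : ℕ} {flip : Bool} {x : ℕ} (hx : x < n) :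
    renumber n flip (renumber n flip x) = x := by
  unfold renumber
  split_ifs <;> omega

/-- The position of the vertex with the new number `x` in the order of layer `t`; if the vertices
    are
renumbered in reverse order, then so are the positions. -/
def position {n τ : ℕ} (π : Fin τ → Equiv.Perm (Fin n)) (flip : Bool) (t x : ℕ) : ℕ :=
  if h : t < τ ∧ x < n then renumber n flip (π ⟨t, h.1⟩ ⟨renumber n flip x, renumber_lt h.2⟩) else 0

section

variable {n τ : ℕ} (π : Fin τ → Equiv.Perm (Fin n)) (flip : Bool)

theorem position_renumber (t : Fin τ) (a : Fin n) :
    position π flip t (renumber n flip a) = renumber n flip (π t a) := by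
  rw [position, dif_pos ⟨t.2, renumber_lt a.2⟩]
  simp only [renumber_renumber a.2, Fin.eta]

theorem exists_renumber {x : ℕ} (hx : x < n) : ∃ a : Fin n, renumber n flip a = x :=
  ⟨⟨renumber n flip x, renumber_lt hx⟩, renumber_renumber hx⟩

theorem renumber_injective : Function.Injective fun a : Fin n => renumber n flip a := by
  intro a b h
  have := congrArg (renumber n flip) h
  simp only [renumber_renumber a.2, renumber_renumber b.2] at this
  exact Fin.ext this

theorem isPermOn_position {t : ℕ} (ht : t < τ) : IsPermOn n (position π flip t) := by
  constructor
  · intro x hx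
    obtain ⟨a, rfl⟩ := exists_renumber flip hx
    rw [position_renumber π flip ⟨t, ht⟩]
    exact renumber_lt (Fin.is_lt _)
  · intro x hx y hy h
    obtain ⟨a, rfl⟩ := exists_renumber flip hx
    obtain ⟨b, rfl⟩ := exists_renumber flip hy
    rw [position_renumber π flip ⟨t, ht⟩, position_renumber π flip ⟨t, ht⟩] at h
    rw [(π ⟨t, ht⟩).injective (renumber_injective flip h)]

theorem inverts_position (t : Fin τ) (a b : Fin n) :
    Inverts (position π flip t) (renumber n flip a) (renumber n flip b) ↔
      (a < b ∧ π t b < π t a) ∨ (b < a ∧ π t a < π t b) := by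
  rw [Inverts, position_renumber, position_renumber]
  have h1 := a.2
  have h2 := b.2
  have h3 := (π t a).2
  have h4 := (π t b).2
  simp only [Fin.lt_def]
  unfold renumber
  split_ifs <;> omega

/-- The layers `t` and `t + 1` have no more events than pairs that are ordered differently. -/
theorem card_isEvent_le_kendallTau {t : ℕ} (ht : t + 1 < τ) :
    ((Finset.range (n + 1)).filter fun c => IsEvent n (position π flip) (t + 1) c).card ≤
      kendallTau (π ⟨t, by omega⟩) (π ⟨t + 1, ht⟩) := by
  refine (card_isEvent_le (isPermOn_position π flip (by omega))
    (isPermOn_position π flip ht)).trans ?_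
  refine (Finset.card_le_card (t := (Finset.univ.filter fun e : Fin n × Fin n => e.1 < e.2 ∧
    ¬ (π ⟨t, by omega⟩ e.1 < π ⟨t, by omega⟩ e.2 ↔ π ⟨t + 1, ht⟩ e.1 < π ⟨t + 1, ht⟩ e.2)).image
    fun e => if flip then (renumber n flip e.2, renumber n flip e.1) else
      (renumber n flip e.1, renumber n flip e.2)) ?_).trans Finset.card_image_le
  rintro ⟨x, y⟩ hxy
  simp only [Finset.mem_filter, Finset.mem_product, Finset.mem_range] at hxy
  obtain ⟨⟨hx, hy⟩, hlt, h⟩ := hxy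
  obtain ⟨a, rfl⟩ := exists_renumber flip hx
  obtain ⟨b, rfl⟩ := exists_renumber flip hy
  rw [inverts_position π flip ⟨t, by omega⟩, inverts_position π flip ⟨t + 1, ht⟩] at h
  have hne : a ≠ b := by rintro rfl; omega
  have h1 := (π ⟨t, by omega⟩).injective.ne hne
  have h2 := (π ⟨t + 1, ht⟩).injective.ne hne
  simp only [Finset.mem_image, Finset.mem_filter, Finset.mem_univ, true_and, Prod.exists]
  rw [renumber, renumber] at hlt
  cases flip
  · have hab : a < b := by simpa using hlt
    refine ⟨a, b, ⟨hab, ?_⟩, rfl⟩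
    generalize π ⟨t, by omega⟩ a = q1, π ⟨t, by omega⟩ b = q2, π ⟨t + 1, ht⟩ a = q3,
      π ⟨t + 1, ht⟩ b = q4 at *
    omega
  · have hab : b < a := by
      simp only [if_true] at hlt
      omega
    refine ⟨b, a, ⟨hab, ?_⟩, rfl⟩
    generalize π ⟨t, by omega⟩ a = q1, π ⟨t, by omega⟩ b = q2, π ⟨t + 1, ht⟩ a = q3,
      π ⟨t + 1, ht⟩ b = q4 at *
    omega

theorem length_eventItems_le_kendallTauSum (k : ℕ) :
    (eventItems n k (position π flip) τ).length ≤ kendallTauSum π * (2 * k + 1) := by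
  rw [length_eventItems]
  rcases τ with _ | τ
  · simp
  have hrow : ∀ t, (eventRow n k (position π flip) t (n + 1)).length =
      ((Finset.range (n + 1)).filter fun c => IsEvent n (position π flip) t c).card *
        (2 * k + 1) := by
    intro t
    rw [length_eventRow, ← Finset.sum_filter, Finset.sum_const, smul_eq_mul]
  have h0 : ((Finset.range (n + 1)).filter fun c => IsEvent n (position π flip) 0 c) = ∅ := by
    refine Finset.filter_eq_empty_iff.mpr fun c _ h => ?_
    obtain ⟨x, -, h⟩ := h
    exact h Iff.rfl
  rw [Finset.sum_range_succ', hrow 0, h0, Finset.card_empty, Nat.zero_mul, Nat.add_zero,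
    kendallTauSum, Fin.sum_univ_castSucc, Finset.sum_range, Nat.add_mul, Finset.sum_mul]
  refine (Finset.sum_le_sum fun t _ => ?_).trans (Nat.le_add_right _ _)
  rw [hrow, dif_pos (by simp)]
  exact Nat.mul_le_mul_right _ (card_isEvent_le_kendallTau π flip (t := t) (by omega))

end

/-- If there is an event, then there are at least `2 * k + 1` items and at least one time-edge: an
event changes the order of some pair, which is inverted in one of the two layers. -/
theorem one_le_of_eventItems_ne_nil {n τ k m : ℕ} {p : ℕ → ℕ → ℕ} {Q : ℕ → ℕ → ℕ → ℕ → Prop}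
    (hp : ∀ t < τ, IsPermOn n (p t)) (h : (eventItems n k p τ).length ≠ 0)
    (hedge : ∀ x < τ, ∀ u < n, ∀ v < n, Inverts (p x) u v → ∃ i < m, Q x u v i) :
    2 * k + 1 ≤ (eventItems n k p τ).length ∧ 1 ≤ m := by
  obtain ⟨e, he⟩ := List.exists_mem_of_length_pos (Nat.pos_of_ne_zero h)
  obtain ⟨t, ht, he⟩ := List.mem_flatMap.mp he
  obtain ⟨c, hc, he⟩ := List.mem_flatMap.mp he
  rw [List.mem_range] at ht hc
  split_ifs at he with hev
  swap
  · simp at he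
  constructor
  · calc 2 * k + 1 = if IsEvent n p t c then 2 * k + 1 else 0 := (if_pos hev).symm
      _ ≤ (eventRow n k p t (n + 1)).length := by
        rw [length_eventRow]
        exact Finset.single_le_sum (f := fun c => if IsEvent n p t c then 2 * k + 1 else 0)
          (fun _ _ => Nat.zero_le _) (Finset.mem_range.mpr hc)
      _ ≤ _ := by
        rw [length_eventItems]
        exact Finset.single_le_sum (f := fun t => (eventRow n k p t (n + 1)).length)
          (fun _ _ => Nat.zero_le _) (Finset.mem_range.mpr ht)
  · rcases t with _ | t
    · obtain ⟨x, -, hx⟩ := hev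
      exact absurd Iff.rfl hx
    have hpos := (Finset.card_pos.mpr ⟨c, Finset.mem_filter.mpr ⟨Finset.mem_range.mpr hc,
      hev⟩⟩).trans_le
      (card_isEvent_le (hp t (by omega)) (hp (t + 1) ht))
    obtain ⟨⟨u, v⟩, h⟩ := Finset.card_pos.mp hpos
    simp only [Finset.mem_filter, Finset.mem_product, Finset.mem_range] at h
    obtain ⟨⟨hu, hv⟩, -, h⟩ := h
    have : ∃ x < τ, Inverts (p x) u v := by
      by_cases h1 : Inverts (p t) u v
      · exact ⟨t, by omega, h1⟩
      · exact ⟨t + 1, ht, by_contra fun h2 => h (iff_of_false h1 h2)⟩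
    obtain ⟨x, hx, hI⟩ := this
    obtain ⟨i, hi, -⟩ := hedge x hx u hu v hv hI
    omega

/-! ### The encoding -/

theorem getD_flatMap_triple {α : Type*} (f g h : α → ℕ) (l : List α) {i : ℕ} (hi : i < l.length) :
    (l.flatMap fun e => [f e, g e, h e]).getD (3 * i) 0 = f l[i] ∧
      (l.flatMap fun e => [f e, g e, h e]).getD (3 * i + 1) 0 = g l[i] ∧
      (l.flatMap fun e => [f e, g e, h e]).getD (3 * i + 2) 0 = h l[i] := by
  induction l generalizing i with
  | nil => simp at hi
  | cons e l ih =>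
    rw [List.flatMap_cons]
    rcases i with _ | i
    · simp
    · have := ih (i := i) (by simpa using hi)
      simpa [Nat.mul_add] using this

/-- Correctness and running time of the program. -/
theorem solve_correct {n τ : ℕ} {G : TemporalGraph (Fin n) τ} {π : Fin τ → Equiv.Perm
    (Fin n)} {s z : Fin n}
    {k : ℕ} {l : List (Fin n × Fin n × Fin τ)} {w : ℕ} (hτ : 1 ≤ τ) (hπ : G.IsPermutationGraphOf π)
    (hsz : s ≠ z) (hl : G.IsEdgeList l) (hw : (n + τ + k + G.edges.card) ^ 5 ≤ 2 ^ w) :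
    Runs w solve (initState (encodeInstance l s z k))
      (20000 * ((kendallTauSum π * (2 * k + 1)) ^ k * n * G.edges.card + τ * n ^ 2)) fun σ =>
      (G.HasSeparatorOfSize s z k → σ.reg 0 = 1) ∧ (¬ G.HasSeparatorOfSize s z k → σ.reg 0 = 0) :=
        by
  have hsz' : (s : ℕ) ≠ z := fun h => hsz (Fin.ext h)
  have hn : 2 ≤ n := by omega
  obtain ⟨hnd, hmem⟩ := hl
  have hcard : G.edges.card = l.length := by
    rw [← List.length_map (as := l) (fun e => (s(e.1, e.2.1), e.2.2)),
      ← List.toFinset_card_of_nodup hnd]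
    congr 1
    ext x
    rw [List.mem_toFinset, hmem]
  rw [hcard] at hw ⊢
  have hfits := fits_of_pow_le hn hτ hw
  have hin := hfits.input
  have hm : l.length ≤ τ * n ^ 2 := by
    rw [← List.toFinset_card_of_nodup (List.Nodup.of_map _ hnd)]
    refine (Finset.card_le_univ _).trans (le_of_eq ?_)
    simp only [Fintype.card_prod, Fintype.card_fin]
    ring
  obtain ⟨flip, hflip⟩ : ∃ flip, flip = decide ((z : ℕ) < s) := ⟨_, rfl⟩
  have hG : ∀ (t : Fin τ) (a b : Fin n), (s(a, b), t) ∈ G.edges ↔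
      Inverts (position π flip t) (renumber n flip a) (renumber n flip b) := by
    intro t a b
    rw [inverts_position]
    rcases lt_trichotomy a b with h | rfl | h
    · rw [hπ t a b h]
      simp [h, h.not_gt]
    · refine iff_of_false (fun h => G.loopless _ h rfl) ?_
      simp
    · rw [Sym2.eq_swap, hπ t b a h]
      simp [h, h.not_gt]
  have hlt : renumber n flip s < renumber n flip z := by
    have h1 := s.2
    have h2 := z.2
    rw [hflip]
    unfold renumber
    by_cases h : (z : ℕ) < s <;> simp [h] <;> omega
  have hsep := hasSeparatorOfSize_iff (p := position π flip) (φ := fun a => renumber n flip a) hG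
    (renumber_injective flip) (fun a => renumber_lt a.2) (fun y hy =>
      exists_renumber flip hy) hτ hlt k
  -- The components of the members of the edge list, with `0` beyond its end.
  let a : ℕ → ℕ := fun i => if h : i < l.length then l[i].1 else 0
  let b : ℕ → ℕ := fun i => if h : i < l.length then l[i].2.1 else 0
  let t : ℕ → ℕ := fun i => if h : i < l.length then l[i].2.2 else 0
  have ha : ∀ i (h : i < l.length), a i = l[i].1 := fun i h => dif_pos h
  have hb : ∀ i (h : i < l.length), b i = l[i].2.1 := fun i h => dif_pos h
  have ht : ∀ i (h : i < l.length), t i = l[i].2.2 := fun i h => dif_pos h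
  have hedge : ∀ x < τ, ∀ u < n, ∀ v < n, Inverts (position π flip x) u v ↔ ∃ i < l.length,
      t i = x ∧ ((renumber n flip (a i) = u ∧ renumber n flip (b i) = v) ∨
        (renumber n flip (a i) = v ∧ renumber n flip (b i) = u)) := by
    intro x hx u hu v hv
    obtain ⟨u, rfl⟩ := exists_renumber flip hu
    obtain ⟨v, rfl⟩ := exists_renumber flip hv
    rw [← hG ⟨x, hx⟩ u v, ← hmem, List.mem_map]
    have hinj : ∀ c d : Fin n, renumber n flip c = renumber n flip d ↔ c = d := fun c d =>
      (renumber_injective flip).eq_iff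
    constructor
    · rintro ⟨e, he, h⟩
      obtain ⟨i, hi, rfl⟩ := List.getElem_of_mem he
      rw [Prod.mk.injEq, Sym2.eq_iff] at h
      refine ⟨i, hi, by rw [ht i hi, h.2], ?_⟩
      rw [ha i hi, hb i hi, hinj, hinj, hinj, hinj]
      exact h.1
    · rintro ⟨i, hi, h1, h2⟩
      rw [ha i hi, hb i hi, hinj, hinj, hinj, hinj] at h2
      rw [ht i hi] at h1
      refine ⟨l[i], List.getElem_mem hi, ?_⟩
      rw [Prod.mk.injEq, Sym2.eq_iff]
      exact ⟨h2, Fin.ext h1⟩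
  have hEl := length_edgeList_le fun x hx u hu v hv => (hedge x hx u hu v hv).mp
  have hVl := length_vertexList_le_two_mul fun x hx u hu v hv => (hedge x hx u hu v hv).mp
  have harr0 : ∀ i, (initState (encodeInstance l s z k)).arr 0 i =
      (encodeInstance l s z k).getD i 0 := fun i => rfl
  have hentry : ∀ i, (hi : i < l.length) → (encodeInstance l s z k).getD (3 * i + 6) 0 = a i ∧
      (encodeInstance l s z k).getD (3 * i + 7) 0 = b i ∧
      (encodeInstance l s z k).getD (3 * i + 8) 0 = t i := by
    intro i hi
    rw [ha i hi, hb i hi, ht i hi]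
    exact getD_flatMap_triple (fun e : Fin n × Fin n × Fin τ => (e.1 : ℕ)) (fun e => (e.2.1 : ℕ))
      (fun e => (e.2.2 : ℕ)) l hi
  have hrun := solve_runs (σ := initState (encodeInstance l s z k)) (p := position π flip)
    (a := a) (b := b) (t := t) hfits hτ (fun t ht => isPermOn_position π flip ht) hflip (by omega)
    rfl rfl rfl rfl rfl rfl (fun _ => rfl) (fun c i hc => if_neg hc)
    (fun i hi => ⟨(hentry i hi).1, by rw [ha i hi]; exact Fin.is_lt _⟩)
    (fun i hi => ⟨(hentry i hi).2.1, by rw [hb i hi]; exact Fin.is_lt _⟩)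
    (fun i hi => ⟨(hentry i hi).2.2, by rw [ht i hi]; exact Fin.is_lt _⟩) hedge hlt
      (renumber_lt z.2)
  refine hrun.mono ?_ fun σ' _ h => by rwa [hsep]
  have hM := length_eventItems_le_kendallTauSum π flip k
  have hMn := length_eventItems_le n k (position π flip) τ
  have hprep := prepareTime_le (M := (eventItems n k (position π flip) τ).length) hn hτ hm
  have hnY : n * n ≤ τ * n ^ 2 := by nlinarith [Nat.mul_le_mul hτ (le_refl (n ^ 2))]
  have hnY' : 2 * n ≤ n * n := Nat.mul_le_mul_right _ hn
  split_ifs with hM0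
  · have h1 := Nat.zero_le ((kendallTauSum π * (2 * k + 1)) ^ k * n * l.length)
    rw [Nat.mul_add n, ← Nat.mul_assoc n n]
    omega
  · obtain ⟨hM1, hE⟩ := one_le_of_eventItems_ne_nil (p := position π flip)
      (fun x hx => isPermOn_position π flip hx) hM0
      fun x hx u hu v hv h => (hedge x hx u hu v hv).mp h
    have hsearch := searchTime_le hn hτ hE hm hM1 hM hVl hEl
    have hMle : (eventItems n k (position π flip) τ).length ≤
        (kendallTauSum π * (2 * k + 1)) ^ k * n * l.length + 2 * (τ * n ^ 2) := by
      rcases k with _ | k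
      · have : τ * (n + 1) ≤ 2 * (τ * n ^ 2) := by nlinarith
        omega
      · refine le_trans ?_ (Nat.le_add_right _ _)
        rw [Nat.mul_assoc]
        refine (hM.trans (Nat.le_self_pow (by omega) _)).trans (Nat.le_mul_of_pos_right _ ?_)
        exact Nat.mul_pos (by omega) hE
    omega

end TemporalPermutation

/-- There is one program `P` with the following property, for absolute constants `c` and `C`. Given any
temporal permutation graph by its list of time-edges (without its permutations), two distinct
vertices `s`, `z` and a number `k`, on a machine whose words have at least
`c * log₂ (n + τ + k + |E|)` bits, `P` stops within the stated time, with `1` in register `0` if there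
is a temporal `(s, z)`-separator of size at most `k`, and with `0` there otherwise. -/
theorem mainTheorem4 :
    ∃ (P : WordRAM.Program) (c C : ℕ),
      ∀ (n τ : ℕ) (G : TemporalGraph (Fin n) τ) (π : Fin τ → Equiv.Perm (Fin n)) (s z : Fin n)
        (k : ℕ) (l : List (Fin n × Fin n × Fin τ)) (w : ℕ),
        1 ≤ τ → G.IsPermutationGraphOf π → s ≠ z → G.IsEdgeList l →
        (n + τ + k + G.edges.card) ^ c ≤ 2 ^ w →
        ∃ (T : ℕ) (σ : WordRAM.State),
          WordRAM.Exec w P (WordRAM.initState (encodeInstance l s z k)) T σ ∧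
          T ≤ C * ((kendallTauSum π * (2 * k + 1)) ^ k * n * G.edges.card + τ * n ^ 2) ∧
          (G.HasSeparatorOfSize s z k → σ.reg 0 = 1) ∧
          (¬ G.HasSeparatorOfSize s z k → σ.reg 0 = 0) :=
  ⟨TemporalPermutation.solve, 5, 20000, fun _ _ _ _ _ _ _ _ _ hτ hπ hsz hl hw =>
    TemporalPermutation.solve_correct hτ hπ hsz hl hw⟩
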